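/- Let $(V,\omega)$ be a real symplectic vector space of dimension $2n$, let $\mathbf J$ be an $\omega$-compatible linear complex structure on $V$ (that is, $\mathbf J^2=-1$, $\mathbf J$ preserves $\omega$, and $\omega(v,\mathbf Jv)>0$ for $v\neq 0$), and let $K$ be the group of linear symplectomorphisms of $V$ that commute with $\mathbf J$. Let $\vec n=(n_0,n_+,n_-)$ be nonnegative integers with $n_0+n_++n_-=n$. *Real subspaces.* For a linear subspace $W\subseteq V$ with symplectic complement $W^\omega$ put $W_0=W\cap W^\omega$; $W$ has type $\vec n$ if $\dim W_0=n_0$ and $\dim W=n_0+2n_+$. Let $\operatorname{Gr}(\vec n)$ be the set of subspaces of type $\vec n$, and $\operatorname{Gr}_{\mathbf J}(\vec n)$ the set of those $W\in\operatorname{Gr}(\vec n)$ for which $W\oplus \mathbf JW_0$ is $\mathbf J$-invariant. *Complex Lagrangian subspaces.* Let $V^{\mathbb C}=\mathbb C\otimes_{\mathbb R}V$, let $\omega^{\mathbb C}$ be the complex bilinear extension of $\omega$, let $\kappa(v,w)=-i\,\omega^{\mathbb C}(v,\overline w)$, and let $\mathbf F_{\pm\mathbf J}\subseteq V^{\mathbb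 C}$ be the $\pm i$-eigenspaces of $\mathbf J$. A complex subspace $\mathbf F\subseteq V^{\mathbb C}$ is complex Lagrangian of type $\vec n$ if $\dim_{\mathbb C}\mathbf F=n$, $\omega^{\mathbb C}|_{\mathbf F}=0$, and $\kappa|_{\mathbf F}$ has an $n_0$-dimensional kernel $\mathbf F_0$ and $n_+$ positive and $n_-$ negative squares. Let $\operatorname{Lag}^{\mathbb C}(\vec n)$ be the set of these, and $\operatorname{Lag}^{\mathbb C}_{\mathbf J}(\vec n)$ the set of those with $\mathbf F=\mathbf F_0\oplus(\mathbf F\cap\mathbf F_{\mathbf J})\oplus(\mathbf F\cap\mathbf F_{-\mathbf J})$. *Splittings.* A splitting of $\mathbf F$ is a triple $(\mathbf F,\mathbf F_+,\mathbf F_-)$ with $\mathbf F=\mathbf F_0\oplus\mathbf F_+\oplus\mathbf F_-$, where $\kappa$ is positive definite on $\mathbf F_+$ and negative definite on $\mathbf F_-$. Two splittings of $\mathbf F$ are equivalent if they give the same pair $(\mathbf F_0\oplus\mathbf F_+,\ \mathbf F_0\oplus\mathbf F_-)$, and a class $\mathbf F^\oplus$ is identified with this pair. Let $\operatorname{Lag}^{\mathbb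 C}_{\oplus}(\vec n)$ be the set of classes of splittings of elements of $\operatorname{Lag}^{\mathbb C}(\vec n)$, and $\operatorname{Lag}^{\mathbb C}_{\mathbf J,\oplus}(\vec n)$ the set of classes of the form $[(\mathbf F,\mathbf F\cap\mathbf F_{\mathbf J},\mathbf F\cap\mathbf F_{-\mathbf J})]$. All these sets carry the smooth structures induced from the real Grassmannians of $V$, the complex Grassmannians of $V^{\mathbb C}$, and products of two of the latter, respectively. **Proposition.** 1. $\operatorname{Gr}_{\mathbf J}(\vec n)$, $\operatorname{Lag}^{\mathbb C}_{\mathbf J}(\vec n)$ and $\operatorname{Lag}^{\mathbb C}_{\mathbf J,\oplus}(\vec n)$ are smooth manifolds, and $K$ acts transitively on each of them. For every point $x$ of any of the three spaces, with stabilizer $K_x$, the orbit map $kK_x\mapsto k.x$ is a diffeomorphism from $K/K_x$ onto that space. Each of the three spaces is diffeomorphic to $$\operatorname{U}(n)/(\operatorname{O}(n_0)\times \operatorname{U}(n_+)\times \operatorname{U}(n_-)),$$ where $\operatorname{O}(n_0)\times \operatorname{U}(n_+)\times \operatorname{U}(n_-)$ is embedded in $\operatorname{U}(n)$ as block diagonal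 matrices. 2. The maps $$\operatorname{Gr}_{\mathbf J}(\vec n)\to \operatorname{Gr}(n_0,0,n-n_0),\quad W\mapsto W\cap W^\omega,$$ $$\operatorname{Lag}^{\mathbb C}_{\mathbf J}(\vec n)\to \operatorname{Gr}(n_0,0,n-n_0),\quad \mathbf F\mapsto \operatorname{Re}\mathbf F_0,$$ $$\operatorname{Lag}^{\mathbb C}_{\mathbf J,\oplus}(\vec n)\to \operatorname{Gr}(n_0,0,n-n_0),\quad [(\mathbf F,\mathbf F_+,\mathbf F_-)]\mapsto \operatorname{Re}\mathbf F_0$$ are well defined smooth fiber bundles, with typical fiber the Grassmannian of complex $n_+$-dimensional subspaces of $\mathbb C^{\,n-n_0}$. -/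

import Mathlib

open Module Diffeology
open scoped TensorProduct Pointwise

noncomputable section

/-! ### Smooth structures

Smooth manifolds, their subsets and their quotients are treated as diffeological spaces, in the
sense of Mathlib. Manifolds form a full subcategory of diffeological spaces. -/

namespace DiffeologicalSpace

/-- The pullback diffeology along `f`: a map into `X` is a plot iff its composite with `f` is. -/
@[reducible]
def induced {X Y : Type*} (f : X → Y) (d : DiffeologicalSpace Y) : DiffeologicalSpace X where
  plots _ := {p | IsPlot (f ∘ p)}
  constant_plots x := isPlot_const (x := f x)
  plot_reparam hp hf := isPlot_reparam (X := Y) hp hf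
  locality hp := d.locality hp

/-- The pushforward (quotient) diffeology along `f`: the smallest diffeology making `f` smooth. -/
@[reducible]
def coinduced {X Y : Type*} (f : X → Y) (d : DiffeologicalSpace X) : DiffeologicalSpace Y :=
  generateFrom {r | ∃ p : EuclideanSpace ℝ (Fin r.1) → X, IsPlot p ∧ r.2 = f ∘ p}

/-- The standard smooth structure of a (finite-dimensional) real vector space: a map
`ℝᵏ → E` is a plot iff its composite with every linear functional is a smooth function. -/
@[reducible]
def ofVectorSpace (E : Type*) [AddCommGroup E] [Module ℝ E] : DiffeologicalSpace E :=
  ⨅ φ : E →ₗ[ℝ] ℝ, induced φ inferInstance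

end DiffeologicalSpace

open DiffeologicalSpace (induced coinduced ofVectorSpace)

/-- Subsets carry the subspace smooth structure. -/
instance instDiffeologicalSpaceSubtype {X : Type*} [d : DiffeologicalSpace X] (P : X → Prop) :
    DiffeologicalSpace {x // P x} :=
  induced Subtype.val d

/-- Products carry the product smooth structure. -/
instance instDiffeologicalSpaceProd {X Y : Type*} [d : DiffeologicalSpace X]
    [d' : DiffeologicalSpace Y] : DiffeologicalSpace (X × Y) :=
  induced Prod.fst d ⊓ induced Prod.snd d'

/-- Spaces of left cosets carry the quotient smooth structure. -/
instance instDiffeologicalSpaceCosets {G : Type*} [Group G] [d : DiffeologicalSpace G]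
    (H : Subgroup G) : DiffeologicalSpace (G ⧸ H) :=
  coinduced (fun g : G => (g : G ⧸ H)) d

instance instDiffeologicalSpaceMatrix {m n : Type*} : DiffeologicalSpace (Matrix m n ℂ) :=
  ofVectorSpace (Matrix m n ℂ)

/-- The general linear group carries its smooth structure as a subset of `End V`. -/
instance instDiffeologicalSpaceLinearEquiv {V : Type*} [AddCommGroup V] [Module ℝ V] :
    DiffeologicalSpace (V ≃ₗ[ℝ] V) :=
  induced (fun g : V ≃ₗ[ℝ] V => (g : V →ₗ[ℝ] V)) (ofVectorSpace (V →ₗ[ℝ] V))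

/-- The Stiefel space of `ℓ`-frames (linearly independent `ℓ`-tuples) of `E`. -/
def Frame (𝕜 E : Type*) [Semiring 𝕜] [AddCommGroup E] [Module 𝕜 E] (ℓ : ℕ) : Type _ :=
  {v : Fin ℓ → E // LinearIndependent 𝕜 v}

/-- The subspace spanned by a frame. -/
def Frame.span {𝕜 E : Type*} [Semiring 𝕜] [AddCommGroup E] [Module 𝕜 E] {ℓ : ℕ}
    (v : Frame 𝕜 E ℓ) : Submodule 𝕜 E :=
  Submodule.span 𝕜 (Set.range v.1)

instance instDiffeologicalSpaceFrame {𝕜 E : Type*} [Semiring 𝕜] [AddCommGroup E] [Module 𝕜 E]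
    [Module ℝ E] (ℓ : ℕ) : DiffeologicalSpace (Frame 𝕜 E ℓ) :=
  induced (fun v : Frame 𝕜 E ℓ => v.1) (ofVectorSpace (Fin ℓ → E))

/-- The smooth structure on the set of all `𝕜`-linear subspaces of `E` (`𝕜 = ℝ` or `ℂ`), that is on
the disjoint union of the Grassmannians `Gr(ℓ; E)`: each `Gr(ℓ; E)` is the quotient of the space of
`ℓ`-frames by the map sending a frame to its span. -/
instance instDiffeologicalSpaceSubmodule {𝕜 E : Type*} [Semiring 𝕜] [Algebra ℝ 𝕜]
    [AddCommGroup E] [Module 𝕜 E] [Module ℝ E] [IsScalarTower ℝ 𝕜 E] :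
    DiffeologicalSpace (Submodule 𝕜 E) :=
  ⨆ ℓ : ℕ, coinduced (Frame.span (𝕜 := 𝕜) (E := E) (ℓ := ℓ)) inferInstance

/-- A bijection that is smooth in both directions. -/
def IsDiffeomorphism {X Y : Type*} [DiffeologicalSpace X] [DiffeologicalSpace Y]
    (Φ : X ≃ Y) : Prop :=
  DSmooth Φ ∧ DSmooth Φ.symm

def Diffeomorphic (X Y : Type*) [DiffeologicalSpace X] [DiffeologicalSpace Y] : Prop :=
  ∃ Φ : X ≃ Y, IsDiffeomorphism Φ

/-- `X` is a smooth manifold of dimension `d`: Hausdorff, second countable, and locally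
diffeomorphic to open subsets of `ℝᵈ`. -/
def IsSmoothManifold (d : ℕ) (X : Type*) [DiffeologicalSpace X] : Prop :=
  @T2Space X dTopology ∧ @SecondCountableTopology X dTopology ∧
    ∀ x : X, ∃ U : Set X, @IsOpen _ dTopology U ∧ x ∈ U ∧
      ∃ O : Set (EuclideanSpace ℝ (Fin d)), IsOpen O ∧ Diffeomorphic U O

/-- `f : E → B` is a smooth fiber bundle with typical fiber `F`: a smooth surjection which over a
neighbourhood of each point of `B` is diffeomorphic to the projection from a product with `F`. -/
def IsSmoothFiberBundle {E B : Type*} [DiffeologicalSpace E] [DiffeologicalSpace B]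
    (F : Type*) [DiffeologicalSpace F] (f : E → B) : Prop :=
  DSmooth f ∧ Function.Surjective f ∧
    ∀ b : B, ∃ U : Set B, @IsOpen _ dTopology U ∧ b ∈ U ∧
      ∃ Φ : (f ⁻¹' U) ≃ U × F, IsDiffeomorphism Φ ∧ ∀ x : f ⁻¹' U, ((Φ x).1 : B) = f x

/-- The orbit map of `K` at `x` descends to a diffeomorphism from `K / Kₓ` onto `S`. -/
def OrbitMapIsDiffeomorphism {G X : Type*} [Group G] [MulAction G X] [DiffeologicalSpace G]
    [DiffeologicalSpace X] (K : Subgroup G) (S : Set X) (x : X) : Prop :=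
  ∃ Φ : (K ⧸ MulAction.stabilizer K x) ≃ S, IsDiffeomorphism Φ ∧
    ∀ k : K, (Φ (k : K ⧸ MulAction.stabilizer K x) : X) = k • x

/-- The Grassmannian of complex `k`-dimensional subspaces of `ℂᵐ`. -/
abbrev ComplexGrassmannian (k m : ℕ) : Type :=
  {L : Submodule ℂ (Fin m → ℂ) // finrank ℂ L = k}

/-- The subgroup `O(n₀) × U(p) × U(q)` of block diagonal matrices in `U(n₀ + p + q)`. -/
def blockSubgroup (n₀ p q : ℕ) :
    Subgroup (Matrix.unitaryGroup (Fin n₀ ⊕ Fin p ⊕ Fin q) ℂ) where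
  carrier := {g | ∃ a ∈ Matrix.orthogonalGroup (Fin n₀) ℝ, ∃ b ∈ Matrix.unitaryGroup (Fin p) ℂ,
    ∃ c ∈ Matrix.unitaryGroup (Fin q) ℂ,
      g.1 = Matrix.fromBlocks (a.map Complex.ofReal) 0 0 (Matrix.fromBlocks b 0 0 c)}
  one_mem' := ⟨1, one_mem _, 1, one_mem _, 1, one_mem _, by simp⟩
  mul_mem' := by
    rintro g g' ⟨a, ha, b, hb, c, hc, h⟩ ⟨a', ha', b', hb', c', hc', h'⟩
    refine ⟨a * a', mul_mem ha ha', b * b', mul_mem hb hb', c * c', mul_mem hc hc', ?_⟩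
    have : (a * a').map Complex.ofReal = a.map Complex.ofReal * a'.map Complex.ofReal :=
      Matrix.map_mul (f := Complex.ofRealHom)
    simp [h, h', Matrix.fromBlocks_multiply, this]
  inv_mem' := by
    rintro g ⟨a, ha, b, hb, c, hc, h⟩
    refine ⟨star a, Unitary.star_mem ha, star b, Unitary.star_mem hb, star c, Unitary.star_mem hc, ?_⟩
    have h1 : ((g⁻¹ : Matrix.unitaryGroup (Fin n₀ ⊕ Fin p ⊕ Fin q) ℂ) :
        Matrix (Fin n₀ ⊕ Fin p ⊕ Fin q) (Fin n₀ ⊕ Fin p ⊕ Fin q) ℂ) =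
        star (g : Matrix (Fin n₀ ⊕ Fin p ⊕ Fin q) (Fin n₀ ⊕ Fin p ⊕ Fin q) ℂ) := rfl
    have h2 : (star a).map Complex.ofReal = (a.map Complex.ofReal).conjTranspose := by
      ext i j; simp [Matrix.star_eq_conjTranspose]
    rw [h1, h, Matrix.star_eq_conjTranspose, Matrix.fromBlocks_conjTranspose,
      Matrix.fromBlocks_conjTranspose, h2]
    simp [Matrix.star_eq_conjTranspose]

/-! ### Symplectic linear algebra -/

section Symplectic

variable {V : Type*} [AddCommGroup V] [Module ℝ V]

/-- The group of linear symplectomorphisms of `(V, ω)`. -/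
def symplecticGroup (ω : LinearMap.BilinForm ℝ V) : Subgroup (V ≃ₗ[ℝ] V) where
  carrier := {g | ∀ v w, ω (g v) (g w) = ω v w}
  one_mem' := fun _ _ => rfl
  mul_mem' := fun {g h} hg hh v w => (hg (h v) (h w)).trans (hh v w)
  inv_mem' := fun {g} hg v w => by
    have := hg (g.symm v) (g.symm w)
    rw [g.apply_symm_apply, g.apply_symm_apply] at this
    exact this.symm

/-- `J` is an `ω`-compatible linear complex structure. -/
structure IsCompatibleComplexStructure (ω : LinearMap.BilinForm ℝ V) (J : V →ₗ[ℝ] V) : Prop where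
  sq : ∀ v, J (J v) = -v
  symplectic : ∀ v w, ω (J v) (J w) = ω v w
  pos : ∀ v, v ≠ 0 → 0 < ω v (J v)

/-- The group `K` of linear symplectomorphisms that commute with `J`. -/
def commutingSymplecticGroup (ω : LinearMap.BilinForm ℝ V) (J : V →ₗ[ℝ] V) :
    Subgroup (V ≃ₗ[ℝ] V) where
  carrier := {g | g ∈ symplecticGroup ω ∧ ∀ v, g (J v) = J (g v)}
  one_mem' := ⟨one_mem _, fun _ => rfl⟩
  mul_mem' := fun {g h} hg hh => ⟨mul_mem hg.1 hh.1, fun v => by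
    change g (h (J v)) = J (g (h v))
    rw [hh.2, hg.2]⟩
  inv_mem' := fun {g} hg => ⟨inv_mem hg.1, fun v => by
    change g.symm (J v) = J (g.symm v)
    rw [LinearEquiv.symm_apply_eq, hg.2, g.apply_symm_apply]⟩

/-- `W₀ = W ∩ W^ω`. -/
def symplecticRadical (ω : LinearMap.BilinForm ℝ V) (W : Submodule ℝ V) : Submodule ℝ V :=
  W ⊓ ω.orthogonal W

/-- `Gr(n₀, p, q)`: real subspaces `W` of type `(n₀, p, q)`, where `dim V = 2 (n₀ + p + q)`. -/
def grassmannianOfType (ω : LinearMap.BilinForm ℝ V) (n₀ p q : ℕ) : Set (Submodule ℝ V) :=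
  {W | finrank ℝ V = 2 * (n₀ + p + q) ∧ finrank ℝ (symplecticRadical ω W) = n₀ ∧
    finrank ℝ W = n₀ + 2 * p}

/-- `Gr_J(n₀, p, q)`: those `W` of type `(n₀, p, q)` for which `W ⊕ J W₀` is `J`-invariant (the sum
is always direct when `J` is `ω`-compatible). -/
def grassmannianJ (ω : LinearMap.BilinForm ℝ V) (J : V →ₗ[ℝ] V) (n₀ p q : ℕ) :
    Set (Submodule ℝ V) :=
  {W | W ∈ grassmannianOfType ω n₀ p q ∧
    ∀ v ∈ W ⊔ (symplecticRadical ω W).map J, J v ∈ W ⊔ (symplecticRadical ω W).map J}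

/-! ### Complex Lagrangian subspaces of the complexification `ℂ ⊗ V` -/

/-- Complex conjugation on `ℂ ⊗ V`. -/
def conjC : ℂ ⊗[ℝ] V →ₗ[ℝ] ℂ ⊗[ℝ] V :=
  LinearMap.rTensor V Complex.conjAe.toLinearMap

/-- The real part `ℂ ⊗ V → V`, `a ⊗ v ↦ Re(a) v`. -/
def rePart : ℂ ⊗[ℝ] V →ₗ[ℝ] V :=
  (TensorProduct.lid ℝ V).toLinearMap ∘ₗ LinearMap.rTensor V Complex.reLm

/-- The hermitian form `κ(v, w) = -i ω^ℂ(v, w̄)`. -/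
def kappa (ω : LinearMap.BilinForm ℝ V) (v w : ℂ ⊗[ℝ] V) : ℂ :=
  -Complex.I * LinearMap.BilinForm.baseChange ℂ ω v (conjC w)

/-- `F₀`, the kernel of the restriction of `κ` to `F`. -/
def kappaKernel (ω : LinearMap.BilinForm ℝ V) (F : Submodule ℂ (ℂ ⊗[ℝ] V)) :
    Submodule ℂ (ℂ ⊗[ℝ] V) where
  carrier := {v | v ∈ F ∧ ∀ w ∈ F, kappa ω v w = 0}
  zero_mem' := ⟨zero_mem _, fun w _ => by simp [kappa]⟩
  add_mem' := fun {a b} ha hb => ⟨add_mem ha.1 hb.1, fun w hw => by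
    have h1 := ha.2 w hw
    have h2 := hb.2 w hw
    simp only [kappa, map_add, LinearMap.add_apply, mul_add] at h1 h2 ⊢
    rw [h1, h2, add_zero]⟩
  smul_mem' := fun c {a} ha => ⟨F.smul_mem c ha.1, fun w hw => by
    have h1 := ha.2 w hw
    simp only [kappa, map_smul, LinearMap.smul_apply, smul_eq_mul] at h1 ⊢
    rw [mul_left_comm, h1, mul_zero]⟩

/-- `κ` is positive definite on `P`. -/
def KappaPos (ω : LinearMap.BilinForm ℝ V) (P : Submodule ℂ (ℂ ⊗[ℝ] V)) : Prop :=
  ∀ v ∈ P, v ≠ 0 → 0 < (kappa ω v v).re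

/-- `-κ` is positive definite on `N`. -/
def KappaNeg (ω : LinearMap.BilinForm ℝ V) (N : Submodule ℂ (ℂ ⊗[ℝ] V)) : Prop :=
  ∀ v ∈ N, v ≠ 0 → (kappa ω v v).re < 0

/-- `F` is a complex Lagrangian subspace: `dim_ℂ F = n = dim V / 2` and `ω^ℂ` vanishes on `F`. -/
def IsComplexLagrangian (ω : LinearMap.BilinForm ℝ V) (F : Submodule ℂ (ℂ ⊗[ℝ] V)) : Prop :=
  2 * finrank ℂ F = finrank ℝ V ∧
    ∀ v ∈ F, ∀ w ∈ F, LinearMap.BilinForm.baseChange ℂ ω v w = 0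

/-- `Lag^ℂ(n₀, p, q)`: complex Lagrangian subspaces `F` on which `κ` has inertia `(n₀, p, q)`
(dimension of the kernel, and largest dimensions of a positive and of a negative definite
subspace). -/
def lagrangianOfType (ω : LinearMap.BilinForm ℝ V) (n₀ p q : ℕ) :
    Set (Submodule ℂ (ℂ ⊗[ℝ] V)) :=
  {F | IsComplexLagrangian ω F ∧ finrank ℂ (kappaKernel ω F) = n₀ ∧
    IsGreatest {k | ∃ P ≤ F, KappaPos ω P ∧ finrank ℂ P = k} p ∧
    IsGreatest {k | ∃ N ≤ F, KappaNeg ω N ∧ finrank ℂ N = k} q}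

/-- `F_J`, the `+i`-eigenspace of `J` in `ℂ ⊗ V`. -/
def eigenPlus (J : V →ₗ[ℝ] V) : Submodule ℂ (ℂ ⊗[ℝ] V) :=
  Module.End.eigenspace (J.baseChange ℂ) Complex.I

/-- `F_{-J}`, the `-i`-eigenspace of `J` in `ℂ ⊗ V`. -/
def eigenMinus (J : V →ₗ[ℝ] V) : Submodule ℂ (ℂ ⊗[ℝ] V) :=
  Module.End.eigenspace (J.baseChange ℂ) (-Complex.I)

/-- `(F, P, N)` is a splitting of `F`: `F = F₀ ⊕ P ⊕ N` with `κ` positive definite on `P` and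
negative definite on `N`. -/
structure IsSplitting (ω : LinearMap.BilinForm ℝ V) (F P N : Submodule ℂ (ℂ ⊗[ℝ] V)) : Prop where
  disjoint_pos : Disjoint (kappaKernel ω F) P
  disjoint_neg : Disjoint (kappaKernel ω F ⊔ P) N
  sup_eq : kappaKernel ω F ⊔ P ⊔ N = F
  pos : KappaPos ω P
  neg : KappaNeg ω N

/-- `Lag^ℂ_J(n₀, p, q)`: those `F` of type `(n₀, p, q)` with
`F = F₀ ⊕ (F ∩ F_J) ⊕ (F ∩ F_{-J})`. -/
def lagrangianJ (ω : LinearMap.BilinForm ℝ V) (J : V →ₗ[ℝ] V) (n₀ p q : ℕ) :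
    Set (Submodule ℂ (ℂ ⊗[ℝ] V)) :=
  {F | F ∈ lagrangianOfType ω n₀ p q ∧
    Disjoint (kappaKernel ω F) (F ⊓ eigenPlus J) ∧
    Disjoint (kappaKernel ω F ⊔ F ⊓ eigenPlus J) (F ⊓ eigenMinus J) ∧
    kappaKernel ω F ⊔ F ⊓ eigenPlus J ⊔ F ⊓ eigenMinus J = F}

/-- The equivalence class of the splitting `(F, P, N)`, recorded as the pair
`(F₀ ⊕ P, F₀ ⊕ N)`: two splittings of `F` are equivalent iff these pairs agree, and the pair
determines `F` as the sum of its two members. -/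
def splittingClass (ω : LinearMap.BilinForm ℝ V) (F P N : Submodule ℂ (ℂ ⊗[ℝ] V)) :
    Submodule ℂ (ℂ ⊗[ℝ] V) × Submodule ℂ (ℂ ⊗[ℝ] V) :=
  (kappaKernel ω F ⊔ P, kappaKernel ω F ⊔ N)

/-- `Lag^ℂ_⊕(n₀, p, q)`: equivalence classes of complex Lagrangian subspaces with splittings. -/
def splitLagrangianOfType (ω : LinearMap.BilinForm ℝ V) (n₀ p q : ℕ) :
    Set (Submodule ℂ (ℂ ⊗[ℝ] V) × Submodule ℂ (ℂ ⊗[ℝ] V)) :=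
  {A | ∃ F ∈ lagrangianOfType ω n₀ p q, ∃ P N, IsSplitting ω F P N ∧ A = splittingClass ω F P N}

/-- `Lag^ℂ_{J,⊕}(n₀, p, q)`: the classes in `Lag^ℂ_⊕(n₀, p, q)` represented by the splitting
`(F, F ∩ F_J, F ∩ F_{-J})`. -/
def splitLagrangianJ (ω : LinearMap.BilinForm ℝ V) (J : V →ₗ[ℝ] V) (n₀ p q : ℕ) :
    Set (Submodule ℂ (ℂ ⊗[ℝ] V) × Submodule ℂ (ℂ ⊗[ℝ] V)) :=
  {A | A ∈ splitLagrangianOfType ω n₀ p q ∧ ∃ F ∈ lagrangianOfType ω n₀ p q,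
    IsSplitting ω F (F ⊓ eigenPlus J) (F ⊓ eigenMinus J) ∧
    A = splittingClass ω F (F ⊓ eigenPlus J) (F ⊓ eigenMinus J)}

/-- The forgetful map `φ`, sending the class of a splitting of `F` to `F`. -/
def forgetSplitting (A : Submodule ℂ (ℂ ⊗[ℝ] V) × Submodule ℂ (ℂ ⊗[ℝ] V)) :
    Submodule ℂ (ℂ ⊗[ℝ] V) :=
  A.1 ⊔ A.2

/-- The reduction map `F ↦ Re F₀`. -/
def reKernel (ω : LinearMap.BilinForm ℝ V) (F : Submodule ℂ (ℂ ⊗[ℝ] V)) : Submodule ℝ V :=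
  ((kappaKernel ω F).restrictScalars ℝ).map rePart

/-- The reduction map `α`, sending the class of a splitting of `F` to `Re F₀`. -/
def alphaMap (ω : LinearMap.BilinForm ℝ V)
    (A : Submodule ℂ (ℂ ⊗[ℝ] V) × Submodule ℂ (ℂ ⊗[ℝ] V)) : Submodule ℝ V :=
  reKernel ω (forgetSplitting A)

/-- The linear action `g.F = {g v : v ∈ F}` of real linear automorphisms of `V` on complex
subspaces of `ℂ ⊗ V`. -/
instance instMulActionComplexSubspace :
    MulAction (V ≃ₗ[ℝ] V) (Submodule ℂ (ℂ ⊗[ℝ] V)) where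
  smul g F := F.map ((g : V →ₗ[ℝ] V).baseChange ℂ)
  one_smul F := by
    change F.map (LinearMap.baseChange ℂ (LinearMap.id : V →ₗ[ℝ] V)) = F
    rw [LinearMap.baseChange_id, Submodule.map_id]
  mul_smul g h F := by
    change F.map (LinearMap.baseChange ℂ ((g : V →ₗ[ℝ] V) ∘ₗ (h : V →ₗ[ℝ] V))) =
      Submodule.map _ (Submodule.map _ F)
    rw [LinearMap.baseChange_comp, Submodule.map_comp]

end Symplectic

end

noncomputable section

open scoped ContDiff Topology
open DiffeologicalSpace (induced coinduced ofVectorSpace generateFrom)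
open OpenPartialHomeomorph (univBall univBall_source univBall_target univBall_apply_zero
  contDiff_univBall contDiffOn_univBall_symm)

/-! ### Plots and local lifts -/

/-! The form `ω v (J w) + i ω v w` is a hermitian inner product on `V` for the complex structure
`J`. An orthonormal basis therefore identifies `V` with `ℂⁿ`, `J` with multiplication by `i`, and
`K` with `U(n)` (`exists_isUnitaryChart`, `exists_chartRot_eq`). Colour the coordinates by `0, 1,
2`, in blocks of sizes `n₀`, `p`, `q`. The complexification becomes a sum of `n` copies of `ℂ × ℂ`,
whose two factors are the eigenspaces of `J`, and `κ` becomes `½ ∑ (|zᵢ|² - |wᵢ|²)`.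

Each of the three spaces contains a coordinate model: `ℝ^{n₀} ⊕ ℂ^p ⊕ 0` for real subspaces; for
Lagrangians, the diagonal, the first factor or the second factor of `ℂ × ℂ` according to colour; for
splittings, the corresponding pair. Every other element is a unitary rotation of the model: an
orthonormal basis of the isotropic real part and one of the complex part orthogonal to it extend
together to a unitary matrix (`exists_unitary_adapted`).

All questions of smoothness pass through one concrete orbit, `modelSet`: the orbit of the diagonal
projections `(D₀, D₁)` under `u · (S, P) = (u S uᵀ, u P u*)`, with stabilizer `O(n₀) × U(p) × U(q)`
(`isBlock_iff`, `mem_blockSubgroup_iff`). Gram-Schmidt gives the orbit map smooth local sections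
(`exists_section`). Hence the orbit carries the quotient smooth structure, it is a smooth local
retract of the space of matrix pairs and so a manifold, and an equivariant smooth map onto such an
orbit is a fiber bundle.

To compare the three spaces with this orbit, their orbit maps are inverted smoothly. The orthogonal
projection onto a rotated model inside `ℂ²ⁿ` has upper blocks `½ u D₀ u* + u D₁ u*` and `½ u D₀ uᵀ`,
from which `u D₀ uᵀ` and `u D₁ u*` are recovered polynomially (`modelInvariant_coordSub`).
Projections vary smoothly with the subspace (`contDiff_starProjection_map`). Real subspaces are
complexified first, and a splitting class is represented by its first member.

The reduction maps correspond to forgetting `P`. Their target is the model for the colouring with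
colour `1` merged into colour `2`, and the fiber over the base point consists of the rank `p`
orthogonal projections of `ℂ^{p+q}`, that is, of a Grassmannian
(`exists_diffeomorphism_modelFiber`). -/

abbrev Eucl (n : ℕ) : Type := EuclideanSpace ℝ (Fin n)

namespace Diffeology

lemma univBall_mem_ball {n : ℕ} (c : Eucl n) {r : ℝ} (hr : 0 < r) (x : Eucl n) :
    univBall c r x ∈ Metric.ball c r := by
  have h := (univBall c r).map_source (x := x) (by simp [univBall_source])
  rwa [univBall_target c hr] at h

/-- A smooth map factors locally through a local diffeomorphism with smooth inverse. -/
lemma exists_factor_univBall {m n : ℕ} {g : Eucl m → Eucl n} (hg : ContDiff ℝ ∞ g)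
    (e : OpenPartialHomeomorph (Eucl n) (Eucl n)) (he : ContDiffOn ℝ ∞ e.symm e.target)
    (s₀ : Eucl m) (hs : g s₀ ∈ e.target) :
    ∃ r > 0, ∃ h : Eucl m → Eucl n, ContDiff ℝ ∞ h ∧
      ∀ s, g (univBall s₀ r s) = e (h s) := by
  obtain ⟨r, hr, hball⟩ := Metric.isOpen_iff.mp (e.open_target.preimage hg.continuous) s₀ hs
  have hmem : ∀ s, g (univBall s₀ r s) ∈ e.target := fun s => hball (univBall_mem_ball s₀ hr s)
  refine ⟨r, hr, fun s => e.symm (g (univBall s₀ r s)), ?_, fun s => ?_⟩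
  · rw [← contDiffOn_univ]
    exact he.comp (hg.comp contDiff_univBall).contDiffOn fun s _ => hmem s
  · exact (e.right_inv (hmem s)).symm

/-- Serves the reparametrization axiom in `ofLocalLifts`: a lift over a ball about `g s₀` pulls back
to a lift over a small ball about `s₀`. -/
lemma exists_univBall_eq_univBall {m n : ℕ} {g : Eucl m → Eucl n} (hg : ContDiff ℝ ∞ g)
    (s₀ : Eucl m) {r : ℝ} (hr : 0 < r) :
    ∃ r' > 0, ∃ h : Eucl m → Eucl n, ContDiff ℝ ∞ h ∧
      ∀ s, g (univBall s₀ r' s) = univBall (g s₀) r (h s) :=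
  exists_factor_univBall hg _
    (by rw [univBall_target _ hr]; exact contDiffOn_univBall_symm) s₀
    (by rw [univBall_target _ hr]; exact Metric.mem_ball_self hr)

/-- Serves the locality axiom in `ofLocalLifts`: there a lift is only known after two nested ball
parametrizations, and a smaller ball about `t` factors through both. -/
lemma exists_univBall_eq_comp {n : ℕ} (t : Eucl n) {r r₁ : ℝ} (hr : 0 < r) (hr₁ : 0 < r₁) :
    ∃ r' > 0, ∃ h : Eucl n → Eucl n, ContDiff ℝ ∞ h ∧
      ∀ s, univBall t r' s = univBall t r (univBall 0 r₁ (h s)) := by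
  have h0 : (univBall t r).symm t = 0 := by
    have := (univBall t r).left_inv (x := 0) (by simp [univBall_source])
    rwa [univBall_apply_zero] at this
  have htar : ((univBall (0 : Eucl n) r₁).trans (univBall t r)).target =
      Metric.ball t r ∩ (univBall t r).symm ⁻¹' Metric.ball 0 r₁ := by
    rw [OpenPartialHomeomorph.trans_target, univBall_target _ hr, univBall_target _ hr₁]
  refine exists_factor_univBall contDiff_id ((univBall (0 : Eucl n) r₁).trans (univBall t r))
    ?_ t ?_
  · rw [htar]
    have h1 : ContDiffOn ℝ ∞ (univBall (0 : Eucl n) r₁).symm (Metric.ball 0 r₁) :=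
      contDiffOn_univBall_symm
    have h2 : ContDiffOn ℝ ∞ (univBall t r).symm
        (Metric.ball t r ∩ (univBall t r).symm ⁻¹' Metric.ball 0 r₁) :=
      ContDiffOn.mono contDiffOn_univBall_symm Set.inter_subset_left
    rw [OpenPartialHomeomorph.coe_trans_symm]
    have hst : Set.MapsTo (univBall t r).symm
        (Metric.ball t r ∩ (univBall t r).symm ⁻¹' Metric.ball 0 r₁) (Metric.ball 0 r₁) :=
      Set.inter_subset_right
    exact ContDiffOn.comp h1 h2 hst
  · rw [htar]
    refine Set.mem_inter (Metric.mem_ball_self hr) ?_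
    rw [Set.mem_preimage, id, h0]
    exact Metric.mem_ball_self hr₁

/-- `univBall` parametrizes a ball by the whole Euclidean space, so locality can be tested on these
maps alone: any smooth `f` into the ball is `univBall` composed with a globally defined smooth map.
-/
lemma isPlot_of_local {X : Type*} [DiffeologicalSpace X] {n : ℕ} {p : Eucl n → X}
    (h : ∀ t, ∃ r > 0, IsPlot fun s => p (univBall t r s)) : IsPlot p := by
  refine DiffeologicalSpace.locality fun t => ?_
  obtain ⟨r, hr, hp⟩ := h t
  refine ⟨Metric.ball t r, Metric.isOpen_ball, Metric.mem_ball_self hr, fun {m f} hf hfs => ?_⟩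
  have hsm : ContDiff ℝ ∞ fun s => (univBall t r).symm (f s) := by
    rw [← contDiffOn_univ]
    exact contDiffOn_univBall_symm.comp hfs.contDiffOn fun s _ => hf s
  have := isPlot_reparam hp hsm
  convert! this using 1
  funext s
  simp only [Function.comp]
  rw [(univBall t r).right_inv (by rw [univBall_target t hr]; exact hf s)]

/-- The diffeology whose plots are the maps that lift locally through one of the `f i`. -/
@[reducible]
def ofLocalLifts {I Y : Type*} {X : I → Type*} [∀ i, DiffeologicalSpace (X i)]
    (f : ∀ i, X i → Y) (hf : ∀ y, ∃ i, ∃ x, f i x = y) : DiffeologicalSpace Y where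
  plots n := {p | ∀ t : Eucl n, ∃ r > 0, ∃ i, ∃ q : Eucl n → X i, IsPlot q ∧
    ∀ s, p (univBall t r s) = f i (q s)}
  constant_plots y := fun t => by
    obtain ⟨i, x, hx⟩ := hf y
    exact ⟨1, one_pos, i, fun _ => x, isPlot_const, fun s => hx.symm⟩
  plot_reparam {n m p g} hp hg := fun t => by
    obtain ⟨r, hr, i, q, hq, hpq⟩ := hp (g t)
    obtain ⟨r', hr', h, hh, hgh⟩ := exists_univBall_eq_univBall hg t hr
    exact ⟨r', hr', i, q ∘ h, isPlot_reparam hq hh, fun s => by simp [hgh, hpq]⟩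
  locality {n p} hp := fun t => by
    obtain ⟨u, hu, htu, hpu⟩ := hp t
    obtain ⟨r, hr, hru⟩ := Metric.isOpen_iff.mp hu t htu
    obtain ⟨r₁, hr₁, i, q, hq, hpq⟩ := hpu (f := univBall t r)
      (fun x => hru (univBall_mem_ball t hr x)) contDiff_univBall 0
    obtain ⟨r₂, hr₂, h, hh, hgh⟩ := exists_univBall_eq_comp t hr hr₁
    refine ⟨r₂, hr₂, i, q ∘ h, isPlot_reparam hq hh, fun s => ?_⟩
    rw [hgh]
    exact hpq (h s)

theorem isPlot_coinduced_comp {X Y : Type*} [d : DiffeologicalSpace X] (f : X → Y) {n : ℕ}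
    {q : Eucl n → X} (hq : IsPlot q) : @IsPlot Y (coinduced f d) n (f ∘ q) :=
  DiffeologicalSpace.isPlot_generatedFrom_of_mem ⟨q, hq, rfl⟩

/-- The supremum is the smallest diffeology making every `f i` smooth, and `ofLocalLifts` is one
such diffeology; comparing them turns abstract plots into local lifts. -/
theorem exists_lift_of_isPlot_iSup_coinduced {I Y : Type*} {X : I → Type*}
    [d : ∀ i, DiffeologicalSpace (X i)] (f : ∀ i, X i → Y) (hf : ∀ y, ∃ i, ∃ x, f i x = y) {n : ℕ}
    {p : Eucl n → Y} (hp : @IsPlot Y (⨆ i, coinduced (f i) (d i)) n p) (t : Eucl n) :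
    ∃ r > 0, ∃ i, ∃ q : Eucl n → X i, IsPlot q ∧ ∀ s, p (univBall t r s) = f i (q s) := by
  have hle : (⨆ i, coinduced (f i) (d i)) ≤ ofLocalLifts f hf := by
    refine iSup_le fun i => ?_
    rw [DiffeologicalSpace.generateFrom_le_iff]
    rintro n p ⟨q, hq, hpq⟩
    exact fun t => ⟨1, one_pos, i, q ∘ univBall t 1, isPlot_reparam hq contDiff_univBall,
      fun s => congrFun hpq _⟩
  exact DiffeologicalSpace.le_iff'.1 hle n p hp t

theorem isPlot_iSup_coinduced_comp {I Y : Type*} {X : I → Type*}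
    [d : ∀ i, DiffeologicalSpace (X i)] (f : ∀ i, X i → Y) {n : ℕ} (i : I)
    {q : Eucl n → X i} (hq : IsPlot q) :
    @IsPlot Y (⨆ i, coinduced (f i) (d i)) n (f i ∘ q) :=
  DiffeologicalSpace.le_iff'.1 (le_iSup (fun i => coinduced (f i) (d i)) i) n _
    (isPlot_coinduced_comp (f i) hq)

/-- Every plot of the target lifts locally to a plot of the source. -/
def LocallyLifts {X Y : Type*} [DiffeologicalSpace X] [DiffeologicalSpace Y] (f : X → Y) : Prop :=
  ∀ (n : ℕ) (p : Eucl n → Y), IsPlot p → ∀ t, ∃ r > 0, ∃ q : Eucl n → X, IsPlot q ∧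
    ∀ s, p (univBall t r s) = f (q s)

section

variable {X Y Z : Type*} [DiffeologicalSpace X] [DiffeologicalSpace Y] [DiffeologicalSpace Z]

lemma LocallyLifts.dSmooth {f : X → Y} (hf : LocallyLifts f) {g : Y → Z}
    (hg : DSmooth (g ∘ f)) : DSmooth g := fun n p hp => isPlot_of_local fun t => by
  obtain ⟨r, hr, q, hq, hpq⟩ := hf n p hp t
  refine ⟨r, hr, ?_⟩
  have := hg n q hq
  convert! this using 1
  funext s
  simp [hpq]

lemma dSmooth_subtype_val {P : X → Prop} : DSmooth (Subtype.val : {x // P x} → X) :=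
  fun _ _ hp => hp

lemma dSmooth_subtype_iff {P : Y → Prop} {f : X → {y // P y}} :
    DSmooth f ↔ DSmooth fun x => (f x : Y) :=
  Iff.rfl

lemma isPlot_subtype_iff {P : Y → Prop} {n : ℕ} {p : Eucl n → {y // P y}} :
    IsPlot p ↔ IsPlot fun t => (p t : Y) :=
  Iff.rfl

lemma isPlot_prod_iff {n : ℕ} {p : Eucl n → X × Y} :
    IsPlot p ↔ (IsPlot fun t => (p t).1) ∧ IsPlot fun t => (p t).2 :=
  DiffeologicalSpace.isPlot_inf_iff

lemma dSmooth_fst : DSmooth (Prod.fst : X × Y → X) := fun _ _ hp => (isPlot_prod_iff.1 hp).1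

lemma dSmooth_snd : DSmooth (Prod.snd : X × Y → Y) := fun _ _ hp => (isPlot_prod_iff.1 hp).2

lemma DSmooth.prodMk {f : X → Y} {g : X → Z} (hf : DSmooth f) (hg : DSmooth g) :
    DSmooth fun x => (f x, g x) :=
  fun n p hp => isPlot_prod_iff.2 ⟨hf n p hp, hg n p hp⟩

end

/-! ### Quotients of groups -/

section Quotient

variable {G Y : Type*} [Group G] [d : DiffeologicalSpace G] [DiffeologicalSpace Y]

lemma dSmooth_mk (H : Subgroup G) : DSmooth (fun g : G => (g : G ⧸ H)) :=
  fun _ _ hp => isPlot_coinduced_comp _ hp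

lemma locallyLifts_mk (H : Subgroup G) : LocallyLifts (fun g : G => (g : G ⧸ H)) := by
  intro n p hp t
  -- A single coinduced diffeology is viewed as a supremum over a one-point family, to use the
  -- lifting theorem for suprema.
  have hp' : @IsPlot _ (⨆ _ : Unit, coinduced (fun g : G => (g : G ⧸ H)) d) n p := by
    rwa [iSup_const]
  obtain ⟨r, hr, -, q, hq, h⟩ := exists_lift_of_isPlot_iSup_coinduced
    (fun _ : Unit => fun g : G => (g : G ⧸ H))
    (fun y => ⟨(), Quotient.exists_rep y⟩) hp' t
  exact ⟨r, hr, q, hq, h⟩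

/-- A smooth surjection with local lifts whose fibers are the left cosets of `H` identifies its
target with `G ⧸ H`. -/
theorem exists_diffeomorphism_quotient (H : Subgroup G) {f : G → Y} (hf : DSmooth f)
    (hl : LocallyLifts f) (hs : Function.Surjective f)
    (hH : ∀ g g', f g = f g' ↔ g⁻¹ * g' ∈ H) :
    ∃ Φ : (G ⧸ H) ≃ Y, IsDiffeomorphism Φ ∧ ∀ g : G, Φ (g : G ⧸ H) = f g := by
  let φ : G ⧸ H → Y := Quotient.lift f fun a b hab =>
    (hH a b).2 (QuotientGroup.leftRel_apply.1 hab)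
  have hφ : ∀ g : G, φ (g : G ⧸ H) = f g := fun g => rfl
  have hb : Function.Bijective φ := by
    refine ⟨fun a b hab => ?_, fun y => ?_⟩
    · induction a using QuotientGroup.induction_on with | _ a
      induction b using QuotientGroup.induction_on with | _ b
      exact QuotientGroup.eq.2 ((hH a b).1 hab)
    · obtain ⟨g, rfl⟩ := hs y
      exact ⟨g, rfl⟩
  refine ⟨Equiv.ofBijective φ hb, ⟨(locallyLifts_mk H).dSmooth hf, hl.dSmooth ?_⟩, hφ⟩
  have : (Equiv.ofBijective φ hb).symm ∘ f = fun g : G => (g : G ⧸ H) := by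
    funext g
    exact (Equiv.symm_apply_eq _).2 rfl
  rw [this]
  exact dSmooth_mk H

end Quotient

end Diffeology

/-! ### Diffeomorphisms -/

section Diffeo

variable {X Y Z : Type*} [DiffeologicalSpace X] [DiffeologicalSpace Y] [DiffeologicalSpace Z]

lemma IsDiffeomorphism.symm {Φ : X ≃ Y} (h : IsDiffeomorphism Φ) : IsDiffeomorphism Φ.symm :=
  ⟨h.2, h.1⟩

lemma IsDiffeomorphism.trans {Φ : X ≃ Y} {Ψ : Y ≃ Z} (h : IsDiffeomorphism Φ)
    (h' : IsDiffeomorphism Ψ) : IsDiffeomorphism (Φ.trans Ψ) :=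
  ⟨h'.1.comp h.1, h.2.comp h'.2⟩

/-- The restriction of a bijection to the preimage of a set. -/
def Equiv.preimageEquiv {X Y : Type*} (Φ : X ≃ Y) (U : Set Y) : (Φ ⁻¹' U : Set X) ≃ U :=
  Φ.subtypeEquiv fun _ => Iff.rfl

lemma IsDiffeomorphism.preimageEquiv {Φ : X ≃ Y} (h : IsDiffeomorphism Φ) (U : Set Y) :
    IsDiffeomorphism (Φ.preimageEquiv U) :=
  ⟨h.1.comp dSmooth_subtype_val, h.2.comp dSmooth_subtype_val⟩

/-- A diffeomorphism as a homeomorphism of D-topologies. -/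
def IsDiffeomorphism.homeomorph {Φ : X ≃ Y} (h : IsDiffeomorphism Φ) :
    @Homeomorph X Y dTopology dTopology :=
  let _ : TopologicalSpace X := dTopology
  let _ : TopologicalSpace Y := dTopology
  { Φ with
    continuous_toFun := h.1.continuous
    continuous_invFun := h.2.continuous }

lemma DSmooth.isOpen_preimage {f : X → Y} (h : DSmooth f) {U : Set Y}
    (hU : @IsOpen _ dTopology U) : @IsOpen _ dTopology (f ⁻¹' U) :=
  @IsOpen.preimage X Y dTopology dTopology f h.continuous U hU

theorem IsSmoothManifold.of_diffeomorphic {d : ℕ} (hX : IsSmoothManifold d X)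
    (h : Diffeomorphic X Y) : IsSmoothManifold d Y := by
  obtain ⟨Φ, hΦ⟩ := h
  obtain ⟨h2, hsc, hc⟩ := hX
  refine ⟨?_, ?_, fun y => ?_⟩
  · let _ : TopologicalSpace X := dTopology
    let _ : TopologicalSpace Y := dTopology
    exact hΦ.homeomorph.t2Space
  · let _ : TopologicalSpace X := dTopology
    let _ : TopologicalSpace Y := dTopology
    exact hΦ.homeomorph.symm.secondCountableTopology
  · obtain ⟨U, hU, hx, O, hO, Ψ, hΨ⟩ := hc (Φ.symm y)
    exact ⟨Φ.symm ⁻¹' U, DSmooth.isOpen_preimage hΦ.2 hU, hx, O, hO, _,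
      (hΦ.symm.preimageEquiv U).trans hΨ⟩

theorem IsSmoothFiberBundle.of_diffeomorphisms {E B E' B' F : Type*} [DiffeologicalSpace E]
    [DiffeologicalSpace B] [DiffeologicalSpace E'] [DiffeologicalSpace B'] [DiffeologicalSpace F]
    {f : E → B} (hf : IsSmoothFiberBundle F f) {f' : E' → B'} (Φ : E' ≃ E)
    (hΦ : IsDiffeomorphism Φ) (Ψ : B' ≃ B) (hΨ : IsDiffeomorphism Ψ)
    (h : ∀ x, Ψ (f' x) = f (Φ x)) : IsSmoothFiberBundle F f' := by
  obtain ⟨h1, h2, h3⟩ := hf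
  have hf' : f' = Ψ.symm ∘ f ∘ Φ := by
    funext x
    exact ((Equiv.symm_apply_eq _).2 (h x).symm).symm
  refine ⟨?_, ?_, fun b => ?_⟩
  · rw [hf']
    exact hΨ.2.comp (h1.comp hΦ.1)
  · rw [hf']
    exact Ψ.symm.surjective.comp (h2.comp Φ.surjective)
  · obtain ⟨U, hU, hb, Θ, hΘ, hΘf⟩ := h3 (Ψ b)
    have hpre : f' ⁻¹' (Ψ ⁻¹' U) = Φ ⁻¹' (f ⁻¹' U) := by
      ext x
      simp [h]
    refine ⟨Ψ ⁻¹' U, DSmooth.isOpen_preimage hΨ.1 hU, hb, ?_⟩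
    rw [hpre]
    let A := (Φ.preimageEquiv (f ⁻¹' U)).trans Θ
    refine ⟨A.trans (Equiv.prodCongr (Ψ.preimageEquiv U).symm (Equiv.refl F)), ⟨?_, ?_⟩, ?_⟩
    · have hA := ((hΦ.preimageEquiv (f ⁻¹' U)).trans hΘ).1
      exact ((hΨ.preimageEquiv U).2.comp (dSmooth_fst.comp hA)).prodMk (dSmooth_snd.comp hA)
    · have hA := ((hΦ.preimageEquiv (f ⁻¹' U)).trans hΘ).2
      exact hA.comp (((hΨ.preimageEquiv U).1.comp dSmooth_fst).prodMk dSmooth_snd)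
    · intro x
      have := hΘf (Φ.preimageEquiv (f ⁻¹' U) x)
      change Ψ.symm ((Θ (Φ.preimageEquiv (f ⁻¹' U) x)).1 : B) = f' x
      rw [this, hf']
      rfl

end Diffeo

/-! ### Vector spaces -/

namespace Diffeology

variable {E F : Type*} [AddCommGroup E] [Module ℝ E] [AddCommGroup F] [Module ℝ F]

lemma isPlot_ofVectorSpace_iff {n : ℕ} {p : Eucl n → E} :
    @IsPlot E (ofVectorSpace E) n p ↔ ∀ φ : E →ₗ[ℝ] ℝ, ContDiff ℝ ∞ fun t => φ (p t) :=
  DiffeologicalSpace.isPlot_iInf_iff.trans (forall_congr' fun _ => Iff.rfl)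

lemma isPlot_ofVectorSpace_comp {n : ℕ} {p : Eucl n → E} (hp : @IsPlot E (ofVectorSpace E) n p)
    (L : E →ₗ[ℝ] F) : @IsPlot F (ofVectorSpace F) n fun t => L (p t) :=
  isPlot_ofVectorSpace_iff.2 fun φ => isPlot_ofVectorSpace_iff.1 hp (φ ∘ₗ L)

/-- In finite dimensions a map is the sum of its coordinate functionals times basis vectors, so
testing on functionals detects smoothness. -/
lemma isPlot_ofVectorSpace_iff_contDiff {E : Type*} [NormedAddCommGroup E] [NormedSpace ℝ E]
    [FiniteDimensional ℝ E] {n : ℕ} {p : Eucl n → E} :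
    @IsPlot E (ofVectorSpace E) n p ↔ ContDiff ℝ ∞ p := by
  rw [isPlot_ofVectorSpace_iff]
  constructor
  · intro h
    let b := Module.finBasis ℝ E
    have : p = fun t => ∑ i, b.coord i (p t) • b i := by
      funext t
      exact (b.sum_repr (p t)).symm
    rw [this]
    exact ContDiff.sum fun i _ => (h (b.coord i)).smul contDiff_const
  · intro h φ
    exact (LinearMap.toContinuousLinearMap φ).contDiff.comp h

lemma isContDiffCompatible_ofVectorSpace (E : Type*) [NormedAddCommGroup E] [NormedSpace ℝ E]
    [FiniteDimensional ℝ E] : @IsContDiffCompatible E _ _ (ofVectorSpace E) :=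
  let _ := ofVectorSpace E
  ⟨isPlot_ofVectorSpace_iff_contDiff⟩

instance {E F : Type*} [NormedAddCommGroup E] [NormedSpace ℝ E] [DiffeologicalSpace E]
    [IsContDiffCompatible E] [NormedAddCommGroup F] [NormedSpace ℝ F] [DiffeologicalSpace F]
    [IsContDiffCompatible F] : IsContDiffCompatible (E × F) where
  isPlot_iff := by
    intro n p
    rw [isPlot_prod_iff, isPlot_iff_contDiff, isPlot_iff_contDiff]
    exact ⟨fun h => h.1.prodMk h.2, fun h => ⟨contDiff_fst.comp h, contDiff_snd.comp h⟩⟩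

end Diffeology

end

/-! ### Smooth local retracts are manifolds -/

noncomputable section

open scoped ContDiff Topology
open DiffeologicalSpace (induced coinduced ofVectorSpace generateFrom)
open OpenPartialHomeomorph (univBall univBall_source univBall_target univBall_apply_zero
  contDiff_univBall contDiffOn_univBall_symm)

section Retract

variable {E : Type*} [NormedAddCommGroup E] [NormedSpace ℝ E] [FiniteDimensional ℝ E]

/-- Inverse function theorem, with smoothness of the inverse on all of its domain. -/
theorem exists_openPartialHomeomorph_of_contDiffOn {F : E → E} {O : Set E} (hO : IsOpen O)
    (hF : ContDiffOn ℝ ∞ F O) {x : E} (hx : x ∈ O)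
    (hF' : HasFDerivAt F (ContinuousLinearEquiv.refl ℝ E : E →L[ℝ] E) x) :
    ∃ e : OpenPartialHomeomorph E E, x ∈ e.source ∧ e.source ⊆ O ∧ (e : E → E) = F ∧
      ContDiffOn ℝ ∞ e.symm e.target := by
  have : CompleteSpace E := FiniteDimensional.complete ℝ E
  have hFx : ContDiffAt ℝ ∞ F x := hF.contDiffAt (hO.mem_nhds hx)
  have hn : (∞ : WithTop ℕ∞) ≠ 0 := by simp
  let e₀ := hFx.toOpenPartialHomeomorph F hF' hn
  have hcont : ContinuousOn (fderiv ℝ F) O := hF.continuousOn_fderiv_of_isOpen hO (by simp)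
  let R : Set (E →L[ℝ] E) := Set.range ((↑) : (E ≃L[ℝ] E) → E →L[ℝ] E)
  have hR : IsOpen R := ContinuousLinearEquiv.isOpen
  have hN : IsOpen (O ∩ fderiv ℝ F ⁻¹' R) := hcont.isOpen_inter_preimage hO hR
  -- The inverse function theorem at `x` gives smoothness of the inverse only at `F x`. Shrinking to
  -- the open set where the derivative stays invertible lets it be applied at every point.
  let e := e₀.restrOpen _ hN
  have he : (e : E → E) = F := rfl
  have hsrc : e.source = e₀.source ∩ (O ∩ fderiv ℝ F ⁻¹' R) := e₀.restrOpen_source _ hN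
  refine ⟨e, ?_, ?_, he, fun v hv => ContDiffAt.contDiffWithinAt ?_⟩
  · rw [hsrc]
    refine ⟨hFx.mem_toOpenPartialHomeomorph_source hF' hn, hx, ?_⟩
    exact ⟨ContinuousLinearEquiv.refl ℝ E, hF'.fderiv.symm⟩
  · rw [hsrc]
    exact fun y hy => hy.2.1
  · have hy : e.symm v ∈ e₀.source ∩ (O ∩ fderiv ℝ F ⁻¹' R) := hsrc ▸ e.map_target hv
    obtain ⟨L, hL⟩ := hy.2.2
    have hFy : ContDiffAt ℝ ∞ F (e.symm v) := hF.contDiffAt (hO.mem_nhds hy.2.1)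
    refine e.contDiffAt_symm (f₀' := L) hv ?_ hFy
    rw [he, hL]
    exact (hFy.differentiableAt hn).hasFDerivAt

/-- Each point of `M` has a neighbourhood in the ambient space with a smooth retraction to `M`. -/
def HasSmoothRetractions {E : Type*} [NormedAddCommGroup E] [NormedSpace ℝ E] (M : Set E) : Prop :=
  ∀ x ∈ M, ∃ O, IsOpen O ∧ x ∈ O ∧ ∃ r : E → E, ContDiffOn ℝ ∞ r O ∧ Set.MapsTo r O M ∧
    ∀ y ∈ M, y ∈ O → r y = y

lemma isPlot_set_iff {E : Type*} [NormedAddCommGroup E] [NormedSpace ℝ E] [DiffeologicalSpace E]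
    [IsContDiffCompatible E] {M : Set E} {n : ℕ} {p : Eucl n → M} :
    IsPlot p ↔ ContDiff ℝ ∞ fun t => (p t : E) :=
  isPlot_subtype_iff.trans isPlot_iff_contDiff

variable [DiffeologicalSpace E] [IsContDiffCompatible E]

lemma isOpen_dTopology_preimage_val {E : Type*} [NormedAddCommGroup E] [NormedSpace ℝ E]
    [DiffeologicalSpace E] [IsContDiffCompatible E] (M : Set E) {W : Set E} (hW : IsOpen W) :
    @IsOpen M dTopology (Subtype.val ⁻¹' W) := by
  rw [isOpen_iff_preimages_plots]
  intro n p hp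
  exact hW.preimage (isPlot_set_iff.1 hp).continuous

/-- A retraction composed with a parametrized ball is a plot of `M`. A D-open set pulls back along
it to an open set, whose ambient image cuts `M` inside the given D-open set because the retraction
fixes points of `M`. -/
theorem HasSmoothRetractions.dTopology_eq {M : Set E} (hM : HasSmoothRetractions M) :
    (dTopology : TopologicalSpace M) = instTopologicalSpaceSubtype := by
  apply le_antisymm
  · intro U hU
    obtain ⟨W, hW, rfl⟩ := isOpen_induced_iff.1 hU
    exact isOpen_dTopology_preimage_val M hW
  · intro U hU
    have hU' := isOpen_iff_preimages_plots.1 hU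
    rw [isOpen_iff_forall_mem_open (X := M)]
    intro x hxU
    obtain ⟨O, hO, hxO, r, hr, hrM, hrid⟩ := hM x x.2
    let T := toEuclidean (E := E)
    obtain ⟨ε, hε, hball⟩ := Metric.isOpen_iff.mp (hO.preimage T.symm.continuous) (T x)
      (by simpa using hxO)
    let φ : Eucl (finrank ℝ E) → E := fun s => T.symm (univBall (T x) ε s)
    have hφO : ∀ s, φ s ∈ O := fun s => hball (univBall_mem_ball _ hε s)
    have hφs : ContDiff ℝ ∞ φ := T.symm.contDiff.comp contDiff_univBall
    let q : Eucl (finrank ℝ E) → M := fun s => ⟨r (φ s), hrM (hφO s)⟩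
    have hq : IsPlot q := isPlot_set_iff.2 (by
      rw [← contDiffOn_univ]
      exact hr.comp hφs.contDiffOn fun s _ => hφO s)
    have hqU := hU' _ q hq
    let W := φ '' (q ⁻¹' U)
    have hW : IsOpen W := by
      have h1 : IsOpen (univBall (T x) ε '' (q ⁻¹' U)) :=
        (univBall (T x) ε).isOpen_image_of_subset_source hqU (by simp [univBall_source])
      have h2 := T.symm.toHomeomorph.isOpenMap _ h1
      rwa [Set.image_image] at h2
    refine ⟨Subtype.val ⁻¹' W, ?_, hW.preimage continuous_subtype_val, ?_⟩
    · rintro y ⟨s, hs, hsy⟩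
      have : q s = y := Subtype.ext (by
        change r (φ s) = y
        rw [hsy]
        exact hrid y y.2 (hsy ▸ hφO s))
      exact this ▸ hs
    · have h0 : φ 0 = x := by simp [φ]
      refine ⟨0, ?_, h0⟩
      have : q 0 = x := Subtype.ext (by
        change r (φ 0) = x
        rw [h0]
        exact hrid x x.2 hxO)
      change q 0 ∈ U
      rwa [this]

/-- The fixed set of a smooth retraction is a submanifold: a local diffeomorphism built from `r` and
its derivative `A` carries `M` near `x` to an open piece of the range of `A`, which is the chart. -/
theorem HasSmoothRetractions.exists_chart {M : Set E} (hM : HasSmoothRetractions M) (x : M) :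
    ∃ d, ∃ U : Set M, @IsOpen _ dTopology U ∧ x ∈ U ∧
      ∃ O : Set (Eucl d), IsOpen O ∧ Diffeomorphic U O := by
  obtain ⟨O, hO, hxO, r, hr, hrM, hrid⟩ := hM x x.2
  have hrx : r x = x := hrid x x.2 hxO
  have hrat : ContDiffAt ℝ ∞ r x := hr.contDiffAt (hO.mem_nhds hxO)
  have hrd : HasFDerivAt r (fderiv ℝ r x) x :=
    (hrat.differentiableAt (by simp)).hasFDerivAt
  set A := fderiv ℝ r x with hA
  -- Differentiate `r ∘ r = r`, which holds near the fixed point `x`.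
  have hAA : ∀ v, A (A v) = A v := by
    have h1 : HasFDerivAt (r ∘ r) (A.comp A) x := by
      refine HasFDerivAt.comp _ ?_ hrd
      rwa [hrx]
    have h2 : (r ∘ r) =ᶠ[𝓝 (x : E)] r := by
      have h3 : r ⁻¹' O ∈ 𝓝 (x : E) :=
        hrat.continuousAt.preimage_mem_nhds (by rw [hrx]; exact hO.mem_nhds hxO)
      filter_upwards [h3, hO.mem_nhds hxO] with y hy hyO
      exact hrid (r y) (hrM hyO) hy
    intro v
    exact DFunLike.congr_fun ((h1.congr_of_eventuallyEq h2.symm).unique hrd) v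
  -- The derivative at `x` is `A² + (1 - A)² = 1` since `A` is a projection; on `M` the second
  -- summand vanishes, so `M` goes into the range of `A`.
  let F : E → E := fun y => A (r y - x) + ((y - r y) - A (y - r y))
  have hF : ContDiffOn ℝ ∞ F O := by
    have h1 : ContDiffOn ℝ ∞ (fun y => y - r y) O := contDiffOn_id.sub hr
    exact (A.contDiff.comp_contDiffOn (hr.sub contDiffOn_const)).add
      (h1.sub (A.contDiff.comp_contDiffOn h1))
  have hF' : HasFDerivAt F (ContinuousLinearEquiv.refl ℝ E : E →L[ℝ] E) x := by
    have h1 : HasFDerivAt (fun y => y - r y) (ContinuousLinearMap.id ℝ E - A) (x : E) :=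
      (hasFDerivAt_id _).sub hrd
    have h2 := (A.hasFDerivAt.comp (x : E) (hrd.sub_const (x : E))).add
      (h1.sub (A.hasFDerivAt.comp (x : E) h1))
    refine h2.congr_fderiv ?_
    ext v
    simp [hAA]
  obtain ⟨e, hxe, heO, heF, hes⟩ := exists_openPartialHomeomorph_of_contDiffOn hO hF hxO hF'
  have hFM : ∀ y ∈ M, y ∈ e.source → F y = A (y - x) := fun y hy hye => by
    simp [F, hrid y hy (heO hye)]
  let T := LinearMap.range (A : E →ₗ[ℝ] E)
  let τ := toEuclidean (E := T)
  let ι : Eucl (finrank ℝ T) → E := fun s => (τ.symm s : E)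
  have hι : ContDiff ℝ ∞ ι := T.subtypeL.contDiff.comp τ.symm.contDiff
  let π : E → Eucl (finrank ℝ T) := fun v => τ ((A : E →ₗ[ℝ] E).rangeRestrict v)
  have hπ : ContDiff ℝ ∞ π :=
    τ.contDiff.comp (LinearMap.toContinuousLinearMap (A : E →ₗ[ℝ] E).rangeRestrict).contDiff
  have hιπ : ∀ v, ι (π v) = A v := fun v => by simp [ι, π]
  have hAι : ∀ s, A (ι s) = ι s := fun s => by
    obtain ⟨w, hw⟩ := (τ.symm s).2
    have hw' : A w = ι s := hw
    rw [← hw', hAA]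
  have hπι : ∀ s, π (ι s) = s := fun s => by
    have : (A : E →ₗ[ℝ] E).rangeRestrict (ι s) = τ.symm s := Subtype.ext (hAι s)
    simp only [π, this, ContinuousLinearEquiv.apply_symm_apply]
  -- Both `y` and `r y` must lie in the source, so that injectivity of `F` can compare them.
  let N : Set E := e.source ∩ r ⁻¹' e.source
  have hN : IsOpen N := (hr.continuousOn.mono heO).isOpen_inter_preimage e.open_source e.open_source
  have hcs : ContinuousOn e.symm e.target := e.continuousOn_symm
  have hW : IsOpen (e.target ∩ e.symm ⁻¹' N) := hcs.isOpen_inter_preimage e.open_target hN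
  -- If `F y` lies in the range of `A`, then `F y = A (F y) = A (r y - x) = F (r y)`, hence `y = r
  -- y` is in `M`.
  have hmem : ∀ s, ι s ∈ e.target ∩ e.symm ⁻¹' N → e.symm (ι s) ∈ M := by
    rintro s ⟨hs, hsN, hsr⟩
    set y := e.symm (ι s) with hy
    have hFy : F y = ι s := by rw [← heF]; exact e.right_inv hs
    have hry : F (r y) = A (r y - x) := hFM _ (hrM (heO hsN)) hsr
    have h0 : F y = A (r y - x) := by
      have h1 : A (F y) = A (r y - x) := by simp [F, hAA]
      rw [← h1, hFy, hAι]
    have h2 : r y = y := by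
      refine e.injOn hsr hsN ?_
      rw [heF, h0, hry]
    rw [← h2]
    exact hrM (heO hsN)
  refine ⟨finrank ℝ T, Subtype.val ⁻¹' N, isOpen_dTopology_preimage_val M hN, ⟨hxe, ?_⟩,
    ι ⁻¹' (e.target ∩ e.symm ⁻¹' N), hW.preimage hι.continuous, ?_⟩
  · change r x ∈ e.source
    rwa [hrx]
  let Φ : (Subtype.val ⁻¹' N : Set M) ≃ (ι ⁻¹' (e.target ∩ e.symm ⁻¹' N) : Set (Eucl _)) :=
    { toFun := fun y => ⟨π (y.1.1 - x), by
        have h1 : ι (π (y.1.1 - x)) = e y.1.1 := by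
          rw [hιπ, heF, hFM _ y.1.2 y.2.1]
        change ι (π (y.1.1 - x)) ∈ e.target ∩ e.symm ⁻¹' N
        rw [h1]
        refine ⟨e.map_source y.2.1, ?_⟩
        change e.symm (e y.1.1) ∈ N
        rw [e.left_inv y.2.1]
        exact y.2⟩
      invFun := fun s => ⟨⟨e.symm (ι s), hmem s s.2⟩, s.2.2⟩
      left_inv := fun y => by
        apply Subtype.ext
        apply Subtype.ext
        change e.symm (ι (π (y.1.1 - x))) = y.1.1
        rw [hιπ, ← hFM _ y.1.2 y.2.1, ← heF]
        exact e.left_inv y.2.1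
      right_inv := fun s => by
        apply Subtype.ext
        change π (e.symm (ι s) - x) = s
        have h1 : A (e.symm (ι s) - x) = ι s := by
          rw [← hFM _ (hmem s s.2) s.2.2.1, ← heF]
          exact e.right_inv s.2.1
        have h2 : ι (π (e.symm (ι s) - x)) = ι s := by rw [hιπ, h1]
        rw [← hπι (π _), h2, hπι] }
  refine ⟨Φ, fun n p hp => ?_, fun n p hp => ?_⟩
  · have hp' : ContDiff ℝ ∞ fun t => ((p t).1 : E) :=
      isPlot_set_iff.1 (isPlot_subtype_iff.1 hp)
    exact isPlot_set_iff.2 (hπ.comp (hp'.sub contDiff_const))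
  · have hp' : ContDiff ℝ ∞ fun t => ((p t).1 : Eucl _) := isPlot_set_iff.1 hp
    refine isPlot_subtype_iff.2 (isPlot_set_iff.2 ?_)
    rw [← contDiffOn_univ]
    exact hes.comp (hι.comp hp').contDiffOn fun t _ => (p t).2.1

/-- A homogeneous set with smooth local retractions is a manifold. -/
theorem HasSmoothRetractions.exists_isSmoothManifold {M : Set E} (hM : HasSmoothRetractions M)
    (x₀ : M) (hh : ∀ x : M, ∃ Φ : M ≃ M, IsDiffeomorphism Φ ∧ Φ x = x₀) :
    ∃ d, IsSmoothManifold d M := by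
  obtain ⟨d, U, hU, hx, O, hO, Ψ, hΨ⟩ := hM.exists_chart x₀
  refine ⟨d, ?_, ?_, fun x => ?_⟩
  · rw [hM.dTopology_eq]
    infer_instance
  · rw [hM.dTopology_eq]
    infer_instance
  · obtain ⟨Φ, hΦ, hΦx⟩ := hh x
    refine ⟨Φ ⁻¹' U, DSmooth.isOpen_preimage hΦ.1 hU, ?_, O, hO, _, (hΦ.preimageEquiv U).trans hΨ⟩
    change Φ x ∈ U
    rwa [hΦx]

end Retract

end

/-! ### Smooth orthonormalization -/

noncomputable section

open scoped ContDiff Topology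
open DiffeologicalSpace (induced coinduced ofVectorSpace generateFrom)
open OpenPartialHomeomorph (univBall univBall_source univBall_target univBall_apply_zero
  contDiff_univBall contDiffOn_univBall_symm)

section GramSchmidt

open InnerProductSpace

variable {E : Type*} [NormedAddCommGroup E] [InnerProductSpace ℂ E] [NormedSpace ℝ E]
  [IsScalarTower ℝ ℂ E]

omit [NormedSpace ℝ E] [IsScalarTower ℝ ℂ E] in
-- The recursion is put in a form whose coefficients are real inverse squared norms times inner
-- products, from which real smoothness can be read off.
lemma gramSchmidt_eq_sub {n : ℕ} (f : Fin n → E) (i : Fin n) :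
    gramSchmidt ℂ f i = f i - ∑ j ∈ Finset.Iio i,
      (((‖gramSchmidt ℂ f j‖ ^ 2)⁻¹ : ℝ) • inner ℂ (gramSchmidt ℂ f j) (f i)) •
        gramSchmidt ℂ f j := by
  rw [eq_sub_iff_add_eq]
  conv_rhs => rw [gramSchmidt_def'' ℂ f i]
  congr 1
  refine Finset.sum_congr rfl fun j _ => ?_
  congr 1
  rw [Complex.real_smul, div_eq_inv_mul]
  simp

/-- Induct along the recursion; at an independent family no denominator vanishes. -/
lemma contDiffAt_gramSchmidt {n : ℕ} {v : Fin n → E} (hv : LinearIndependent ℂ v) (i : Fin n) :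
    ContDiffAt ℝ ∞ (fun f : Fin n → E => gramSchmidt ℂ f i) v := by
  induction i using Fin.strong_induction_on with
  | _ i ih =>
    have heq : (fun f : Fin n → E => gramSchmidt ℂ f i) = fun f => f i - ∑ j ∈ Finset.Iio i,
      (((‖gramSchmidt ℂ f j‖ ^ 2)⁻¹ : ℝ) • inner ℂ (gramSchmidt ℂ f j) (f i)) •
        gramSchmidt ℂ f j := funext fun f => gramSchmidt_eq_sub f i
    rw [heq]
    have happ : ∀ j, ContDiffAt ℝ ∞ (fun f : Fin n → E => f j) v := fun j =>
      (contDiff_apply ℝ E j).contDiffAt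
    refine (happ i).sub (ContDiffAt.sum fun j hj => ?_)
    have hj' := ih j (Finset.mem_Iio.1 hj)
    have hne : gramSchmidt ℂ v j ≠ 0 := gramSchmidt_ne_zero j hv
    refine ContDiffAt.smul (ContDiffAt.smul (ContDiffAt.inv ((hj'.norm ℂ hne).pow 2) ?_)
      (hj'.inner ℂ (happ i))) hj'
    simpa using hne

lemma gramSchmidtNormed_eq_smul {n : ℕ} (f : Fin n → E)
    (i : Fin n) :
    gramSchmidtNormed ℂ f i = (‖gramSchmidt ℂ f i‖⁻¹ : ℝ) • gramSchmidt ℂ f i := by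
  rw [gramSchmidtNormed, ← algebraMap_smul ℂ (‖gramSchmidt ℂ f i‖⁻¹ : ℝ)]
  simp

lemma contDiffAt_gramSchmidtNormed {n : ℕ} {v : Fin n → E} (hv : LinearIndependent ℂ v)
    (i : Fin n) : ContDiffAt ℝ ∞ (fun f : Fin n → E => gramSchmidtNormed ℂ f i) v := by
  simp only [gramSchmidtNormed_eq_smul]
  have hi := contDiffAt_gramSchmidt hv i
  have hne : gramSchmidt ℂ v i ≠ 0 := gramSchmidt_ne_zero i hv
  exact ((hi.norm ℂ hne).inv (by simpa using hne)).smul hi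

/-- Gram-Schmidt orthonormalization of a family indexed by an arbitrary finite type. -/
def orthonormalize {ι E : Type*} [Fintype ι] [NormedAddCommGroup E] [InnerProductSpace ℂ E]
    (v : ι → E) (i : ι) : E :=
  gramSchmidtNormed ℂ (v ∘ (Fintype.equivFin ι).symm) (Fintype.equivFin ι i)

variable {ι : Type*} [Fintype ι] {v : ι → E}

lemma contDiffAt_orthonormalize (hv : LinearIndependent ℂ v) (i : ι) :
    ContDiffAt ℝ ∞ (fun f : ι → E => orthonormalize f i) v := by
  let e := Fintype.equivFin ι
  have hL : ContDiff ℝ ∞ fun f : ι → E => f ∘ e.symm :=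
    contDiff_pi.2 fun j => contDiff_apply ℝ E (e.symm j)
  exact (contDiffAt_gramSchmidtNormed (hv.comp _ e.symm.injective) (e i)).comp v hL.contDiffAt

omit [NormedSpace ℝ E] [IsScalarTower ℝ ℂ E] in
lemma orthonormal_orthonormalize (hv : LinearIndependent ℂ v) :
    Orthonormal ℂ (orthonormalize v) :=
  (gramSchmidtNormed_orthonormal (hv.comp _ (Fintype.equivFin ι).symm.injective)).comp _
    (Fintype.equivFin ι).injective

omit [NormedSpace ℝ E] [IsScalarTower ℝ ℂ E] in
lemma span_orthonormalize (v : ι → E) :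
    Submodule.span ℂ (Set.range (orthonormalize v)) = Submodule.span ℂ (Set.range v) := by
  have h1 : Set.range (orthonormalize v) =
      Set.range (gramSchmidtNormed ℂ (v ∘ (Fintype.equivFin ι).symm)) :=
    (Fintype.equivFin ι).surjective.range_comp _
  have h2 : Set.range (v ∘ (Fintype.equivFin ι).symm) = Set.range v :=
    (Fintype.equivFin ι).symm.surjective.range_comp _
  rw [h1, span_gramSchmidtNormed_range, span_gramSchmidt, h2]

/-- Orthonormalization respects a decomposition into mutually orthogonal real subspaces on each of
which the multiples `⟪x, y⟫ • x` stay inside. -/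
lemma orthonormalize_mem {κ : Type*} (B : κ → Submodule ℝ E) (c : ι → κ)
    (horth : ∀ a b, a ≠ b → ∀ x ∈ B a, ∀ y ∈ B b, inner ℂ x y = (0 : ℂ))
    (hB : ∀ a, ∀ x ∈ B a, ∀ y ∈ B a, (inner ℂ x y : ℂ) • x ∈ B a)
    (hv : ∀ i, v i ∈ B (c i)) (i : ι) : orthonormalize v i ∈ B (c i) := by
  let e := Fintype.equivFin ι
  have key : ∀ j : Fin (Fintype.card ι), gramSchmidt ℂ (v ∘ e.symm) j ∈ B (c (e.symm j)) := by
    intro j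
    induction j using Fin.strong_induction_on with
    | _ j ih =>
      rw [gramSchmidt_eq_sub]
      refine sub_mem (hv _) (sum_mem fun k hk => ?_)
      have hk' := ih k (Finset.mem_Iio.1 hk)
      -- A correction term of the same colour is a multiple that stays in its subspace; one of
      -- another colour has coefficient zero by orthogonality.
      by_cases hc : c (e.symm k) = c (e.symm j)
      · rw [smul_assoc]
        rw [hc] at hk'
        exact (B _).smul_mem _ (hB _ _ hk' _ (hv _))
      · have h0 : inner ℂ (gramSchmidt ℂ (v ∘ e.symm) k) ((v ∘ e.symm) j) = (0 : ℂ) :=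
          horth _ _ hc _ hk' _ (hv _)
        rw [h0]
        simp
  have h := key (e i)
  rw [Equiv.symm_apply_apply] at h
  rw [orthonormalize, gramSchmidtNormed_eq_smul]
  exact (B _).smul_mem _ h

end GramSchmidt

/-! ### Smooth families of subspaces -/

section Subspaces

variable {𝕜 E : Type*} [Field 𝕜] [Algebra ℝ 𝕜] [AddCommGroup E] [Module 𝕜 E] [Module ℝ E]
  [IsScalarTower ℝ 𝕜 E] [FiniteDimensional 𝕜 E]

omit [IsScalarTower ℝ 𝕜 E] [Algebra ℝ 𝕜] [Module ℝ E] in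
lemma Frame.exists_span_eq (W : Submodule 𝕜 E) :
    ∃ ℓ, ∃ v : Frame 𝕜 E ℓ, v.span = W := by
  let b := Module.finBasis 𝕜 W
  refine ⟨finrank 𝕜 W, ⟨fun i => (b i : E),
    b.linearIndependent.map' W.subtype (Submodule.ker_subtype W)⟩, ?_⟩
  have : Set.range (fun i => (b i : E)) = W.subtype '' Set.range b := by
    rw [← Set.range_comp]; rfl
  change Submodule.span 𝕜 (Set.range fun i => (b i : E)) = W
  rw [this, Submodule.span_image, b.span_eq, Submodule.map_top, Submodule.range_subtype]

omit [FiniteDimensional 𝕜 E] in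
lemma isPlot_frame_span {n ℓ : ℕ} {q : Eucl n → Frame 𝕜 E ℓ} (hq : IsPlot q) :
    IsPlot fun t => (q t).span :=
  isPlot_iSup_coinduced_comp (fun ℓ => Frame.span (𝕜 := 𝕜) (E := E) (ℓ := ℓ)) ℓ hq

lemma exists_frame_of_isPlot {n : ℕ} {p : Eucl n → Submodule 𝕜 E} (hp : IsPlot p) (t : Eucl n) :
    ∃ r > 0, ∃ ℓ, ∃ q : Eucl n → Frame 𝕜 E ℓ, IsPlot q ∧
      ∀ s, p (univBall t r s) = (q s).span :=
  exists_lift_of_isPlot_iSup_coinduced (fun ℓ => Frame.span (𝕜 := 𝕜) (E := E) (ℓ := ℓ))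
    Frame.exists_span_eq hp t

end Subspaces

/-! ### Orthogonal projections onto smooth families of subspaces -/

section Projection

variable {E H : Type*} [AddCommGroup E] [Module ℂ E] [Module ℝ E] [IsScalarTower ℝ ℂ E]
  [FiniteDimensional ℂ E] [NormedAddCommGroup H] [InnerProductSpace ℂ H] [NormedSpace ℝ H]
  [IsScalarTower ℝ ℂ H] [FiniteDimensional ℂ H] [FiniteDimensional ℝ H]

omit [NormedSpace ℝ H] [IsScalarTower ℝ ℂ H] [FiniteDimensional ℝ H] in
lemma starProjection_eq_sum {ι : Type*} [Fintype ι] {g : ι → H} (hg : Orthonormal ℂ g)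
    {K : Submodule ℂ H} (hK : Submodule.span ℂ (Set.range g) = K) (w : H) :
    K.starProjection w = ∑ i, (inner ℂ (g i) w : ℂ) • g i := by
  classical
  refine Submodule.eq_starProjection_of_mem_orthogonal ?_ ?_
  · rw [← hK]
    exact Submodule.sum_mem _ fun i _ =>
      Submodule.smul_mem _ _ (Submodule.subset_span ⟨i, rfl⟩)
  · rw [← hK, Submodule.mem_orthogonal]
    intro u hu
    induction hu using Submodule.span_induction with
    | mem x hx =>
      obtain ⟨i, rfl⟩ := hx
      rw [inner_sub_right, hg.inner_right_fintype, sub_self]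
    | zero => simp
    | add x y _ _ hx hy => rw [inner_add_left, hx, hy, add_zero]
    | smul a x _ hx => rw [inner_smul_left, hx, mul_zero]

/-- The orthogonal projections onto a smooth family of subspaces are smooth. -/
theorem contDiff_starProjection_map (G : E ≃ₗ[ℂ] H) {n : ℕ} {p : Eucl n → Submodule ℂ E}
    (hp : IsPlot p) (w : H) :
    ContDiff ℝ ∞ fun t => ((p t).map (G : E →ₗ[ℂ] H)).starProjection w := by
  let _ : DiffeologicalSpace H := NormedSpace.toDiffeology H
  suffices h : IsPlot fun t => ((p t).map (G : E →ₗ[ℂ] H)).starProjection w from h.contDiff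
  refine isPlot_of_local fun t => ?_
  obtain ⟨r, hr, ℓ, q, hq, hpq⟩ := exists_frame_of_isPlot hp t
  refine ⟨r, hr, ContDiff.isPlot ?_⟩
  -- A local smooth frame, orthonormalized, writes the projection as a sum of smooth rank-one terms.
  let v : Eucl n → Fin ℓ → H := fun s i => G ((q s).1 i)
  have hv : ∀ s, LinearIndependent ℂ (v s) := fun s =>
    (q s).2.map' (G : E →ₗ[ℂ] H) (LinearEquiv.ker G)
  have hvs : ContDiff ℝ ∞ v := by
    let L : (Fin ℓ → E) →ₗ[ℝ] (Fin ℓ → H) :=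
      ((G : E →ₗ[ℂ] H).restrictScalars ℝ).compLeft (Fin ℓ)
    exact isPlot_ofVectorSpace_iff_contDiff.1 (isPlot_ofVectorSpace_comp hq L)
  have hspan : ∀ s, Submodule.span ℂ (Set.range (orthonormalize (v s))) =
      (p (univBall t r s)).map (G : E →ₗ[ℂ] H) := fun s => by
    rw [span_orthonormalize, hpq, Frame.span, Submodule.map_span, ← Set.range_comp]
    rfl
  have heq : (fun s => ((p (univBall t r s)).map (G : E →ₗ[ℂ] H)).starProjection w) =
      fun s => ∑ i, (inner ℂ (orthonormalize (v s) i) w : ℂ) • orthonormalize (v s) i :=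
    funext fun s => starProjection_eq_sum (orthonormal_orthonormalize (hv s)) (hspan s) w
  rw [heq]
  have ho : ∀ i, ContDiff ℝ ∞ fun s => orthonormalize (v s) i := fun i =>
    contDiff_iff_contDiffAt.2 fun s =>
      (contDiffAt_orthonormalize (hv s) i).comp s hvs.contDiffAt
  exact ContDiff.sum fun i _ => ((ho i).inner ℂ contDiff_const).smul (ho i)

end Projection

end

/-! ### The homogeneous space of pairs of matrices -/

noncomputable section

open scoped ContDiff Topology
open DiffeologicalSpace (induced coinduced ofVectorSpace generateFrom)
open OpenPartialHomeomorph (univBall univBall_source univBall_target univBall_apply_zero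
  contDiff_univBall contDiffOn_univBall_symm)

open Matrix

attribute [local instance] Matrix.linftyOpNormedRing Matrix.linftyOpNormedAlgebra

namespace BlockModel

variable {ι : Type*} [Fintype ι] [DecidableEq ι]

instance : IsContDiffCompatible (Matrix ι ι ℂ) := isContDiffCompatible_ofVectorSpace _

omit [DecidableEq ι] in
lemma contDiff_of_isLinearMap {E F : Type*} [NormedAddCommGroup E] [NormedSpace ℝ E]
    [FiniteDimensional ℝ E] [NormedAddCommGroup F] [NormedSpace ℝ F] {f : E → F}
    (hf : IsLinearMap ℝ f) : ContDiff ℝ ∞ f :=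
  (LinearMap.toContinuousLinearMap hf.mk').contDiff

lemma contDiff_transpose : ContDiff ℝ ∞ (fun g : Matrix ι ι ℂ => gᵀ) :=
  contDiff_of_isLinearMap ⟨fun _ _ => rfl, fun _ _ => rfl⟩

lemma contDiff_conjTranspose : ContDiff ℝ ∞ (fun g : Matrix ι ι ℂ => gᴴ) :=
  contDiff_of_isLinearMap ⟨fun g h => conjTranspose_add g h, fun r g => by
    ext i j; simp [conjTranspose_apply]⟩

/-- The vectors of columns of a matrix. -/
def columns (g : Matrix ι ι ℂ) (i : ι) : EuclideanSpace ℂ ι := WithLp.toLp 2 fun k => g k i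

omit [Fintype ι] [DecidableEq ι] in
@[simp] lemma columns_apply (g : Matrix ι ι ℂ) (i k : ι) : columns g i k = g k i := rfl

/-- The matrix with given columns. -/
def ofColumns (v : ι → EuclideanSpace ℂ ι) : Matrix ι ι ℂ := Matrix.of fun k i => v i k

omit [Fintype ι] [DecidableEq ι] in
@[simp] lemma ofColumns_apply (v : ι → EuclideanSpace ℂ ι) (i k : ι) :
    ofColumns v k i = v i k := rfl

lemma contDiff_columns : ContDiff ℝ ∞ (columns : Matrix ι ι ℂ → _) :=
  contDiff_of_isLinearMap ⟨fun _ _ => rfl, fun _ _ => rfl⟩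

lemma contDiff_ofColumns :
    ContDiff ℝ ∞ (ofColumns : (ι → EuclideanSpace ℂ ι) → Matrix ι ι ℂ) :=
  contDiff_of_isLinearMap ⟨fun _ _ => rfl, fun _ _ => rfl⟩

lemma ofColumns_mem_unitaryGroup {v : ι → EuclideanSpace ℂ ι} (hv : Orthonormal ℂ v) :
    ofColumns v ∈ unitaryGroup ι ℂ := by
  rw [mem_unitaryGroup_iff', star_eq_conjTranspose]
  ext i j
  have := orthonormal_iff_ite.1 hv i j
  rw [PiLp.inner_apply] at this
  rw [Matrix.mul_apply, Matrix.one_apply, ← this]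
  refine Finset.sum_congr rfl fun k _ => ?_
  simp [mul_comm]

lemma linearIndependent_columns_one : LinearIndependent ℂ (columns (1 : Matrix ι ι ℂ)) := by
  have h : columns (1 : Matrix ι ι ℂ) = EuclideanSpace.basisFun ι ℂ := by
    funext i
    ext k
    simp [Matrix.one_apply, eq_comm]
  rw [h]
  exact (EuclideanSpace.basisFun ι ℂ).orthonormal.linearIndependent

variable (c : ι → Fin 3)

/-- The diagonal projection onto the coordinates of colour `k`. -/
def diagProj (k : Fin 3) : Matrix ι ι ℂ := diagonal fun i => if c i = k then 1 else 0

omit [Fintype ι] in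
lemma diagProj_conjTranspose (k : Fin 3) : (diagProj c k)ᴴ = diagProj c k := by
  rw [diagProj, diagonal_conjTranspose]
  congr 1
  funext i
  simp [apply_ite]

lemma diagProj_mul_self (k : Fin 3) : diagProj c k * diagProj c k = diagProj c k := by
  rw [diagProj, diagonal_mul_diagonal]
  congr 1
  funext i
  simp

omit [Fintype ι] in
lemma diagProj_sum : diagProj c 0 + diagProj c 1 + diagProj c 2 = 1 := by
  rw [diagProj, diagProj, diagProj, diagonal_add, diagonal_add, ← diagonal_one]
  congr 1
  funext i
  generalize c i = k
  fin_cases k <;> simp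

lemma mul_diagProj_apply (g : Matrix ι ι ℂ) (k : Fin 3) (i j : ι) :
    (g * diagProj c k) i j = if c j = k then g i j else 0 := by
  simp [diagProj, mul_diagonal]

lemma diagProj_mul_apply (g : Matrix ι ι ℂ) (k : Fin 3) (i j : ι) :
    (diagProj c k * g) i j = if c i = k then g i j else 0 := by
  simp [diagProj, diagonal_mul]

/-- The action of unitary matrices on pairs consisting of a symmetric and a hermitian matrix. -/
def act (g : Matrix ι ι ℂ) (y : Matrix ι ι ℂ × Matrix ι ι ℂ) : Matrix ι ι ℂ × Matrix ι ι ℂ :=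
  (g * y.1 * gᵀ, g * y.2 * gᴴ)

/-- The base point. -/
def basePair : Matrix ι ι ℂ × Matrix ι ι ℂ := (diagProj c 0, diagProj c 1)

omit [DecidableEq ι] in
lemma act_mul (g h : Matrix ι ι ℂ) (y : Matrix ι ι ℂ × Matrix ι ι ℂ) :
    act (g * h) y = act g (act h y) := by
  simp [act, transpose_mul, conjTranspose_mul, Matrix.mul_assoc]

lemma act_one (y : Matrix ι ι ℂ × Matrix ι ι ℂ) : act 1 y = y := by simp [act]

lemma contDiff_act :
    ContDiff ℝ ∞ fun z : Matrix ι ι ℂ × (Matrix ι ι ℂ × Matrix ι ι ℂ) => act z.1 z.2 := by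
  have h1 : ContDiff ℝ ∞ fun z : Matrix ι ι ℂ × (Matrix ι ι ℂ × Matrix ι ι ℂ) => z.1 :=
    contDiff_fst
  have h2 : ContDiff ℝ ∞ fun z : Matrix ι ι ℂ × (Matrix ι ι ℂ × Matrix ι ι ℂ) => z.2.1 :=
    contDiff_fst.comp contDiff_snd
  have h3 : ContDiff ℝ ∞ fun z : Matrix ι ι ℂ × (Matrix ι ι ℂ × Matrix ι ι ℂ) => z.2.2 :=
    contDiff_snd.comp contDiff_snd
  exact ((h1.mul h2).mul (contDiff_transpose.comp h1)).prodMk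
    ((h1.mul h3).mul (contDiff_conjTranspose.comp h1))

lemma contDiffOn_act_comp {F : Type*} [NormedAddCommGroup F] [NormedSpace ℝ F]
    {f : F → Matrix ι ι ℂ} {y : F → Matrix ι ι ℂ × Matrix ι ι ℂ} {O : Set F}
    (hf : ContDiffOn ℝ ∞ f O) (hy : ContDiffOn ℝ ∞ y O) :
    ContDiffOn ℝ ∞ (fun t => act (f t) (y t)) O :=
  ContDiff.comp_contDiffOn (g := fun z : Matrix ι ι ℂ × (Matrix ι ι ℂ × Matrix ι ι ℂ) =>
    act z.1 z.2) contDiff_act (f := fun t => (f t, y t)) (hf.prodMk hy)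

lemma contDiff_act_comp {F : Type*} [NormedAddCommGroup F] [NormedSpace ℝ F]
    {f : F → Matrix ι ι ℂ} {y : F → Matrix ι ι ℂ × Matrix ι ι ℂ}
    (hf : ContDiff ℝ ∞ f) (hy : ContDiff ℝ ∞ y) : ContDiff ℝ ∞ (fun t => act (f t) (y t)) :=
  contDiffOn_univ.1 (contDiffOn_act_comp hf.contDiffOn hy.contDiffOn)

/-- The orbit of the base point under the unitary group. -/
def modelSet : Set (Matrix ι ι ℂ × Matrix ι ι ℂ) :=
  {y | ∃ u : unitaryGroup ι ℂ, act (u : Matrix ι ι ℂ) (basePair c) = y}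

/-- The orbit map. -/
def orbitMap (u : unitaryGroup ι ℂ) : modelSet c := ⟨act (u : Matrix ι ι ℂ) (basePair c), u, rfl⟩

lemma orbitMap_surjective : Function.Surjective (orbitMap c) := by
  rintro ⟨y, u, rfl⟩
  exact ⟨u, rfl⟩

/-- Block diagonal matrices with real block of colour `0`. -/
def IsBlock (h : Matrix ι ι ℂ) : Prop :=
  (∀ i j, c i ≠ c j → h i j = 0) ∧ ∀ i j, c i = 0 → c j = 0 → (h i j).im = 0

lemma mul_conjTranspose_self (u : unitaryGroup ι ℂ) : (u : Matrix ι ι ℂ) * (u : Matrix ι ι ℂ)ᴴ = 1 :=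
  mem_unitaryGroup_iff.1 u.2

lemma conjTranspose_mul_self (u : unitaryGroup ι ℂ) : (u : Matrix ι ι ℂ)ᴴ * (u : Matrix ι ι ℂ) = 1 :=
  mem_unitaryGroup_iff'.1 u.2

lemma transpose_mul_conj (u : unitaryGroup ι ℂ) :
    (u : Matrix ι ι ℂ)ᵀ * (u : Matrix ι ι ℂ)ᴴᵀ = 1 := by
  rw [← transpose_mul, conjTranspose_mul_self, transpose_one]

lemma conj_mul_transpose (u : unitaryGroup ι ℂ) :
    (u : Matrix ι ι ℂ)ᴴᵀ * (u : Matrix ι ι ℂ)ᵀ = 1 := by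
  rw [← transpose_mul, mul_conjTranspose_self, transpose_one]

lemma mul_mul_transpose_eq_iff (h : unitaryGroup ι ℂ) (D : Matrix ι ι ℂ) :
    (h : Matrix ι ι ℂ) * D * (h : Matrix ι ι ℂ)ᵀ = D ↔ (h : Matrix ι ι ℂ) * D = D * (h : Matrix ι ι ℂ)ᴴᵀ := by
  constructor
  · intro H
    conv_rhs => rw [← H]
    rw [Matrix.mul_assoc, transpose_mul_conj, Matrix.mul_one]
  · intro H
    rw [H, Matrix.mul_assoc, conj_mul_transpose, Matrix.mul_one]

lemma mul_mul_conjTranspose_eq_iff (h : unitaryGroup ι ℂ) (D : Matrix ι ι ℂ) :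
    (h : Matrix ι ι ℂ) * D * (h : Matrix ι ι ℂ)ᴴ = D ↔ (h : Matrix ι ι ℂ) * D = D * (h : Matrix ι ι ℂ) := by
  constructor
  · intro H
    conv_rhs => rw [← H]
    rw [Matrix.mul_assoc, conjTranspose_mul_self, Matrix.mul_one]
  · intro H
    rw [H, Matrix.mul_assoc, mul_conjTranspose_self, Matrix.mul_one]

/-- The first condition reads `h D₀ = D₀ h̄`: it removes the entries between colour `0` and the
others and makes the `0` block real. The second says that `h` commutes with `D₁`, which separates
colours `1` and `2`. -/
lemma isBlock_iff (h : unitaryGroup ι ℂ) :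
    IsBlock c (h : Matrix ι ι ℂ) ↔ act (h : Matrix ι ι ℂ) (basePair c) = basePair c := by
  rw [act, basePair, Prod.mk.injEq, mul_mul_transpose_eq_iff, mul_mul_conjTranspose_eq_iff,
    ← Matrix.ext_iff, ← Matrix.ext_iff]
  simp only [mul_diagProj_apply, diagProj_mul_apply]
  have hreal : ∀ i j, (h : Matrix ι ι ℂ)ᴴᵀ i j = (starRingEnd ℂ) ((h : Matrix ι ι ℂ) i j) :=
    fun i j => rfl
  simp only [hreal]
  constructor
  · rintro ⟨h1, h2⟩
    refine ⟨fun i j => ?_, fun i j => ?_⟩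
    · split_ifs with hj hi hi
      · exact (Complex.conj_eq_iff_im.2 (h2 i j hi hj)).symm
      · exact h1 i j (fun e => hi (e.trans hj))
      · rw [h1 i j (fun e => hj (e.symm.trans hi)), map_zero]
      · rfl
    · split_ifs with hj hi hi
      · rfl
      · exact h1 i j (fun e => hi (e.trans hj))
      · rw [h1 i j (fun e => hj (e.symm.trans hi))]
      · rfl
  · rintro ⟨h1, h2⟩
    refine ⟨fun i j hij => ?_, fun i j hi hj => ?_⟩
    · have h1' := h1 i j
      have h2' := h2 i j
      by_cases hj0 : c j = 0
      · rwa [if_pos hj0, if_neg (fun e => hij (e.trans hj0.symm))] at h1'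
      by_cases hi0 : c i = 0
      · rw [if_neg hj0, if_pos hi0] at h1'
        exact (map_eq_zero _).1 h1'.symm
      by_cases hj1 : c j = 1
      · rwa [if_pos hj1, if_neg (fun e => hij (e.trans hj1.symm))] at h2'
      by_cases hi1 : c i = 1
      · rw [if_neg hj1, if_pos hi1] at h2'
        exact h2'.symm
      exact absurd (by omega) hij
    · have := h1 i j
      rw [if_pos hi, if_pos hj] at this
      exact Complex.conj_eq_iff_im.1 this.symm

lemma act_eq_act_iff (u u' : unitaryGroup ι ℂ) :
    act (u : Matrix ι ι ℂ) (basePair c) = act (u' : Matrix ι ι ℂ) (basePair c) ↔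
      IsBlock c ((u⁻¹ * u' : unitaryGroup ι ℂ) : Matrix ι ι ℂ) := by
  rw [isBlock_iff]
  have hinv : ∀ y, act ((u⁻¹ : unitaryGroup ι ℂ) : Matrix ι ι ℂ) (act (u : Matrix ι ι ℂ) y) = y := fun y => by
    rw [← act_mul, ← Submonoid.coe_mul, inv_mul_cancel]; exact act_one y
  have hinv' : ∀ y, act (u : Matrix ι ι ℂ) (act ((u⁻¹ : unitaryGroup ι ℂ) : Matrix ι ι ℂ) y) = y := fun y => by
    rw [← act_mul, ← Submonoid.coe_mul, mul_inv_cancel]; exact act_one y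
  rw [Submonoid.coe_mul, act_mul]
  constructor
  · intro h
    rw [← h, hinv]
  · intro h
    rw [← hinv' (act (u' : Matrix ι ι ℂ) _), h]

/-! #### Local sections -/

/-- A matrix which for pairs near the base point is close to the identity, and for pairs in the
model set has columns compatible with the corresponding decomposition. -/
def preframe (y : Matrix ι ι ℂ × Matrix ι ι ℂ) : Matrix ι ι ℂ :=
  (2⁻¹ : ℝ) • (y.1 * y.1ᴴ + y.1) * diagProj c 0 + y.2 * diagProj c 1 +
    (1 - y.1 * y.1ᴴ - y.2) * diagProj c 2

lemma contDiff_preframe : ContDiff ℝ ∞ (preframe c) := by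
  have h1 : ContDiff ℝ ∞ fun y : Matrix ι ι ℂ × Matrix ι ι ℂ => y.1 := contDiff_fst
  have h2 : ContDiff ℝ ∞ fun y : Matrix ι ι ℂ × Matrix ι ι ℂ => y.2 := contDiff_snd
  have h3 : ContDiff ℝ ∞ fun y : Matrix ι ι ℂ × Matrix ι ι ℂ => y.1 * y.1ᴴ :=
    h1.mul (contDiff_conjTranspose.comp h1)
  have h4 : ContDiff ℝ ∞ fun y : Matrix ι ι ℂ × Matrix ι ι ℂ => (2⁻¹ : ℝ) • (y.1 * y.1ᴴ + y.1) :=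
    (h3.add h1).const_smul _
  have h5 : ContDiff ℝ ∞ fun y : Matrix ι ι ℂ × Matrix ι ι ℂ => 1 - y.1 * y.1ᴴ - y.2 :=
    (contDiff_const.sub h3).sub h2
  exact ((h4.mul contDiff_const).add (h2.mul contDiff_const)).add (h5.mul contDiff_const)

lemma preframe_basePair : preframe c (basePair c) = 1 := by
  have h : (1 : Matrix ι ι ℂ) - diagProj c 0 - diagProj c 1 = diagProj c 2 := by
    rw [← diagProj_sum c]; abel
  have h2 : (2⁻¹ : ℝ) • (diagProj c 0 + diagProj c 0) = diagProj c 0 := by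
    rw [← two_smul ℝ, smul_smul]; norm_num
  simp only [preframe, basePair, diagProj_conjTranspose, diagProj_mul_self, h, h2]
  exact diagProj_sum c

/-- These are the coordinates of the preframe in the frame `u`. With `S = u D₀ uᵀ`, both `u* S = D₀
uᵀ` and `u* S S* = D₀ u*` hold. As `uᵀ` is the entrywise conjugate of `u*`, averaging leaves the
real part of `u*` in the colour `0` rows; this is why the preframe contains `½ (S S* + S)`. -/
lemma conjTranspose_mul_preframe (u : unitaryGroup ι ℂ) :
    (u : Matrix ι ι ℂ)ᴴ * preframe c (act (u : Matrix ι ι ℂ) (basePair c)) =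
      (2⁻¹ : ℝ) • (diagProj c 0 * ((u : Matrix ι ι ℂ)ᴴ + (u : Matrix ι ι ℂ)ᵀ)) * diagProj c 0 +
      diagProj c 1 * (u : Matrix ι ι ℂ)ᴴ * diagProj c 1 +
      ((u : Matrix ι ι ℂ)ᴴ - diagProj c 0 * (u : Matrix ι ι ℂ)ᴴ - diagProj c 1 * (u : Matrix ι ι ℂ)ᴴ) *
        diagProj c 2 := by
  set g : Matrix ι ι ℂ := (u : Matrix ι ι ℂ) with hg
  set S := g * diagProj c 0 * gᵀ with hS
  have hu : gᴴ * g = 1 := conjTranspose_mul_self (ι := ι) u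
  have hSH : Sᴴ = gᴴᵀ * diagProj c 0 * gᴴ := by
    rw [hS, conjTranspose_mul, conjTranspose_mul, diagProj_conjTranspose, Matrix.mul_assoc]
    rfl
  have h0 : gᴴ * S = diagProj c 0 * gᵀ := by
    rw [hS, ← Matrix.mul_assoc, ← Matrix.mul_assoc, hu, Matrix.one_mul]
  have h1 : gᴴ * (S * Sᴴ) = diagProj c 0 * gᴴ := by
    rw [← Matrix.mul_assoc, h0, hSH, Matrix.mul_assoc, ← Matrix.mul_assoc gᵀ,
      ← Matrix.mul_assoc gᵀ, transpose_mul_conj, Matrix.one_mul, ← Matrix.mul_assoc,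
      diagProj_mul_self]
  have h2 : gᴴ * (g * diagProj c 1 * gᴴ) = diagProj c 1 * gᴴ := by
    rw [← Matrix.mul_assoc, ← Matrix.mul_assoc, hu, Matrix.one_mul]
  have : act g (basePair c) = (S, g * diagProj c 1 * gᴴ) := rfl
  rw [this, preframe]
  simp only [Matrix.mul_add, ← Matrix.mul_assoc gᴴ, Matrix.mul_sub, Matrix.mul_smul, Matrix.mul_one]
  have h3 : diagProj c 0 * gᵀ * Sᴴ = diagProj c 0 * gᴴ := by rw [← h0, Matrix.mul_assoc, h1]
  simp only [Matrix.mul_assoc gᴴ, h0, h2, h3]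

/-- The part of colour `k` of the decomposition given by a unitary frame. -/
def part (u : unitaryGroup ι ℂ) (k : Fin 3) : Submodule ℝ (EuclideanSpace ℂ ι) where
  carrier := {v | (∀ j, c j ≠ k → ((u : Matrix ι ι ℂ)ᴴ *ᵥ v.ofLp) j = 0) ∧
    (k = 0 → ∀ j, (((u : Matrix ι ι ℂ)ᴴ *ᵥ v.ofLp) j).im = 0)}
  zero_mem' := by simp
  add_mem' := by
    rintro v w ⟨h1, h2⟩ ⟨h3, h4⟩
    refine ⟨fun j hj => ?_, fun hk j => ?_⟩
    · simp [mulVec_add, h1 j hj, h3 j hj]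
    · simp [mulVec_add, h2 hk j, h4 hk j]
  smul_mem' := by
    rintro r v ⟨h1, h2⟩
    refine ⟨fun j hj => ?_, fun hk j => ?_⟩
    · simp [mulVec_smul, h1 j hj]
    · simp [mulVec_smul, h2 hk j]

lemma inner_eq_sum_mulVec (u : unitaryGroup ι ℂ) (x y : EuclideanSpace ℂ ι) :
    (inner ℂ x y : ℂ) = ∑ j, (starRingEnd ℂ) (((u : Matrix ι ι ℂ)ᴴ *ᵥ x.ofLp) j) *
      ((u : Matrix ι ι ℂ)ᴴ *ᵥ y.ofLp) j := by
  have h1 : (inner ℂ x y : ℂ) = star x.ofLp ⬝ᵥ y.ofLp := by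
    rw [PiLp.inner_apply, dotProduct]
    exact Finset.sum_congr rfl fun k _ => by simp [mul_comm]
  have h2 : ∑ j, (starRingEnd ℂ) (((u : Matrix ι ι ℂ)ᴴ *ᵥ x.ofLp) j) *
      ((u : Matrix ι ι ℂ)ᴴ *ᵥ y.ofLp) j =
      star ((u : Matrix ι ι ℂ)ᴴ *ᵥ x.ofLp) ⬝ᵥ ((u : Matrix ι ι ℂ)ᴴ *ᵥ y.ofLp) := rfl
  rw [h1, h2, star_mulVec, conjTranspose_conjTranspose, dotProduct_mulVec, vecMul_vecMul,
    mul_conjTranspose_self, vecMul_one]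

/-- Each column keeps only coordinates of its own colour in the frame `u`, and those of colour `0`
are real, so Gram-Schmidt will respect the decomposition attached to `u`. -/
lemma columns_preframe_mem (u : unitaryGroup ι ℂ) (i : ι) :
    columns (preframe c (act (u : Matrix ι ι ℂ) (basePair c))) i ∈ part c u (c i) := by
  have h : ∀ j, ((u : Matrix ι ι ℂ)ᴴ *ᵥ (columns (preframe c (act (u : Matrix ι ι ℂ) (basePair c))) i).ofLp) j =
      ((u : Matrix ι ι ℂ)ᴴ * preframe c (act (u : Matrix ι ι ℂ) (basePair c))) j i := fun j => by
    rw [Matrix.mul_apply]; rfl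
  change (∀ j, _ → _) ∧ _
  simp only [h, conjTranspose_mul_preframe]
  simp only [Matrix.add_apply, mul_diagProj_apply, Matrix.smul_apply, diagProj_mul_apply,
    Matrix.sub_apply, transpose_apply, conjTranspose_apply]
  refine ⟨fun j hj => ?_, fun hi j => ?_⟩
  · generalize hi : c i = a at *
    generalize hj' : c j = b at *
    fin_cases a <;> fin_cases b <;> simp_all
  · simp [hi]
    split_ifs <;> simp

/-- The preframe is the identity at the base point, so its columns remain independent nearby and
orthonormalize to a unitary matrix. Over a point `u · base` the resulting columns stay in the parts
determined by `u`, so the new matrix differs from `u` by a block matrix and reaches the same point.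
-/
lemma exists_section_one :
    ∃ N : Set (Matrix ι ι ℂ × Matrix ι ι ℂ), IsOpen N ∧ basePair c ∈ N ∧
      ∃ σ : Matrix ι ι ℂ × Matrix ι ι ℂ → Matrix ι ι ℂ, ContDiffOn ℝ ∞ σ N ∧
        (∀ y ∈ N, σ y ∈ unitaryGroup ι ℂ) ∧
        ∀ y ∈ modelSet c, y ∈ N → act (σ y) (basePair c) = y := by
  let A : Matrix ι ι ℂ × Matrix ι ι ℂ → ι → EuclideanSpace ℂ ι := fun y => columns (preframe c y)
  have hA : ContDiff ℝ ∞ A := contDiff_columns.comp (contDiff_preframe c)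
  refine ⟨A ⁻¹' {v | LinearIndependent ℂ v}, ?_, ?_, fun y => ofColumns (orthonormalize (A y)),
    ?_, ?_, ?_⟩
  · exact (isOpen_setOfPred_linearIndependent (𝕜 := ℂ)).preimage hA.continuous
  · change LinearIndependent ℂ (columns (preframe c (basePair c)))
    rw [preframe_basePair]
    exact linearIndependent_columns_one
  · intro y hy
    have ho : ContDiffAt ℝ ∞ (fun y => orthonormalize (A y)) y := contDiffAt_pi.2 fun i =>
      (contDiffAt_orthonormalize (v := A y) hy i).comp y hA.contDiffAt
    exact (ContDiffAt.comp y (contDiff_ofColumns (ι := ι)).contDiffAt ho).contDiffWithinAt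
  · exact fun y hy => ofColumns_mem_unitaryGroup (orthonormal_orthonormalize hy)
  · rintro y ⟨u, rfl⟩ hy
    let s : unitaryGroup ι ℂ := ⟨_, ofColumns_mem_unitaryGroup (orthonormal_orthonormalize hy)⟩
    have hs : ∀ i, orthonormalize (A (act (u : Matrix ι ι ℂ) (basePair c))) i ∈ part c u (c i) := by
      refine orthonormalize_mem (part c u) c ?_ ?_ (columns_preframe_mem c u)
      · intro a b hab x hx z hz
        rw [inner_eq_sum_mulVec u]
        refine Finset.sum_eq_zero fun j _ => ?_
        by_cases hj : c j = a
        · rw [hz.1 j (fun e => hab (hj.symm.trans e)), mul_zero]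
        · rw [hx.1 j hj, map_zero, zero_mul]
      · intro a x hx z hz
        have hsm : ∀ j, ((u : Matrix ι ι ℂ)ᴴ *ᵥ ((inner ℂ x z : ℂ) • x).ofLp) j =
            inner ℂ x z * ((u : Matrix ι ι ℂ)ᴴ *ᵥ x.ofLp) j := fun j => by
          simp [mulVec_smul]
        refine ⟨fun j hj => ?_, fun ha j => ?_⟩
        · rw [hsm, hx.1 j hj, mul_zero]
        · rw [hsm, inner_eq_sum_mulVec u, Complex.mul_im, hx.2 ha j, mul_zero, zero_add,
            Complex.im_sum]
          rw [Finset.sum_eq_zero, zero_mul]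
          intro k _
          simp [Complex.mul_im, hx.2 ha k, hz.2 ha k]
    change act (s : Matrix ι ι ℂ) _ = _
    refine ((act_eq_act_iff c u s).2 ?_).symm
    -- The entries of `u⁻¹ s` are the coordinates of the orthonormalized columns in the frame `u`;
    -- membership in the parts is thus exactly the block condition.
    have hent : ∀ j i, ((u⁻¹ * s : unitaryGroup ι ℂ) : Matrix ι ι ℂ) j i =
        ((u : Matrix ι ι ℂ)ᴴ *ᵥ (orthonormalize (A (act (u : Matrix ι ι ℂ) (basePair c))) i).ofLp) j :=
      fun j i => rfl
    refine ⟨fun j i hji => ?_, fun j i _ hi => ?_⟩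
    · rw [hent]
      exact (hs i).1 j hji
    · rw [hent]
      exact (hs i).2 hi j

lemma act_mem_modelSet (u : unitaryGroup ι ℂ) {y : Matrix ι ι ℂ × Matrix ι ι ℂ}
    (hy : y ∈ modelSet c) : act (u : Matrix ι ι ℂ) y ∈ modelSet c := by
  obtain ⟨v, rfl⟩ := hy
  exact ⟨u * v, act_mul _ _ _⟩

lemma act_inv_act (u : unitaryGroup ι ℂ) (y : Matrix ι ι ℂ × Matrix ι ι ℂ) :
    act ((u⁻¹ : unitaryGroup ι ℂ) : Matrix ι ι ℂ) (act (u : Matrix ι ι ℂ) y) = y := by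
  rw [← act_mul, ← Submonoid.coe_mul, inv_mul_cancel]; exact act_one y

lemma act_act_inv (u : unitaryGroup ι ℂ) (y : Matrix ι ι ℂ × Matrix ι ι ℂ) :
    act (u : Matrix ι ι ℂ) (act ((u⁻¹ : unitaryGroup ι ℂ) : Matrix ι ι ℂ) y) = y := by
  rw [← act_mul, ← Submonoid.coe_mul, mul_inv_cancel]; exact act_one y

lemma contDiff_act_left (g : Matrix ι ι ℂ) : ContDiff ℝ ∞ (act g) :=
  contDiff_act_comp contDiff_const contDiff_id

/-- The orbit map has smooth local sections. -/
theorem exists_section (y₀ : modelSet c) :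
    ∃ N : Set (Matrix ι ι ℂ × Matrix ι ι ℂ), IsOpen N ∧ (y₀ : Matrix ι ι ℂ × Matrix ι ι ℂ) ∈ N ∧
      ∃ σ : Matrix ι ι ℂ × Matrix ι ι ℂ → Matrix ι ι ℂ, ContDiffOn ℝ ∞ σ N ∧
        (∀ y ∈ N, σ y ∈ unitaryGroup ι ℂ) ∧
        ∀ y ∈ modelSet c, y ∈ N → act (σ y) (basePair c) = y := by
  obtain ⟨_, u, rfl⟩ := y₀
  obtain ⟨N, hN, h1, σ, hσ, hσu, hσs⟩ := exists_section_one c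
  have hc := contDiff_act_left ((u⁻¹ : unitaryGroup ι ℂ) : Matrix ι ι ℂ)
  refine ⟨act ((u⁻¹ : unitaryGroup ι ℂ) : Matrix ι ι ℂ) ⁻¹' N, hN.preimage hc.continuous, ?_,
    -- The section near the base point is translated by `u`.
    fun y => u * σ (act ((u⁻¹ : unitaryGroup ι ℂ) : Matrix ι ι ℂ) y), ?_, ?_, ?_⟩
  · rwa [Set.mem_preimage, act_inv_act]
  · exact contDiffOn_const.mul (hσ.comp hc.contDiffOn fun y hy => hy)
  · exact fun y hy => mul_mem u.2 (hσu _ hy)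
  · intro y hy hyN
    rw [act_mul, hσs _ (act_mem_modelSet c _ hy) hyN, act_act_inv]

lemma dSmooth_orbitMap : DSmooth (orbitMap c) := fun n p hp => by
  have hp' : ContDiff ℝ ∞ fun t => (p t : Matrix ι ι ℂ) := isPlot_iff_contDiff.1 hp
  exact isPlot_set_iff.2 (contDiff_act_comp hp' contDiff_const)

theorem locallyLifts_orbitMap : LocallyLifts (orbitMap c) := by
  intro n p hp t
  have hp' := isPlot_set_iff.1 hp
  obtain ⟨N, hN, hy, σ, hσ, hσu, hσs⟩ := exists_section c (p t)
  obtain ⟨r, hr, hball⟩ := Metric.isOpen_iff.mp (hN.preimage hp'.continuous) t hy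
  have hmem : ∀ s, (p (univBall t r s) : Matrix ι ι ℂ × Matrix ι ι ℂ) ∈ N :=
    fun s => hball (univBall_mem_ball t hr s)
  refine ⟨r, hr, fun s => ⟨σ (p (univBall t r s)), hσu _ (hmem s)⟩, ?_, fun s => ?_⟩
  · refine isPlot_subtype_iff.2 (isPlot_iff_contDiff.2 ?_)
    rw [← contDiffOn_univ]
    exact hσ.comp (hp'.comp contDiff_univBall).contDiffOn fun s _ => hmem s
  · exact Subtype.ext (hσs _ (p _).2 (hmem s)).symm

/-- The action of a unitary matrix on the model set. -/
def actEquiv (u : unitaryGroup ι ℂ) : modelSet c ≃ modelSet c where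
  toFun y := ⟨act (u : Matrix ι ι ℂ) y, act_mem_modelSet c u y.2⟩
  invFun y := ⟨act ((u⁻¹ : unitaryGroup ι ℂ) : Matrix ι ι ℂ) y, act_mem_modelSet c u⁻¹ y.2⟩
  left_inv y := Subtype.ext (act_inv_act u y)
  right_inv y := Subtype.ext (act_act_inv u y)

lemma isDiffeomorphism_actEquiv (u : unitaryGroup ι ℂ) : IsDiffeomorphism (actEquiv c u) :=
  ⟨fun _ _ hp => isPlot_set_iff.2 (contDiff_act_comp contDiff_const (isPlot_set_iff.1 hp)),
    fun _ _ hp => isPlot_set_iff.2 (contDiff_act_comp contDiff_const (isPlot_set_iff.1 hp))⟩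

/-- The section is unitary on an ambient open set and not only on the orbit, so following it by the
orbit map retracts that open set into the orbit. -/
lemma hasSmoothRetractions_modelSet : HasSmoothRetractions (modelSet c) := by
  intro y hy
  obtain ⟨N, hN, hy, σ, hσ, hσu, hσs⟩ := exists_section c ⟨y, hy⟩
  exact ⟨N, hN, hy, fun z => act (σ z) (basePair c),
    contDiffOn_act_comp hσ contDiffOn_const,
    fun z hz => ⟨⟨σ z, hσu z hz⟩, rfl⟩, hσs⟩

theorem exists_isSmoothManifold_modelSet : ∃ d, IsSmoothManifold d (modelSet c) := by
  refine (hasSmoothRetractions_modelSet c).exists_isSmoothManifold (orbitMap c 1) ?_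
  rintro ⟨_, u, rfl⟩
  refine ⟨actEquiv c u⁻¹, isDiffeomorphism_actEquiv c u⁻¹, Subtype.ext ?_⟩
  change act ((u⁻¹ : unitaryGroup ι ℂ) : Matrix ι ι ℂ) (act (u : Matrix ι ι ℂ) (basePair c)) = act 1 (basePair c)
  rw [act_inv_act, act_one]

end BlockModel

end

/-! ### The fibration of the model and its fiber -/

noncomputable section

open scoped ContDiff Topology
open DiffeologicalSpace (induced coinduced ofVectorSpace generateFrom)
open OpenPartialHomeomorph (univBall univBall_source univBall_target univBall_apply_zero
  contDiff_univBall contDiffOn_univBall_symm)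

open Matrix

attribute [local instance] Matrix.linftyOpNormedRing Matrix.linftyOpNormedAlgebra

theorem IsSmoothFiberBundle.congr_fiber {E B F F' : Type*} [DiffeologicalSpace E]
    [DiffeologicalSpace B] [DiffeologicalSpace F] [DiffeologicalSpace F'] {f : E → B}
    (hf : IsSmoothFiberBundle F f) {Λ : F ≃ F'} (hΛ : IsDiffeomorphism Λ) :
    IsSmoothFiberBundle F' f := by
  refine ⟨hf.1, hf.2.1, fun b => ?_⟩
  obtain ⟨U, hU, hb, Φ, hΦ, h⟩ := hf.2.2 b
  refine ⟨U, hU, hb, Φ.trans (Equiv.prodCongr (Equiv.refl U) Λ), ⟨?_, ?_⟩, h⟩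
  · exact (dSmooth_fst.comp hΦ.1).prodMk (hΛ.1.comp (dSmooth_snd.comp hΦ.1))
  · exact hΦ.2.comp (dSmooth_fst.prodMk (hΛ.2.comp dSmooth_snd))

/-- An equivariant smooth map onto a homogeneous space with smooth local sections is a fiber bundle
whose typical fiber is any of its fibers. -/
theorem isSmoothFiberBundle_of_equivariant {G E B : Type*} [Group G] [MulAction G E]
    [MulAction G B] [DiffeologicalSpace G] [DiffeologicalSpace E] [DiffeologicalSpace B]
    (hinv : DSmooth fun g : G => g⁻¹) (hE : DSmooth fun z : G × E => z.1 • z.2)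
    {f : E → B} (hf : DSmooth f) (hfs : Function.Surjective f) (hfe : ∀ (g : G) x, f (g • x) = g • f x)
    (b₀ : B) (hB : ∀ b : B, ∃ U : Set B, @IsOpen _ dTopology U ∧ b ∈ U ∧
      ∃ s : U → G, DSmooth s ∧ ∀ z : U, s z • b₀ = z) :
    IsSmoothFiberBundle {x // f x = b₀} f := by
  refine ⟨hf, hfs, fun b => ?_⟩
  obtain ⟨U, hU, hb, s, hs, hsb⟩ := hB b
  refine ⟨U, hU, hb, ?_⟩
  have h1 : ∀ (x : E) (hx : f x ∈ U), f ((s ⟨f x, hx⟩)⁻¹ • x) = b₀ := fun x hx => by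
    rw [hfe, inv_smul_eq_iff, hsb]
  have h2 : ∀ (z : U) (x : {x // f x = b₀}), f (s z • x.1) = z := fun z x => by
    rw [hfe, x.2, hsb]
  -- The local section moves the fiber over `f x` back to the fiber over `b₀`.
  let Φ : (f ⁻¹' U) ≃ U × {x // f x = b₀} :=
    { toFun := fun x => (⟨f x.1, x.2⟩, ⟨(s ⟨f x.1, x.2⟩)⁻¹ • x.1, h1 _ _⟩)
      invFun := fun z => ⟨s z.1 • z.2.1, by rw [Set.mem_preimage, h2]; exact z.1.2⟩
      left_inv := fun x => Subtype.ext (smul_inv_smul _ _)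
      right_inv := fun z => by
        have h3 : ∀ (w : B) (hw : w ∈ U), w = z.1 →
            (s ⟨w, hw⟩)⁻¹ • s z.1 • z.2.1 = z.2.1 := by
          rintro _ hw rfl
          exact inv_smul_smul _ _
        exact Prod.ext (Subtype.ext (h2 _ _)) (Subtype.ext (h3 _ _ (h2 _ _))) }
  have h4 : DSmooth fun x : f ⁻¹' U => (⟨f x.1, x.2⟩ : U) :=
    dSmooth_subtype_iff.2 (hf.comp dSmooth_subtype_val)
  refine ⟨Φ, ⟨h4.prodMk (dSmooth_subtype_iff.2 ?_), dSmooth_subtype_iff.2 ?_⟩, fun x => rfl⟩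
  · exact hE.comp ((hinv.comp (hs.comp h4)).prodMk dSmooth_subtype_val)
  · exact hE.comp ((hs.comp dSmooth_fst).prodMk (dSmooth_subtype_val.comp dSmooth_snd))

namespace BlockModel

section Bundle

variable {ι : Type*} [Fintype ι] [DecidableEq ι] (c : ι → Fin 3)

/-- The colouring in which the colours `1` and `2` are merged. -/
def mergeColor {ι : Type*} (c : ι → Fin 3) (i : ι) : Fin 3 := if c i = 0 then 0 else 2

omit [Fintype ι] [DecidableEq ι] in
lemma mergeColor_eq_zero_iff (i : ι) : mergeColor c i = 0 ↔ c i = 0 := by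
  unfold mergeColor; split_ifs with h <;> simp [h]

omit [Fintype ι] [DecidableEq ι] in
lemma mergeColor_ne_one (i : ι) : mergeColor c i ≠ 1 := by
  unfold mergeColor; split_ifs <;> simp

omit [Fintype ι] in
-- Merging is into colour `2`, which leaves colour `1` empty. Forgetting the second matrix therefore
-- lands in a model set of the same kind, with its own local sections.
lemma basePair_mergeColor : basePair (mergeColor c) = (diagProj c 0, 0) := by
  rw [basePair, diagProj, diagProj, diagProj]
  simp only [mergeColor_eq_zero_iff, mergeColor_ne_one, if_false]
  rw [diagonal_zero]

lemma act_basePair_mergeColor (g : Matrix ι ι ℂ) :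
    act g (basePair (mergeColor c)) = ((act g (basePair c)).1, 0) := by
  rw [basePair_mergeColor]
  simp [act, basePair]

/-- The projection forgetting the second matrix. -/
def modelMap (y : modelSet c) : modelSet (mergeColor c) :=
  ⟨((y : Matrix ι ι ℂ × Matrix ι ι ℂ).1, 0), by
    obtain ⟨_, u, rfl⟩ := y
    exact ⟨u, act_basePair_mergeColor c u⟩⟩

lemma modelMap_orbitMap (u : unitaryGroup ι ℂ) :
    modelMap c (orbitMap c u) = orbitMap (mergeColor c) u :=
  Subtype.ext (act_basePair_mergeColor c u).symm

/-- The fiber of `modelMap` over the base point. -/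
abbrev ModelFiber : Type _ :=
  {y : modelSet c // (y : Matrix ι ι ℂ × Matrix ι ι ℂ).1 = diagProj c 0}

lemma dSmooth_modelMap : DSmooth (modelMap c) := fun _ _ hp =>
  isPlot_set_iff.2 ((contDiff_fst.comp (isPlot_set_iff.1 hp)).prodMk contDiff_const)

instance : MulAction (unitaryGroup ι ℂ) (modelSet c) where
  smul u y := actEquiv c u y
  one_smul _ := Subtype.ext (act_one _)
  mul_smul _ _ _ := Subtype.ext (act_mul _ _ _)

lemma coe_smul (u : unitaryGroup ι ℂ) (y : modelSet c) :
    ((u • y : modelSet c) : Matrix ι ι ℂ × Matrix ι ι ℂ) = act (u : Matrix ι ι ℂ) y := rfl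

lemma modelMap_smul (u : unitaryGroup ι ℂ) (y : modelSet c) :
    modelMap c (u • y) = u • modelMap c y := by
  apply Subtype.ext
  rw [coe_smul]
  simp [modelMap, coe_smul, act]

lemma dSmooth_inv_unitaryGroup : DSmooth fun u : unitaryGroup ι ℂ => u⁻¹ := fun _ _ hp =>
  isPlot_set_iff.2 (contDiff_conjTranspose.comp (isPlot_set_iff.1 hp))

lemma dSmooth_smul_modelSet :
    DSmooth fun z : unitaryGroup ι ℂ × modelSet c => z.1 • z.2 := fun _ _ hp =>
  isPlot_set_iff.2 (contDiff_act_comp (isPlot_set_iff.1 (isPlot_prod_iff.1 hp).1)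
    (isPlot_set_iff.1 (isPlot_prod_iff.1 hp).2))

lemma modelMap_eq_base_iff (y : modelSet c) :
    modelMap c y = orbitMap (mergeColor c) 1 ↔
      (y : Matrix ι ι ℂ × Matrix ι ι ℂ).1 = diagProj c 0 := by
  have h : (orbitMap (mergeColor c) 1 : Matrix ι ι ℂ × Matrix ι ι ℂ) = (diagProj c 0, 0) := by
    change act ((1 : unitaryGroup ι ℂ) : Matrix ι ι ℂ) (basePair (mergeColor c)) = _
    rw [Submonoid.coe_one, act_one, basePair_mergeColor]
  rw [← Subtype.coe_inj, h]
  simp [modelMap]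

lemma exists_dSmooth_section (b : modelSet c) :
    ∃ U : Set (modelSet c), @IsOpen _ dTopology U ∧ b ∈ U ∧
      ∃ s : U → unitaryGroup ι ℂ, DSmooth s ∧ ∀ z : U, s z • orbitMap c 1 = z := by
  obtain ⟨N, hN, hb, σ, hσ, hσu, hσs⟩ := exists_section c b
  refine ⟨Subtype.val ⁻¹' N, isOpen_dTopology_preimage_val _ hN, hb,
    fun z => ⟨σ z, hσu _ z.2⟩, fun n p hp => isPlot_set_iff.2 ?_, fun z => Subtype.ext ?_⟩
  · have hp' : ContDiff ℝ ∞ fun t => ((p t).1 : Matrix ι ι ℂ × Matrix ι ι ℂ) :=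
      isPlot_set_iff.1 (isPlot_subtype_iff.1 hp)
    rw [← contDiffOn_univ]
    exact ContDiffOn.comp (g := σ) hσ hp'.contDiffOn fun t _ => (p t).2
  · have h1 : (orbitMap c 1 : Matrix ι ι ℂ × Matrix ι ι ℂ) = basePair c := act_one _
    rw [coe_smul, h1]
    exact hσs _ z.1.2 z.2

/-- Forgetting the second matrix commutes with the unitary action, and the base is a homogeneous
space with smooth local sections, so the equivariant bundle criterion applies. -/
theorem isSmoothFiberBundle_modelMap : IsSmoothFiberBundle (ModelFiber c) (modelMap c) := by
  have hs : Function.Surjective (modelMap c) := by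
    rintro ⟨_, u, rfl⟩
    exact ⟨orbitMap c u, modelMap_orbitMap c u⟩
  have h := isSmoothFiberBundle_of_equivariant dSmooth_inv_unitaryGroup (dSmooth_smul_modelSet c)
    (dSmooth_modelMap c) hs (modelMap_smul c) (orbitMap (mergeColor c) 1)
    (exists_dSmooth_section (mergeColor c))
  exact h.congr_fiber (Λ := Equiv.subtypeEquivRight (modelMap_eq_base_iff c))
    ⟨fun _ _ hp => hp, fun _ _ hp => hp⟩

end Bundle

/-! ### Standard block colouring: the stabilizer and the fiber -/

section Blocks

variable (n₀ p q : ℕ)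

/-- The colouring of the index set of `U(n₀ + p + q)` by blocks. -/
def blockColor : Fin n₀ ⊕ Fin p ⊕ Fin q → Fin 3 :=
  Sum.elim (fun _ => 0) (Sum.elim (fun _ => 1) (fun _ => 2))

variable {n₀ p q}

lemma mem_blockSubgroup_iff (g : unitaryGroup (Fin n₀ ⊕ Fin p ⊕ Fin q) ℂ) :
    g ∈ blockSubgroup n₀ p q ↔ IsBlock (blockColor n₀ p q) g.1 := by
  constructor
  · rintro ⟨a, -, b, -, d, -, h⟩
    rw [h]
    refine ⟨?_, ?_⟩
    · rintro (i | i | i) (j | j | j) hij <;> first | rfl | exact absurd rfl hij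
    · rintro (i | i | i) (j | j | j) hi hj
      · exact Complex.ofReal_im _
      all_goals simp [blockColor] at hi hj
  · rintro ⟨h1, h2⟩
    let M : Matrix (Fin n₀ ⊕ Fin p ⊕ Fin q) (Fin n₀ ⊕ Fin p ⊕ Fin q) ℂ := g
    let a : Matrix (Fin n₀) (Fin n₀) ℝ := Matrix.of fun i j => (M (Sum.inl i) (Sum.inl j)).re
    let b : Matrix (Fin p) (Fin p) ℂ :=
      Matrix.of fun i j => M (Sum.inr (Sum.inl i)) (Sum.inr (Sum.inl j))
    let d : Matrix (Fin q) (Fin q) ℂ :=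
      Matrix.of fun i j => M (Sum.inr (Sum.inr i)) (Sum.inr (Sum.inr j))
    have hM : M = Matrix.fromBlocks (a.map Complex.ofReal) 0 0 (Matrix.fromBlocks b 0 0 d) := by
      ext i j
      rcases i with i | i | i <;> rcases j with j | j | j
      · exact (Complex.conj_eq_iff_re.1 (Complex.conj_eq_iff_im.2 (h2 _ _ rfl rfl))).symm
      all_goals first | rfl | exact h1 _ _ (by simp [blockColor])
    -- Unitarity of a block diagonal matrix, read block by block, gives orthogonality or unitarity
    -- of each block.
    have hu : Mᴴ * M = 1 := conjTranspose_mul_self g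
    rw [hM, Matrix.fromBlocks_conjTranspose, Matrix.fromBlocks_conjTranspose,
      Matrix.fromBlocks_multiply, Matrix.fromBlocks_multiply, ← Matrix.fromBlocks_one,
      ← Matrix.fromBlocks_one] at hu
    simp only [Matrix.conjTranspose_zero, Matrix.mul_zero, Matrix.zero_mul, add_zero, zero_add,
      Matrix.fromBlocks_inj] at hu
    obtain ⟨ha, -, -, hb, -, -, hd⟩ := hu
    refine ⟨a, ?_, b, mem_unitaryGroup_iff'.2 hb, d, mem_unitaryGroup_iff'.2 hd, hM⟩
    rw [mem_orthogonalGroup_iff']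
    have h3 : (a.map Complex.ofReal)ᴴ = (star a).map Complex.ofReal := by
      ext i j
      simp [Matrix.star_eq_conjTranspose, Matrix.conjTranspose_apply]
    have h4 : (star a * a).map Complex.ofReal =
        (star a).map Complex.ofReal * a.map Complex.ofReal :=
      Matrix.map_mul (f := Complex.ofRealHom)
    rw [h3, ← h4] at ha
    refine Matrix.map_injective Complex.ofReal_injective ?_
    change (star a * a).map Complex.ofReal = Matrix.map 1 Complex.ofReal
    rw [ha, Matrix.map_one _ Complex.ofReal_zero Complex.ofReal_one]

theorem diffeomorphic_modelSet_quotient :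
    Diffeomorphic (modelSet (blockColor n₀ p q))
      (unitaryGroup (Fin n₀ ⊕ Fin p ⊕ Fin q) ℂ ⧸ blockSubgroup n₀ p q) := by
  obtain ⟨Φ, hΦ, -⟩ := exists_diffeomorphism_quotient (blockSubgroup n₀ p q)
    (dSmooth_orbitMap (blockColor n₀ p q)) (locallyLifts_orbitMap _) (orbitMap_surjective _)
    (fun g g' => by
      rw [mem_blockSubgroup_iff, ← act_eq_act_iff]
      exact Subtype.ext_iff)
  exact ⟨Φ.symm, hΦ.symm⟩

/-! #### The fiber is a Grassmannian -/

/-- The coordinate space with its euclidean norm. -/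
def toEuc (m : ℕ) : (Fin m → ℂ) ≃ₗ[ℂ] EuclideanSpace ℂ (Fin m) := (WithLp.linearEquiv 2 ℂ _).symm

lemma toEuc_apply {m : ℕ} (v : Fin m → ℂ) (k : Fin m) : toEuc m v k = v k := rfl

/-- The orthogonal projection onto `L`, as a matrix extended by zero. -/
def padProj (L : Submodule ℂ (Fin (p + q) → ℂ)) :
    Matrix (Fin n₀ ⊕ Fin p ⊕ Fin q) (Fin n₀ ⊕ Fin p ⊕ Fin q) ℂ :=
  Matrix.fromBlocks 0 0 0 (Matrix.of fun a b =>
    (L.map (toEuc (p + q)).toLinearMap).starProjection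
      (EuclideanSpace.single (finSumFinEquiv b) 1) (finSumFinEquiv a))

/-- The columns of colour `1`, restricted to the coordinates of colour `1` and `2`. -/
def frameOf (u : Matrix (Fin n₀ ⊕ Fin p ⊕ Fin q) (Fin n₀ ⊕ Fin p ⊕ Fin q) ℂ) (s : Fin p) :
    Fin (p + q) → ℂ :=
  fun k => u (Sum.inr (finSumFinEquiv.symm k)) (Sum.inr (Sum.inl s))

/-- Preserving `D₀` means `u D₀ = D₀ ū`, whose entries between colour `0` and the rest give the
vanishing. -/
lemma apply_inl_inr_eq_zero {u : unitaryGroup (Fin n₀ ⊕ Fin p ⊕ Fin q) ℂ}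
    (hu : (act u.1 (basePair (blockColor n₀ p q))).1 =
      diagProj (blockColor n₀ p q) 0) (i : Fin n₀) (j : Fin p ⊕ Fin q) :
    u.1 (Sum.inl i) (Sum.inr j) = 0 := by
  have h := (mul_mul_transpose_eq_iff u (diagProj (blockColor n₀ p q) 0)).1 hu
  have h' := congrFun (congrFun h (Sum.inl i)) (Sum.inr j)
  rw [mul_diagProj_apply, diagProj_mul_apply, if_neg (by rcases j with j | j <;> simp [blockColor]),
    if_pos (by rfl)] at h'
  exact (map_eq_zero (starRingEnd ℂ)).1 h'.symm

lemma orthonormal_frameOf {u : unitaryGroup (Fin n₀ ⊕ Fin p ⊕ Fin q) ℂ}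
    (hu : (act u.1 (basePair (blockColor n₀ p q))).1 =
      diagProj (blockColor n₀ p q) 0) :
    Orthonormal ℂ fun s => toEuc (p + q) (frameOf u.1 s) := by
  rw [orthonormal_iff_ite]
  intro s s'
  have h := congrFun (congrFun (conjTranspose_mul_self u) (Sum.inr (Sum.inl s)))
    (Sum.inr (Sum.inl s'))
  rw [Matrix.mul_apply, Fintype.sum_sum_type, Finset.sum_eq_zero, zero_add, Matrix.one_apply] at h
  · simp only [Sum.inr.injEq, Sum.inl.injEq] at h
    rw [PiLp.inner_apply, ← h, ← finSumFinEquiv.sum_comp]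
    refine Finset.sum_congr rfl fun k _ => ?_
    simp [toEuc_apply, frameOf, mul_comm]
  · intro i _
    rw [apply_inl_inr_eq_zero hu, mul_zero]

/-- `u D₁ u*` is the sum of the rank-one projections onto the colour `1` columns of `u`. These have
no colour `0` coordinates and are orthonormal, so this is the padded projection onto their span. -/
lemma padProj_span_frameOf {u : unitaryGroup (Fin n₀ ⊕ Fin p ⊕ Fin q) ℂ}
    (hu : (act u.1 (basePair (blockColor n₀ p q))).1 =
      diagProj (blockColor n₀ p q) 0) :
    padProj (Submodule.span ℂ (Set.range (frameOf u.1))) =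
      (act u.1 (basePair (blockColor n₀ p q))).2 := by
  have hsum : ∀ i j, (act u.1 (basePair (blockColor n₀ p q))).2 i j =
      ∑ s : Fin p, u.1 i (Sum.inr (Sum.inl s)) *
        (starRingEnd ℂ) (u.1 j (Sum.inr (Sum.inl s))) := by
    intro i j
    change (u.1 * diagProj (blockColor n₀ p q) 1 * u.1ᴴ) i j = _
    rw [Matrix.mul_apply, Fintype.sum_sum_type, Fintype.sum_sum_type]
    simp only [mul_diagProj_apply, blockColor, Sum.elim_inl, Sum.elim_inr]
    simp
  have hspan : Submodule.span ℂ (Set.range fun s => toEuc (p + q) (frameOf u.1 s)) =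
      (Submodule.span ℂ (Set.range (frameOf u.1))).map
        (toEuc (p + q)).toLinearMap := by
    rw [Submodule.map_span, ← Set.range_comp]
    rfl
  ext i j
  rw [hsum]
  rcases i with i | i
  · rw [Finset.sum_eq_zero fun s _ => by rw [apply_inl_inr_eq_zero hu, zero_mul]]
    rcases j with j | j <;> rfl
  rcases j with j | j
  · rw [Finset.sum_eq_zero fun s _ => by rw [apply_inl_inr_eq_zero hu, map_zero, mul_zero]]
    rfl
  change (Submodule.map (toEuc (p + q)).toLinearMap _).starProjection
    (EuclideanSpace.single (finSumFinEquiv j) 1) (finSumFinEquiv i) = _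
  rw [starProjection_eq_sum (orthonormal_frameOf hu) hspan]
  simp only [WithLp.ofLp_sum, WithLp.ofLp_smul, Finset.sum_apply, Pi.smul_apply, smul_eq_mul]
  refine Finset.sum_congr rfl fun s _ => ?_
  rw [EuclideanSpace.inner_single_right]
  simp [toEuc_apply, frameOf, mul_comm]

/-- An orthonormal basis of `L` is completed to one of `ℂ^{p+q}`, and the resulting unitary matrix
is padded by the identity on colour `0`. -/
lemma exists_frameOf_span_eq (L : Submodule ℂ (Fin (p + q) → ℂ)) (hL : finrank ℂ L = p) :
    ∃ u : unitaryGroup (Fin n₀ ⊕ Fin p ⊕ Fin q) ℂ,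
      (act u.1 (basePair (blockColor n₀ p q))).1 = diagProj (blockColor n₀ p q) 0 ∧
      Submodule.span ℂ (Set.range (frameOf u.1)) = L := by
  let L' := L.map (toEuc (p + q)).toLinearMap
  have hL' : finrank ℂ L' = p := (LinearEquiv.finrank_map_eq (toEuc (p + q)) L).trans hL
  let b₀ : OrthonormalBasis (Fin p) ℂ L' := (stdOrthonormalBasis ℂ L').reindex (finCongr hL')
  let v : Fin p ⊕ Fin q → EuclideanSpace ℂ (Fin (p + q)) :=
    Sum.elim (fun s => (b₀ s : EuclideanSpace ℂ (Fin (p + q)))) 0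
  have hv : Orthonormal ℂ ((Set.range Sum.inl).domRestrict v) := by
    have h1 : Orthonormal ℂ fun s => (b₀ s : EuclideanSpace ℂ (Fin (p + q))) :=
      b₀.orthonormal.comp_linearIsometry L'.subtypeₗᵢ
    have h2 := h1.comp (Equiv.ofInjective (Sum.inl : Fin p → Fin p ⊕ Fin q)
      Sum.inl_injective).symm (Equiv.injective _)
    convert! h2 using 1
    funext x
    obtain ⟨s, hs⟩ : ∃ s, Equiv.ofInjective (Sum.inl : Fin p → Fin p ⊕ Fin q)
      Sum.inl_injective s = x := Equiv.surjective _ x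
    subst hs
    simp [Set.domRestrict, v]
  obtain ⟨b, hb⟩ := hv.exists_orthonormalBasis_extension_of_card_eq (by simp)
  have hb' : ∀ s, b (Sum.inl s) = b₀ s := fun s => hb _ ⟨s, rfl⟩
  let w : Matrix (Fin p ⊕ Fin q) (Fin p ⊕ Fin q) ℂ :=
    Matrix.of fun a j => b j (finSumFinEquiv a)
  have hw : wᴴ * w = 1 := by
    ext i j
    rw [Matrix.mul_apply, Matrix.one_apply, ← orthonormal_iff_ite.1 b.orthonormal i j,
      PiLp.inner_apply, ← finSumFinEquiv.sum_comp]
    exact Finset.sum_congr rfl fun k _ => by simp [w, mul_comm]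
  let M : Matrix (Fin n₀ ⊕ Fin p ⊕ Fin q) (Fin n₀ ⊕ Fin p ⊕ Fin q) ℂ :=
    Matrix.fromBlocks 1 0 0 w
  have hM : M ∈ unitaryGroup (Fin n₀ ⊕ Fin p ⊕ Fin q) ℂ := by
    rw [mem_unitaryGroup_iff', star_eq_conjTranspose, Matrix.fromBlocks_conjTranspose,
      Matrix.fromBlocks_multiply, hw]
    simp
  have hd : diagProj (blockColor n₀ p q) 0 = Matrix.fromBlocks 1 0 0 0 := by
    ext i j
    rcases i with i | i | i <;> rcases j with j | j | j <;>
      simp [diagProj, blockColor, Matrix.diagonal_apply, Matrix.one_apply]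
  refine ⟨⟨M, hM⟩, ?_, ?_⟩
  · change M * diagProj (blockColor n₀ p q) 0 * Mᵀ = diagProj (blockColor n₀ p q) 0
    rw [hd, Matrix.fromBlocks_transpose, Matrix.fromBlocks_multiply, Matrix.fromBlocks_multiply]
    simp
  · have hf : ∀ s, toEuc (p + q) (frameOf M s) = b₀ s := fun s => by
      rw [← hb']
      ext k
      simp [toEuc_apply, frameOf, M, w]
    apply Submodule.map_injective_of_injective (toEuc (p + q)).injective
    change Submodule.map (toEuc (p + q)).toLinearMap _ = L'
    rw [Submodule.map_span, ← Set.range_comp]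
    have : Set.range ((toEuc (p + q)).toLinearMap ∘ frameOf M) =
        L'.subtype '' Set.range b₀ := by
      rw [← Set.range_comp]
      exact congrArg Set.range (funext hf)
    rw [this, Submodule.span_image, ← b₀.coe_toBasis, b₀.toBasis.span_eq, Submodule.map_top,
      Submodule.range_subtype]

lemma padProj_injective : Function.Injective (padProj (n₀ := n₀) (p := p) (q := q)) := by
  intro L L' h
  have h1 : ∀ k, (L.map (toEuc (p + q)).toLinearMap).starProjection
      (EuclideanSpace.single k 1) =
      (L'.map (toEuc (p + q)).toLinearMap).starProjection
        (EuclideanSpace.single k 1) := by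
    intro k
    ext l
    obtain ⟨a, rfl⟩ := finSumFinEquiv.surjective k
    obtain ⟨b, rfl⟩ := finSumFinEquiv.surjective l
    exact congrFun (congrFun h (Sum.inr b)) (Sum.inr a)
  have h2 : (L.map (toEuc (p + q)).toLinearMap).starProjection =
      (L'.map (toEuc (p + q)).toLinearMap).starProjection := by
    apply ContinuousLinearMap.coe_injective
    refine (EuclideanSpace.basisFun (Fin (p + q)) ℂ).toBasis.ext fun k => ?_
    simpa using h1 k
  have h3 : L.map (toEuc (p + q)).toLinearMap = L'.map (toEuc (p + q)).toLinearMap := by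
    rw [← Submodule.range_starProjection (L.map (toEuc (p + q)).toLinearMap), h2,
      Submodule.range_starProjection]
  exact Submodule.map_injective_of_injective (toEuc (p + q)).injective h3

lemma contDiff_matrix {ι F : Type*} [Fintype ι] [DecidableEq ι] [NormedAddCommGroup F]
    [NormedSpace ℝ F] {f : F → Matrix ι ι ℂ} (h : ∀ i j, ContDiff ℝ ∞ fun t => f t i j) :
    ContDiff ℝ ∞ f := by
  have h1 : ContDiff ℝ ∞ fun t => (fun i j => f t i j : ι → ι → ℂ) :=
    contDiff_pi.2 fun i => contDiff_pi.2 fun j => h i j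
  have h2 : ContDiff ℝ ∞ (fun g : ι → ι → ℂ => (Matrix.of g : Matrix ι ι ℂ)) :=
    contDiff_of_isLinearMap (E := ι → ι → ℂ) (F := Matrix ι ι ℂ) ⟨fun _ _ => rfl, fun _ _ => rfl⟩
  exact h2.comp h1

lemma contDiff_padProj {n : ℕ} {L : Eucl n → Submodule ℂ (Fin (p + q) → ℂ)} (hL : IsPlot L) :
    ContDiff ℝ ∞ fun t => padProj (n₀ := n₀) (L t) := by
  refine contDiff_matrix fun i j => ?_
  rcases i with i | i
  · rcases j with j | j <;> exact contDiff_const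
  rcases j with j | j
  · exact contDiff_const
  · exact (contDiff_of_isLinearMap (E := EuclideanSpace ℂ (Fin (p + q))) (F := ℂ)
      (f := fun v => v (finSumFinEquiv i)) ⟨fun _ _ => rfl, fun _ _ => rfl⟩).comp
      (contDiff_starProjection_map (toEuc (p + q)) hL _)

/-- The fiber point given by a complex subspace. -/
def toModelFiber (L : ComplexGrassmannian p (p + q)) : ModelFiber (blockColor n₀ p q) :=
  ⟨⟨(diagProj (blockColor n₀ p q) 0, padProj L.1), by
    obtain ⟨u, hu, hL⟩ := exists_frameOf_span_eq (n₀ := n₀) L.1 L.2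
    refine ⟨u, Prod.ext hu ?_⟩
    rw [← hL]
    exact (padProj_span_frameOf hu).symm⟩, rfl⟩

lemma linearIndependent_frameOf {u : unitaryGroup (Fin n₀ ⊕ Fin p ⊕ Fin q) ℂ}
    (hu : (act u.1 (basePair (blockColor n₀ p q))).1 =
      diagProj (blockColor n₀ p q) 0) :
    LinearIndependent ℂ (frameOf u.1) :=
  LinearIndependent.of_comp (toEuc (p + q)).toLinearMap
    (orthonormal_frameOf hu).linearIndependent

/-- A subspace and its orthogonal projection determine each other. The projection depends smoothly
on the subspace; conversely, a plot of the fiber lifts locally to unitary matrices, whose colour `1`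
columns form a smooth frame of the subspace. -/
theorem exists_diffeomorphism_modelFiber :
    ∃ Λ : ModelFiber (blockColor n₀ p q) ≃ ComplexGrassmannian p (p + q), IsDiffeomorphism Λ := by
  have key : ∀ (u : unitaryGroup (Fin n₀ ⊕ Fin p ⊕ Fin q) ℂ) (y : ModelFiber (blockColor n₀ p q)),
      orbitMap _ u = y.1 → ∃ hu : (act u.1 (basePair (blockColor n₀ p q))).1 =
        diagProj (blockColor n₀ p q) 0,
      toModelFiber ⟨_, finrank_span_eq_card (linearIndependent_frameOf hu) |>.trans (by simp)⟩ = y := by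
    rintro u ⟨y, hy⟩ rfl
    exact ⟨hy, Subtype.ext (Subtype.ext (Prod.ext hy.symm (padProj_span_frameOf hy)))⟩
  have hbij : Function.Bijective (toModelFiber (n₀ := n₀) (p := p) (q := q)) := by
    refine ⟨fun L L' h => Subtype.ext (padProj_injective (n₀ := n₀) ?_), fun y => ?_⟩
    · exact congrArg (fun y : ModelFiber (blockColor n₀ p q) => y.1.1.2) h
    · obtain ⟨u, hu⟩ := orbitMap_surjective _ y.1
      obtain ⟨_, h⟩ := key u y hu
      exact ⟨_, h⟩
  let Λ := Equiv.ofBijective _ hbij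
  refine ⟨Λ.symm, fun n y hy => isPlot_of_local fun t => ?_, fun n L hL => ?_⟩
  · obtain ⟨r, hr, u, hu, hyu⟩ := locallyLifts_orbitMap _ n _ (isPlot_subtype_iff.1 hy) t
    refine ⟨r, hr, ?_⟩
    choose h1 h2 using fun s => key (u s) (y (univBall t r s)) (hyu s).symm
    have h3 : ∀ s, (Λ.symm (y (univBall t r s))).1 =
        Frame.span (ℓ := p) ⟨_, linearIndependent_frameOf (h1 s)⟩ := fun s =>
      congrArg Subtype.val ((Equiv.symm_apply_eq Λ).2 (h2 s).symm)
    refine isPlot_subtype_iff.2 ?_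
    have h4 : (fun s => (Λ.symm (y (univBall t r s))).1) = fun s =>
      Frame.span (ℓ := p) ⟨_, linearIndependent_frameOf (h1 s)⟩ := funext h3
    simp only [Function.comp]
    rw [h4]
    refine isPlot_frame_span ?_
    let Lf : Matrix (Fin n₀ ⊕ Fin p ⊕ Fin q) (Fin n₀ ⊕ Fin p ⊕ Fin q) ℂ →ₗ[ℝ]
        (Fin p → Fin (p + q) → ℂ) :=
      { toFun := frameOf, map_add' := fun _ _ => rfl, map_smul' := fun _ _ => rfl }
    exact isPlot_ofVectorSpace_comp (isPlot_subtype_iff.1 hu) Lf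
  · refine isPlot_subtype_iff.2 (isPlot_set_iff.2 ?_)
    exact contDiff_const.prodMk (contDiff_padProj (isPlot_subtype_iff.1 hL))

theorem isSmoothFiberBundle_modelMap_blockColor :
    IsSmoothFiberBundle (ComplexGrassmannian p (p + q)) (modelMap (blockColor n₀ p q)) := by
  obtain ⟨Λ, hΛ⟩ := exists_diffeomorphism_modelFiber (n₀ := n₀) (p := p) (q := q)
  exact (isSmoothFiberBundle_modelMap _).congr_fiber hΛ

end Blocks

end BlockModel

end

/-! ### Unitary charts of a symplectic vector space with compatible complex structure -/

noncomputable section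

open Matrix

/-- The map is the coordinate map of an orthonormal basis. The inner product is passed as a core so
that its norm and instances exist only inside the proof. -/
lemma exists_linearEquiv_of_innerProductSpaceCore {V ι : Type*} [Fintype ι] [AddCommGroup V]
    [Module ℂ V] [Module ℝ V] [IsScalarTower ℝ ℂ V] [FiniteDimensional ℝ V]
    (core : InnerProductSpace.Core ℂ V) (hcard : finrank ℝ V = 2 * Fintype.card ι) :
    ∃ Φ : V ≃ₗ[ℂ] (ι → ℂ), ∀ v w,
      core.inner v w = ∑ i, (starRingEnd ℂ) (Φ v i) * Φ w i := by
  have : FiniteDimensional ℂ V := FiniteDimensional.right ℝ ℂ V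
  let _ : NormedAddCommGroup V := core.toNormedAddCommGroup
  let _ : InnerProductSpace ℂ V := InnerProductSpace.ofCore core.toCore
  have hfr : finrank ℂ V = Fintype.card ι := by
    have h := Module.finrank_mul_finrank ℝ ℂ V
    rw [Complex.finrank_real_complex] at h
    omega
  let b := (stdOrthonormalBasis ℂ V).reindex
    ((finCongr hfr).trans (Fintype.equivFin ι).symm)
  refine ⟨b.repr.toLinearEquiv.trans (WithLp.linearEquiv 2 ℂ (ι → ℂ)), fun v w => ?_⟩
  change (inner ℂ v w : ℂ) = _
  rw [← b.repr.inner_map_map, PiLp.inner_apply]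
  refine Finset.sum_congr rfl fun i _ => ?_
  simp [mul_comm]

section Chart

variable {V : Type*} [AddCommGroup V] [Module ℝ V] {ω : LinearMap.BilinForm ℝ V} {J : V →ₗ[ℝ] V}
  {ι : Type*} [Fintype ι]

/-- A linear isomorphism with `ℂ^ι` that carries `J` to multiplication by `i` and `ω` to the
imaginary part of the standard hermitian form. -/
structure IsUnitaryChart (ω : LinearMap.BilinForm ℝ V) (J : V →ₗ[ℝ] V) (Φ : V ≃ₗ[ℝ] (ι → ℂ)) :
    Prop where
  map_J : ∀ v i, Φ (J v) i = Complex.I * Φ v i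
  form : ∀ v w, ω v w = ∑ i, ((starRingEnd ℂ) (Φ v i) * Φ w i).im

/-- Scalar multiplication through `J` and the form `ω x (J y) + i ω x y` make `V` a complex inner
product space, positive by compatibility; an orthonormal basis is the chart. -/
theorem exists_isUnitaryChart [FiniteDimensional ℝ V] (hω : ω.IsAlt)
    (hJ : IsCompatibleComplexStructure ω J) (hcard : finrank ℝ V = 2 * Fintype.card ι) :
    ∃ Φ : V ≃ₗ[ℝ] (ι → ℂ), IsUnitaryChart ω J Φ := by
  have hJJ : (J : Module.End ℝ V) * J = -1 := LinearMap.ext fun v => hJ.sq v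
  let ρ : ℂ →ₐ[ℝ] Module.End ℝ V := Complex.liftAux J hJJ
  let _ : Module ℂ V := Module.compHom V ρ.toRingHom
  have hsmul : ∀ (z : ℂ) (v : V), z • v = z.re • v + z.im • J v := fun z v => by
    change ρ z v = _
    rw [Complex.liftAux_apply]
    rfl
  have : IsScalarTower ℝ ℂ V := ⟨fun r z v => by
    rw [hsmul, hsmul, Complex.smul_re, Complex.smul_im, smul_add, smul_smul, smul_smul]
    rfl⟩
  have hanti : ∀ x y, ω (J x) y = -ω x (J y) := fun x y => by
    have := hJ.symplectic (J x) y
    rw [hJ.sq, map_neg, LinearMap.neg_apply] at this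
    exact this.symm
  have hsymm : ∀ x y, ω y x = -ω x y := fun x y => (LinearMap.IsAlt.neg hω y x).symm ▸ by simp
  let core : InnerProductSpace.Core ℂ V :=
    { inner := fun x y => ⟨ω x (J y), ω x y⟩
      conj_inner_symm := fun x y => by
        apply Complex.ext
        · change ω y (J x) = ω x (J y)
          rw [hsymm (J x) y, hanti, neg_neg]
        · change -ω y x = ω x y
          rw [hsymm x y, neg_neg]
      re_inner_nonneg := fun x => by
        change 0 ≤ ω x (J x)
        by_cases hx : x = 0
        · simp [hx]
        · exact (hJ.pos x hx).le
      add_left := fun x y z => by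
        apply Complex.ext <;> simp
      smul_left := fun x y z => by
        have h1 : ω (J x) (J y) = ω x y := hJ.symplectic x y
        apply Complex.ext
        · simp [hsmul, h1]
        · simp [hsmul, hanti]
      definite := fun x hx => by
        by_contra h
        exact (hJ.pos x h).ne' (congrArg Complex.re hx) }
  obtain ⟨Φ, hΦ⟩ := exists_linearEquiv_of_innerProductSpaceCore core hcard
  refine ⟨Φ.restrictScalars ℝ, fun v i => ?_, fun v w => ?_⟩
  · have hJv : J v = Complex.I • v := by rw [hsmul]; simp
    change Φ (J v) i = _
    rw [hJv, map_smul]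
    rfl
  · have := congrArg Complex.im (hΦ v w)
    rw [Complex.im_sum] at this
    exact this

lemma IsUnitaryChart.apply_J {Φ : V ≃ₗ[ℝ] (ι → ℂ)} (hΦ : IsUnitaryChart ω J Φ)
    (v w : V) : ω v (J w) = ∑ i, ((starRingEnd ℂ) (Φ v i) * Φ w i).re := by
  rw [hΦ.form]
  refine Finset.sum_congr rfl fun i _ => ?_
  rw [hΦ.map_J]
  simp

/-- This is the transfer device: a fact proved for coordinate subspaces in an arbitrary unitary
chart holds for all their translates under `K`, which are coordinate subspaces in the moved chart.
-/
lemma IsUnitaryChart.symm_trans {Φ : V ≃ₗ[ℝ] (ι → ℂ)} (hΦ : IsUnitaryChart ω J Φ)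
    {k : V ≃ₗ[ℝ] V} (hk : k ∈ commutingSymplecticGroup ω J) :
    IsUnitaryChart ω J (k.symm.trans Φ) where
  map_J v i := by
    have : k.symm (J v) = J (k.symm v) := ((commutingSymplecticGroup ω J).inv_mem hk).2 v
    simp [this, hΦ.map_J]
  form v w := by
    have : ω (k.symm v) (k.symm w) = ω v w :=
      ((commutingSymplecticGroup ω J).inv_mem hk).1 v w
    rw [← this, hΦ.form]
    rfl

variable [DecidableEq ι] (Φ : V ≃ₗ[ℝ] (ι → ℂ))

/-- Unitary matrices acting on `V` through a chart. -/
def chartRot : unitaryGroup ι ℂ →* (V ≃ₗ[ℝ] V) where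
  toFun u := (Φ.trans ((UnitaryGroup.toLinearEquiv u).restrictScalars ℝ)).trans Φ.symm
  map_one' := by
    ext v
    change Φ.symm ((1 : Matrix ι ι ℂ) *ᵥ Φ v) = v
    simp
  map_mul' u u' := by
    ext v
    change Φ.symm (((u : Matrix ι ι ℂ) * (u' : Matrix ι ι ℂ)) *ᵥ Φ v) =
      Φ.symm ((u : Matrix ι ι ℂ) *ᵥ Φ (Φ.symm ((u' : Matrix ι ι ℂ) *ᵥ Φ v)))
    simp

lemma chart_chartRot (u : unitaryGroup ι ℂ) (v : V) :
    Φ (chartRot Φ u v) = (u : Matrix ι ι ℂ) *ᵥ Φ v :=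
  Φ.apply_symm_apply _

lemma chart_chartRot_symm (u : unitaryGroup ι ℂ) (v : V) :
    Φ ((chartRot Φ u).symm v) = (u : Matrix ι ι ℂ)ᴴ *ᵥ Φ v := by
  have : (chartRot Φ u).symm = chartRot Φ u⁻¹ := (map_inv (chartRot Φ) u).symm
  rw [this, chart_chartRot]
  rfl

lemma sum_conj_mulVec (u : unitaryGroup ι ℂ) (x y : ι → ℂ) :
    ∑ i, (starRingEnd ℂ) (((u : Matrix ι ι ℂ) *ᵥ x) i) * ((u : Matrix ι ι ℂ) *ᵥ y) i =
      ∑ i, (starRingEnd ℂ) (x i) * y i := by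
  change star ((u : Matrix ι ι ℂ) *ᵥ x) ⬝ᵥ ((u : Matrix ι ι ℂ) *ᵥ y) = star x ⬝ᵥ y
  rw [star_mulVec, dotProduct_mulVec, vecMul_vecMul, BlockModel.conjTranspose_mul_self, vecMul_one]

variable {Φ}

lemma chartRot_mem (hΦ : IsUnitaryChart ω J Φ) (u : unitaryGroup ι ℂ) :
    chartRot Φ u ∈ commutingSymplecticGroup ω J := by
  refine ⟨fun v w => ?_, fun v => ?_⟩
  · rw [hΦ.form, hΦ.form, ← Complex.im_sum, ← Complex.im_sum, chart_chartRot, chart_chartRot,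
      sum_conj_mulVec]
  · apply Φ.injective
    have h : ∀ w, Φ (J w) = Complex.I • Φ w := fun w => funext fun i => hΦ.map_J w i
    rw [h, chart_chartRot, chart_chartRot, h, mulVec_smul]

/-- Commuting with `J` makes `k` complex linear in the chart. Preserving `ω` as well as `ω · (J ·)`
preserves the imaginary and real parts of the hermitian form, so its matrix is unitary. -/
lemma exists_chartRot_eq (hΦ : IsUnitaryChart ω J Φ) {k : V ≃ₗ[ℝ] V}
    (hk : k ∈ commutingSymplecticGroup ω J) : ∃ u : unitaryGroup ι ℂ, chartRot Φ u = k := by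
  have hJ : ∀ w, Φ (J w) = Complex.I • Φ w := fun w => funext fun i => hΦ.map_J w i
  have hJ' : ∀ x, Φ.symm (Complex.I • x) = J (Φ.symm x) := fun x => by
    rw [LinearEquiv.symm_apply_eq, hJ, Φ.apply_symm_apply]
  let A : (ι → ℂ) →ₗ[ℂ] (ι → ℂ) :=
    { toFun := fun x => Φ (k (Φ.symm x))
      map_add' := fun x y => by simp
      map_smul' := fun z x => by
        have h1 : z • x = z.re • x + z.im • (Complex.I • x) := by
          funext i
          apply Complex.ext <;> simp [sub_eq_add_neg]
        have h2 : z • Φ (k (Φ.symm x)) =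
            z.re • Φ (k (Φ.symm x)) + z.im • (Complex.I • Φ (k (Φ.symm x))) := by
          funext i
          apply Complex.ext <;> simp [sub_eq_add_neg]
        rw [RingHom.id_apply, h2, h1]
        simp only [map_add, map_smul, hJ', hk.2, hJ] }
  let M := LinearMap.toMatrix' A
  have hM : ∀ x, M *ᵥ x = Φ (k (Φ.symm x)) := fun x => LinearMap.toMatrix'_mulVec A x
  have hform : ∀ x y : ι → ℂ, star (M *ᵥ x) ⬝ᵥ (M *ᵥ y) = star x ⬝ᵥ y := by
    intro x y
    have h1 := hk.1 (Φ.symm x) (Φ.symm y)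
    have h2 := hk.1 (Φ.symm x) (J (Φ.symm y))
    rw [hk.2, hΦ.apply_J, hΦ.apply_J] at h2
    rw [hΦ.form, hΦ.form] at h1
    simp only [← hM, Φ.apply_symm_apply, ← Complex.im_sum, ← Complex.re_sum] at h1 h2
    exact Complex.ext h2 h1
  have hu : Mᴴ * M = 1 := by
    ext i j
    have h := hform (Pi.single i 1) (Pi.single j 1)
    rw [star_mulVec, dotProduct_mulVec, vecMul_vecMul, ← dotProduct_mulVec] at h
    simpa [Matrix.one_apply, Pi.single_apply, eq_comm, Pi.star_single] using h
  refine ⟨⟨M, mem_unitaryGroup_iff'.2 hu⟩, ?_⟩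
  ext v
  apply Φ.injective
  rw [chart_chartRot]
  change M *ᵥ Φ v = _
  rw [hM, Φ.symm_apply_apply]

lemma dSmooth_chartRot : DSmooth (chartRot Φ) := fun n p hp => by
  let L : Matrix ι ι ℂ →ₗ[ℝ] (V →ₗ[ℝ] V) :=
    { toFun := fun M => Φ.symm.toLinearMap ∘ₗ (M.mulVecLin.restrictScalars ℝ) ∘ₗ Φ.toLinearMap
      map_add' := fun M N => by ext v; simp
      map_smul' := fun r M => by
        ext v
        simp }
  exact isPlot_ofVectorSpace_comp (E := Matrix ι ι ℂ) (p := fun t => (p t : Matrix ι ι ℂ)) hp L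

end Chart

end

/-! ### Coordinate subspaces and complexified charts -/

noncomputable section

open Matrix

section CoordSub

variable {𝕜 M N ι : Type*} [Field 𝕜] [AddCommGroup M] [Module 𝕜 M] [AddCommGroup N] [Module 𝕜 N]

/-- The vectors whose `i`-th coordinate lies in `S k`, where `k` is the colour of `i`. -/
def coordSub (L : M ≃ₗ[𝕜] (ι → N)) (c : ι → Fin 3) (S : Fin 3 → Submodule 𝕜 N) :
    Submodule 𝕜 M where
  carrier := {t | ∀ i, L t i ∈ S (c i)}
  zero_mem' i := by simp
  add_mem' hs ht i := by simpa using add_mem (hs i) (ht i)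
  smul_mem' z t ht i := by simpa using (S (c i)).smul_mem z (ht i)

variable (L : M ≃ₗ[𝕜] (ι → N)) (c : ι → Fin 3)

lemma mem_coordSub {S : Fin 3 → Submodule 𝕜 N} {t : M} :
    t ∈ coordSub L c S ↔ ∀ i, L t i ∈ S (c i) :=
  Iff.rfl

lemma coordSub_inf (S S' : Fin 3 → Submodule 𝕜 N) :
    coordSub L c S ⊓ coordSub L c S' = coordSub L c (S ⊓ S') := by
  ext t
  simp [mem_coordSub, forall_and]

lemma coordSub_mono {S S' : Fin 3 → Submodule 𝕜 N} (h : S ≤ S') :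
    coordSub L c S ≤ coordSub L c S' :=
  fun _ ht i => h _ (ht i)

lemma coordSub_sup (S S' : Fin 3 → Submodule 𝕜 N) :
    coordSub L c S ⊔ coordSub L c S' = coordSub L c (S ⊔ S') := by
  refine le_antisymm (sup_le (coordSub_mono L c le_sup_left) (coordSub_mono L c le_sup_right))
    fun t ht => ?_
  have h : ∀ i, ∃ y ∈ S (c i), ∃ z ∈ S' (c i), y + z = L t i := fun i =>
    Submodule.mem_sup.1 (ht i)
  choose y hy z hz hyz using h
  refine Submodule.mem_sup.2 ⟨L.symm y, fun i => ?_, L.symm z, fun i => ?_, ?_⟩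
  · rw [L.apply_symm_apply]; exact hy i
  · rw [L.apply_symm_apply]; exact hz i
  · rw [← map_add, LinearEquiv.symm_apply_eq]
    exact funext hyz

lemma coordSub_eq_bot {S : Fin 3 → Submodule 𝕜 N} (h : S = ⊥) : coordSub L c S = ⊥ := by
  subst h
  refine eq_bot_iff.2 fun t ht => ?_
  exact (Submodule.mem_bot 𝕜).2 (L.map_eq_zero_iff.1 (funext fun i => (Submodule.mem_bot 𝕜).1 (ht i)))

/-- The number of indices of colour `k`. -/
def colorCard [Fintype ι] (c : ι → Fin 3) (k : Fin 3) : ℕ := (Finset.univ.filter (c · = k)).card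

lemma colorCard_sum [Fintype ι] :
    colorCard c 0 + colorCard c 1 + colorCard c 2 = Fintype.card ι := by
  have := Finset.card_eq_sum_card_fiberwise (f := c) (s := Finset.univ) (t := Finset.univ)
    (by simp)
  rw [Fin.sum_univ_three] at this
  exact this.symm

lemma finrank_coordSub [Fintype ι] [FiniteDimensional 𝕜 N] (S : Fin 3 → Submodule 𝕜 N) :
    finrank 𝕜 (coordSub L c S) = colorCard c 0 * finrank 𝕜 (S 0) +
      colorCard c 1 * finrank 𝕜 (S 1) + colorCard c 2 * finrank 𝕜 (S 2) := by
  let e : coordSub L c S ≃ₗ[𝕜] (∀ i, S (c i)) :=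
    { toFun := fun t i => ⟨L t.1 i, t.2 i⟩
      map_add' := fun s t => by ext i; simp
      map_smul' := fun z t => by ext i; simp
      invFun := fun y => ⟨L.symm fun i => (y i).1, fun i => by simp⟩
      left_inv := fun t => by ext; simp
      right_inv := fun y => by ext; simp }
  rw [e.finrank_eq, Module.finrank_pi_fintype,
    ← Finset.sum_fiberwise (s := Finset.univ) (g := c)]
  rw [Fin.sum_univ_three]
  have h : ∀ k, ∑ i with c i = k, finrank 𝕜 (S (c i)) = colorCard c k * finrank 𝕜 (S k) := by
    intro k
    rw [Finset.sum_congr rfl (g := fun _ => finrank 𝕜 (S k)), Finset.sum_const, smul_eq_mul]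
    · rfl
    · intro i hi
      rw [(Finset.mem_filter.1 hi).2]
  rw [h, h, h]

end CoordSub

/-! ### Lines in one coordinate and in its complexification -/

section Lines

def realLine : Submodule ℝ ℂ := LinearMap.ker Complex.imLm

lemma mem_realLine {z : ℂ} : z ∈ realLine ↔ z.im = 0 := Iff.rfl

lemma finrank_realLine : finrank ℝ realLine = 1 := by
  have h := Complex.imLm.finrank_range_add_finrank_ker
  have h1 : LinearMap.range Complex.imLm = ⊤ :=
    LinearMap.range_eq_top.2 fun r => ⟨⟨0, r⟩, rfl⟩
  rw [h1, finrank_top, Complex.finrank_real_complex, finrank_self] at h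
  change 1 + finrank ℝ realLine = 2 at h
  omega

/-- Here `ℂ × ℂ` stands for the complexification of one coordinate `ℂ` through `z ↦ (z, z̄)`. The
diagonal is the complexification of the real line, and the two axes are the `+i` and `-i` eigenlines
of multiplication by `i`. -/
def diagLine : Submodule ℂ (ℂ × ℂ) := Submodule.span ℂ {(1, 1)}
def fstLine : Submodule ℂ (ℂ × ℂ) := Submodule.span ℂ {(1, 0)}
def sndLine : Submodule ℂ (ℂ × ℂ) := Submodule.span ℂ {(0, 1)}

lemma mem_diagLine {z : ℂ × ℂ} : z ∈ diagLine ↔ z.1 = z.2 := by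
  rw [diagLine, Submodule.mem_span_singleton]
  constructor
  · rintro ⟨a, rfl⟩; simp
  · intro h; exact ⟨z.1, Prod.ext (by simp) (by simp [h])⟩

lemma mem_fstLine {z : ℂ × ℂ} : z ∈ fstLine ↔ z.2 = 0 := by
  rw [fstLine, Submodule.mem_span_singleton]
  constructor
  · rintro ⟨a, rfl⟩; simp
  · intro h; exact ⟨z.1, Prod.ext (by simp) (by simp [h])⟩

lemma mem_sndLine {z : ℂ × ℂ} : z ∈ sndLine ↔ z.1 = 0 := by
  rw [sndLine, Submodule.mem_span_singleton]
  constructor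
  · rintro ⟨a, rfl⟩; simp
  · intro h; exact ⟨z.2, Prod.ext (by simp [h]) (by simp)⟩

lemma finrank_diagLine : finrank ℂ diagLine = 1 := finrank_span_singleton (by simp)
lemma finrank_fstLine : finrank ℂ fstLine = 1 := finrank_span_singleton (by simp)
lemma finrank_sndLine : finrank ℂ sndLine = 1 := finrank_span_singleton (by simp)

end Lines

/-! ### Complexification of a chart -/

section ComplexChart

variable {V : Type*} [AddCommGroup V] [Module ℝ V] {ω : LinearMap.BilinForm ℝ V} {J : V →ₗ[ℝ] V}
  {ι : Type*} (Φ : V ≃ₗ[ℝ] (ι → ℂ))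

/-- The complex linear extension of `v ↦ (Φ v, conj (Φ v))`. -/
def complexChartHom : ℂ ⊗[ℝ] V →ₗ[ℂ] (ι → ℂ × ℂ) :=
  LinearMap.liftBaseChange ℂ
    { toFun := fun v i => (Φ v i, (starRingEnd ℂ) (Φ v i))
      map_add' := fun v w => by ext i <;> simp
      map_smul' := fun r v => by ext i <;> simp }

lemma complexChartHom_tmul (z : ℂ) (v : V) (i : ι) :
    complexChartHom Φ (z ⊗ₜ v) i = (z * Φ v i, z * (starRingEnd ℂ) (Φ v i)) := by
  simp [complexChartHom]

variable [Fintype ι]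

lemma complexChartHom_bijective : Function.Bijective (complexChartHom Φ) := by
  have : FiniteDimensional ℝ V := Module.Finite.equiv Φ.symm
  have hs : Function.Surjective (complexChartHom Φ) := fun x => by
    -- Solving `(z, w) = (a + i b, ā + i b̄)` gives `a = (z + w̄) / 2` and `b = -i (z - w̄) / 2`.
    refine ⟨1 ⊗ₜ Φ.symm (fun i => ((x i).1 + (starRingEnd ℂ) (x i).2) / 2) +
      Complex.I ⊗ₜ Φ.symm (fun i => -Complex.I * ((x i).1 - (starRingEnd ℂ) (x i).2) / 2), ?_⟩
    funext i
    rw [map_add, Pi.add_apply, complexChartHom_tmul, complexChartHom_tmul]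
    have hI := Complex.I_mul_I
    refine Prod.ext ?_ ?_
    · simp only [LinearEquiv.apply_symm_apply, Prod.fst_add]
      linear_combination (-((x i).1 - (starRingEnd ℂ) (x i).2) / 2) * hI
    · simp only [LinearEquiv.apply_symm_apply, Prod.snd_add, map_div₀, map_mul, map_add, map_sub,
        map_neg, Complex.conj_I, Complex.conj_conj, map_ofNat]
      linear_combination (((starRingEnd ℂ) (x i).1 - (x i).2) / 2) * hI
  refine ⟨(LinearMap.injective_iff_surjective_of_finrank_eq_finrank ?_).2 hs, hs⟩
  rw [Module.finrank_baseChange, Φ.finrank_eq, Module.finrank_pi_fintype,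
    Module.finrank_pi_fintype]
  simp

/-- The complexification of a chart `Φ`, in the coordinates of the two eigenspaces of `J`. -/
def complexChart : ℂ ⊗[ℝ] V ≃ₗ[ℂ] (ι → ℂ × ℂ) :=
  LinearEquiv.ofBijective (complexChartHom Φ) (complexChartHom_bijective Φ)

lemma complexChart_tmul (z : ℂ) (v : V) (i : ι) :
    complexChart Φ (z ⊗ₜ v) i = (z * Φ v i, z * (starRingEnd ℂ) (Φ v i)) :=
  complexChartHom_tmul Φ z v i

lemma complexChart_conjC (t : ℂ ⊗[ℝ] V) (i : ι) : complexChart Φ (conjC t) i =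
    ((starRingEnd ℂ) (complexChart Φ t i).2, (starRingEnd ℂ) (complexChart Φ t i).1) := by
  induction t with
  | zero => ext <;> simp
  | add s t hs ht => simp only [map_add, Pi.add_apply, hs, ht]; simp
  | tmul z v => simp [conjC, complexChart_tmul]

lemma chart_rePart (t : ℂ ⊗[ℝ] V) (i : ι) : Φ (rePart t) i =
    ((complexChart Φ t i).1 + (starRingEnd ℂ) (complexChart Φ t i).2) / 2 := by
  induction t with
  | zero => simp
  | add s t hs ht => simp only [map_add, Pi.add_apply, hs, ht, Prod.fst_add, Prod.snd_add]; ring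
  | tmul z v =>
    simp only [rePart, LinearMap.comp_apply, LinearMap.rTensor_tmul, LinearEquiv.coe_coe,
      TensorProduct.lid_tmul, complexChart_tmul, map_smul, Pi.smul_apply, Complex.real_smul,
      Complex.reLm_coe, map_mul, Complex.conj_conj, Complex.re_eq_add_conj]
    ring

lemma complexChart_baseChange (k : V ≃ₗ[ℝ] V) (t : ℂ ⊗[ℝ] V) :
    complexChart (k.symm.trans Φ) ((k : V →ₗ[ℝ] V).baseChange ℂ t) = complexChart Φ t := by
  induction t with
  | zero => simp
  | add s t hs ht => simp only [map_add, hs, ht]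
  | tmul z v => ext i <;> simp [complexChart_tmul]

variable {Φ}

namespace IsUnitaryChart

variable (hΦ : IsUnitaryChart ω J Φ)
include hΦ

lemma complexChart_J (t : ℂ ⊗[ℝ] V) (i : ι) : complexChart Φ (J.baseChange ℂ t) i =
    (Complex.I * (complexChart Φ t i).1, -Complex.I * (complexChart Φ t i).2) := by
  induction t with
  | zero => ext <;> simp
  | add s t hs ht => simp only [map_add, Pi.add_apply, hs, ht, Prod.fst_add, Prod.snd_add]; ext <;>
      simp <;> ring
  | tmul z v =>
    rw [LinearMap.baseChange_tmul, complexChart_tmul, complexChart_tmul, hΦ.map_J]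
    ext <;> simp <;> ring

lemma baseChange_form (s t : ℂ ⊗[ℝ] V) : LinearMap.BilinForm.baseChange ℂ ω s t =
    ∑ i, (-Complex.I / 2) * ((complexChart Φ s i).2 * (complexChart Φ t i).1 -
      (complexChart Φ s i).1 * (complexChart Φ t i).2) := by
  induction s with
  | zero => simp
  | add s s' hs hs' =>
    rw [map_add, LinearMap.add_apply, hs, hs', ← Finset.sum_add_distrib]
    refine Finset.sum_congr rfl fun i _ => ?_
    simp only [map_add, Pi.add_apply, Prod.fst_add, Prod.snd_add]
    ring
  | tmul z v =>
    induction t with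
    | zero => simp
    | add s s' hs hs' =>
      rw [map_add, hs, hs', ← Finset.sum_add_distrib]
      refine Finset.sum_congr rfl fun i _ => ?_
      simp only [map_add, Pi.add_apply, Prod.fst_add, Prod.snd_add]
      ring
    | tmul z' v' =>
      rw [LinearMap.BilinForm.baseChange_tmul, hΦ.form, Complex.real_smul, Complex.ofReal_sum,
        Finset.sum_mul]
      refine Finset.sum_congr rfl fun i _ => ?_
      rw [complexChart_tmul, complexChart_tmul, Complex.im_eq_sub_conj]
      simp only [map_mul, Complex.conj_conj]
      field_simp
      ring_nf
      simp only [Complex.I_sq]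
      ring

/-- The hermitian form becomes half the difference of the standard forms on the two factors, so each
eigenspace of `J` is definite and the diagonals are null. -/
lemma kappa_eq (s t : ℂ ⊗[ℝ] V) : kappa ω s t =
    ∑ i, ((complexChart Φ s i).1 * (starRingEnd ℂ) (complexChart Φ t i).1 -
      (complexChart Φ s i).2 * (starRingEnd ℂ) (complexChart Φ t i).2) / 2 := by
  rw [kappa, hΦ.baseChange_form, Finset.mul_sum]
  refine Finset.sum_congr rfl fun i _ => ?_
  rw [complexChart_conjC]
  linear_combination ((complexChart Φ s i).2 * (starRingEnd ℂ) (complexChart Φ t i).2 -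
    (complexChart Φ s i).1 * (starRingEnd ℂ) (complexChart Φ t i).1) / 2 * Complex.I_mul_I

lemma mem_eigenPlus {t : ℂ ⊗[ℝ] V} : t ∈ eigenPlus J ↔ ∀ i, (complexChart Φ t i).2 = 0 := by
  rw [eigenPlus, Module.End.mem_eigenspace_iff, ← (complexChart Φ).injective.eq_iff, funext_iff]
  refine forall_congr' fun i => ?_
  rw [hΦ.complexChart_J, map_smul, Pi.smul_apply, Prod.ext_iff]
  simp only [Prod.smul_fst, Prod.smul_snd, smul_eq_mul, true_and]
  constructor
  · intro h
    have : (2 * Complex.I) * (complexChart Φ t i).2 = 0 := by linear_combination -h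
    simpa using this
  · intro h; simp [h]

lemma mem_eigenMinus {t : ℂ ⊗[ℝ] V} : t ∈ eigenMinus J ↔ ∀ i, (complexChart Φ t i).1 = 0 := by
  rw [eigenMinus, Module.End.mem_eigenspace_iff, ← (complexChart Φ).injective.eq_iff, funext_iff]
  refine forall_congr' fun i => ?_
  rw [hΦ.complexChart_J, map_smul, Pi.smul_apply, Prod.ext_iff]
  simp only [Prod.smul_fst, Prod.smul_snd, smul_eq_mul, and_true]
  constructor
  · intro h
    have : (2 * Complex.I) * (complexChart Φ t i).1 = 0 := by linear_combination h
    simpa using this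
  · intro h; simp [h]

end IsUnitaryChart

omit [Fintype ι] in
-- A translate of a coordinate subspace is the same coordinate subspace read in the moved chart;
-- together with `IsUnitaryChart.symm_trans` this reduces claims about translates to the model.
lemma smul_coordSub (k : V ≃ₗ[ℝ] V) (c : ι → Fin 3) (S : Fin 3 → Submodule ℝ ℂ) :
    k • coordSub Φ c S = coordSub (k.symm.trans Φ) c S := by
  ext v
  rw [Submodule.mem_smul_pointwise_iff_exists]
  constructor
  · rintro ⟨w, hw, rfl⟩ i
    simpa using hw i
  · intro h
    exact ⟨k.symm v, fun i => h i, k.apply_symm_apply v⟩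

lemma smul_complexSubmodule_def (k : V ≃ₗ[ℝ] V) (F : Submodule ℂ (ℂ ⊗[ℝ] V)) :
    k • F = F.map ((k : V →ₗ[ℝ] V).baseChange ℂ) :=
  rfl

lemma smul_coordSub_complexChart (k : V ≃ₗ[ℝ] V) (c : ι → Fin 3)
    (S : Fin 3 → Submodule ℂ (ℂ × ℂ)) :
    k • coordSub (complexChart Φ) c S = coordSub (complexChart (k.symm.trans Φ)) c S := by
  ext t
  rw [smul_complexSubmodule_def, Submodule.mem_map]
  constructor
  · rintro ⟨w, hw, rfl⟩ i
    rw [complexChart_baseChange]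
    exact hw i
  · intro h
    have hk : (k : V →ₗ[ℝ] V).baseChange ℂ ((k.symm : V →ₗ[ℝ] V).baseChange ℂ t) = t := by
      rw [← LinearMap.comp_apply, ← LinearMap.baseChange_comp]
      simp
    refine ⟨(k.symm : V →ₗ[ℝ] V).baseChange ℂ t, fun i => ?_, hk⟩
    rw [← complexChart_baseChange Φ k, hk]
    exact h i

end ComplexChart

end

/-! ### Subspaces of given type in unitary coordinates -/

noncomputable section

open Matrix

lemma Fin.eq_zero_or_one_or_two (k : Fin 3) : k = 0 ∨ k = 1 ∨ k = 2 := by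
  fin_cases k <;> simp

/-! ### Unitary frames adapted to a pair of orthogonal subspaces -/

section Adapted

variable {ι : Type*} [Fintype ι] [DecidableEq ι]

omit [DecidableEq ι] in
lemma EuclideanSpace.re_inner_eq (x y : EuclideanSpace ℂ ι) :
    (inner ℂ x y : ℂ).re = inner ℝ x y := by
  rw [PiLp.inner_apply, PiLp.inner_apply, Complex.re_sum]
  rfl

/-- A totally real isotropic subspace and a complex subspace orthogonal to it contain prescribed
numbers of columns of a suitable unitary matrix. -/
theorem exists_unitary_adapted (c : ι → Fin 3) (R : Submodule ℝ (ι → ℂ)) (C : Submodule ℂ (ι → ℂ))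
    (hR : ∀ x ∈ R, ∀ y ∈ R, (star x ⬝ᵥ y).im = 0) (hRC : ∀ x ∈ R, ∀ y ∈ C, star x ⬝ᵥ y = 0)
    (h0 : colorCard c 0 ≤ finrank ℝ R) (h1 : colorCard c 1 ≤ finrank ℂ C) :
    ∃ u : unitaryGroup ι ℂ, (∀ i, c i = 0 → (fun j => u.1 j i) ∈ R) ∧
      ∀ i, c i = 1 → (fun j => u.1 j i) ∈ C := by
  let E := EuclideanSpace ℂ ι
  let T : E ≃ₗ[ℂ] (ι → ℂ) := WithLp.linearEquiv 2 ℂ (ι → ℂ)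
  have hT : ∀ x y : E, (inner ℂ x y : ℂ) = star (T x) ⬝ᵥ T y := fun x y => by
    rw [EuclideanSpace.inner_eq_star_dotProduct, dotProduct_comm]
    rfl
  let R' : Submodule ℝ E := R.map ((T.restrictScalars ℝ).symm : (ι → ℂ) →ₗ[ℝ] E)
  let C' : Submodule ℂ E := C.map (T.symm : (ι → ℂ) →ₗ[ℂ] E)
  have hR' : finrank ℝ R' = finrank ℝ R := LinearEquiv.finrank_map_eq (T.restrictScalars ℝ).symm R
  have hC' : finrank ℂ C' = finrank ℂ C := LinearEquiv.finrank_map_eq T.symm C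
  have hmR : ∀ x ∈ R', T x ∈ R := by
    rintro _ ⟨y, hy, rfl⟩
    exact hy
  have hmC : ∀ x ∈ C', T x ∈ C := by
    rintro _ ⟨y, hy, rfl⟩
    exact hy
  let a := stdOrthonormalBasis ℝ R'
  let b := stdOrthonormalBasis ℂ C'
  -- A real orthonormal basis is orthonormal for the real part of the hermitian form; isotropy kills
  -- the imaginary part, so it is orthonormal over `ℂ` too.
  have ha : ∀ i j, (inner ℂ (a i : E) (a j : E) : ℂ) = if i = j then 1 else 0 := fun i j => by
    have h := orthonormal_iff_ite.1 a.orthonormal i j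
    apply Complex.ext
    · rw [EuclideanSpace.re_inner_eq, ← Submodule.coe_inner, h]
      split_ifs <;> simp
    · rw [hT, hR _ (hmR _ (a i).2) _ (hmR _ (a j).2)]
      split_ifs <;> simp
  have hb : ∀ i j, (inner ℂ (b i : E) (b j : E) : ℂ) = if i = j then 1 else 0 := fun i j =>
    orthonormal_iff_ite.1 b.orthonormal i j
  have hab : ∀ i j, (inner ℂ (a i : E) (b j : E) : ℂ) = 0 := fun i j => by
    rw [hT, hRC _ (hmR _ (a i).2) _ (hmC _ (b j).2)]
  have hc : ∀ k, Fintype.card {i // c i = k} = colorCard c k := fun k =>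
    Fintype.card_subtype _
  obtain ⟨f0⟩ : Nonempty ({i // c i = 0} ↪ Fin (finrank ℝ R')) :=
    Function.Embedding.nonempty_of_card_le (by rw [Fintype.card_fin, hc, hR']; exact h0)
  obtain ⟨f1⟩ : Nonempty ({i // c i = 1} ↪ Fin (finrank ℂ C')) :=
    Function.Embedding.nonempty_of_card_le (by rw [Fintype.card_fin, hc, hC']; exact h1)
  let v : ι → E := fun i => if h : c i = 0 then a (f0 ⟨i, h⟩) else
    if h : c i = 1 then b (f1 ⟨i, h⟩) else 0
  have v0 : ∀ i (h : c i = 0), v i = a (f0 ⟨i, h⟩) := fun i h => dif_pos h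
  have v1 : ∀ i (h : c i = 1), v i = b (f1 ⟨i, h⟩) := fun i h => by
    have h' : c i ≠ 0 := by rw [h]; decide
    simp only [v, dif_neg h', dif_pos h]
  have hv : Orthonormal ℂ (Set.domRestrict {i | c i ≠ 2} v) := by
    rw [orthonormal_iff_ite]
    rintro ⟨i, hi⟩ ⟨j, hj⟩
    change (inner ℂ (v i) (v j) : ℂ) = _
    rcases Fin.eq_zero_or_one_or_two (c i) with h | h | h
    · rcases Fin.eq_zero_or_one_or_two (c j) with h' | h' | h'
      · rw [v0 i h, v0 j h', ha]
        simp
      · have : i ≠ j := fun e => by rw [e, h'] at h; exact absurd h (by decide)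
        rw [v0 i h, v1 j h', hab]
        simp [this]
      · exact absurd h' hj
    · rcases Fin.eq_zero_or_one_or_two (c j) with h' | h' | h'
      · have : i ≠ j := fun e => by rw [e, h'] at h; exact absurd h (by decide)
        rw [v1 i h, v0 j h', ← inner_conj_symm, hab]
        simp [this]
      · rw [v1 i h, v1 j h', hb]
        simp
      · exact absurd h' hj
    · exact absurd h hi
  obtain ⟨e, he⟩ := hv.exists_orthonormalBasis_extension_of_card_eq (by simp [E])
  refine ⟨⟨fun j i => T (e i) j, mem_unitaryGroup_iff'.2 ?_⟩, fun i hi => ?_, fun i hi => ?_⟩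
  · ext i j
    have h := orthonormal_iff_ite.1 e.orthonormal i j
    rw [hT] at h
    rw [Matrix.one_apply, ← h]
    rfl
  · have h2 : c i ≠ 2 := by rw [hi]; decide
    change T (e i) ∈ R
    rw [he i h2, v0 i hi]
    exact hmR _ (a (f0 ⟨i, hi⟩)).2
  · have h2 : c i ≠ 2 := by rw [hi]; decide
    change T (e i) ∈ C
    rw [he i h2, v1 i hi]
    exact hmC _ (b (f1 ⟨i, hi⟩)).2

end Adapted

/-! ### Real subspaces -/

section RealSubspaces

variable {V : Type*} [AddCommGroup V] [Module ℝ V] {ω : LinearMap.BilinForm ℝ V} {J : V →ₗ[ℝ] V}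
  {ι : Type*} [Fintype ι] [DecidableEq ι] {Φ : V ≃ₗ[ℝ] (ι → ℂ)} (c : ι → Fin 3)

/-- The model subspace `ℝ^{n₀} ⊕ ℂ^p ⊕ 0`; the next family describes its radical. -/
def typeLines : Fin 3 → Submodule ℝ ℂ := ![realLine, ⊤, ⊥]

def radicalLines : Fin 3 → Submodule ℝ ℂ := ![realLine, ⊥, ⊥]

omit [DecidableEq ι] in
lemma IsUnitaryChart.finrank_eq (Φ : V ≃ₗ[ℝ] (ι → ℂ)) : finrank ℝ V = 2 * Fintype.card ι := by
  rw [Φ.finrank_eq, Module.finrank_pi_fintype]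
  simp [mul_comm]

omit [DecidableEq ι] in
lemma finrank_coordSub_typeLines (Φ : V ≃ₗ[ℝ] (ι → ℂ)) :
    finrank ℝ (coordSub Φ c typeLines) = colorCard c 0 + 2 * colorCard c 1 := by
  rw [finrank_coordSub]
  change colorCard c 0 * finrank ℝ realLine + colorCard c 1 * finrank ℝ (⊤ : Submodule ℝ ℂ) +
    colorCard c 2 * finrank ℝ (⊥ : Submodule ℝ ℂ) = _
  rw [finrank_realLine, finrank_top, finrank_bot, Complex.finrank_real_complex]
  ring

omit [DecidableEq ι] in
lemma finrank_coordSub_radicalLines (Φ : V ≃ₗ[ℝ] (ι → ℂ)) :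
    finrank ℝ (coordSub Φ c radicalLines) = colorCard c 0 := by
  rw [finrank_coordSub]
  change colorCard c 0 * finrank ℝ realLine + colorCard c 1 * finrank ℝ (⊥ : Submodule ℝ ℂ) +
    colorCard c 2 * finrank ℝ (⊥ : Submodule ℝ ℂ) = _
  rw [finrank_realLine, finrank_bot]
  ring

namespace IsUnitaryChart

variable (hΦ : IsUnitaryChart ω J Φ)
include hΦ

lemma mem_orthogonal_coordSub (S : Fin 3 → Submodule ℝ ℂ) {v : V} :
    v ∈ ω.orthogonal (coordSub Φ c S) ↔
      ∀ i, ∀ z ∈ S (c i), ((starRingEnd ℂ) z * Φ v i).im = 0 := by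
  rw [LinearMap.BilinForm.mem_orthogonal_iff]
  constructor
  · intro h i z hz
    have := h (Φ.symm (Pi.single i z)) (fun j => by
      rw [Φ.apply_symm_apply]
      by_cases hij : j = i
      · subst hij; simpa using hz
      · simp [hij])
    rw [hΦ.form, Finset.sum_eq_single i] at this
    · simpa using this
    · intro j _ hj
      simp [hj]
    · simp
  · intro h w hw
    rw [hΦ.form]
    exact Finset.sum_eq_zero fun i _ => h i _ (hw i)

/-- The form splits over coordinates, so the radical is computed colour by colour: the real line of
`ℂ` is Lagrangian, and `ℂ` itself is symplectic. -/
lemma symplecticRadical_coordSub :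
    symplecticRadical ω (coordSub Φ c typeLines) = coordSub Φ c radicalLines := by
  ext v
  rw [symplecticRadical, Submodule.mem_inf, hΦ.mem_orthogonal_coordSub, mem_coordSub,
    mem_coordSub, ← forall_and]
  refine forall_congr' fun i => ?_
  rcases Fin.eq_zero_or_one_or_two (c i) with h | h | h <;> rw [h]
  · change _ ∈ realLine ∧ (∀ z ∈ realLine, _) ↔ _ ∈ realLine
    refine and_iff_left_of_imp fun hv z hz => ?_
    rw [mem_realLine] at hv hz
    simp [hv, hz]
  · change _ ∈ (⊤ : Submodule ℝ ℂ) ∧ (∀ z ∈ (⊤ : Submodule ℝ ℂ), _) ↔ _ ∈ (⊥ : Submodule ℝ ℂ)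
    rw [Submodule.mem_bot]
    constructor
    · rintro ⟨-, h⟩
      have h1 := h 1 trivial
      have h2 := h Complex.I trivial
      exact Complex.ext (by simpa using h2) (by simpa using h1)
    · intro h
      simp [h]
  · change _ ∈ (⊥ : Submodule ℝ ℂ) ∧ (∀ z ∈ (⊥ : Submodule ℝ ℂ), _) ↔ _ ∈ (⊥ : Submodule ℝ ℂ)
    simp

omit [DecidableEq ι] in
lemma J_mem_coordSub {S S' : Fin 3 → Submodule ℝ ℂ} (hS : ∀ k, ∀ z ∈ S k, Complex.I * z ∈ S' k)
    {v : V} (hv : v ∈ coordSub Φ c S) : J v ∈ coordSub Φ c S' := fun i => by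
  rw [hΦ.map_J]
  exact hS _ _ (hv i)

lemma coordSub_mem_grassmannianJ : coordSub Φ c typeLines ∈
    grassmannianJ ω J (colorCard c 0) (colorCard c 1) (colorCard c 2) := by
  have hrad := hΦ.symplecticRadical_coordSub c
  refine ⟨⟨?_, ?_, finrank_coordSub_typeLines c Φ⟩, ?_⟩
  · rw [colorCard_sum]
    exact IsUnitaryChart.finrank_eq Φ
  · rw [hrad, finrank_coordSub_radicalLines]
  · rw [hrad]
    -- Adding `J W₀` fills each real line up to `ℂ`, so the sum is the complex coordinate subspace
    -- of colours `0` and `1`.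
    have hle : coordSub Φ c typeLines ⊔ (coordSub Φ c radicalLines).map J ≤
        coordSub Φ c ![⊤, ⊤, ⊥] := by
      refine sup_le (coordSub_mono Φ c fun k => ?_) ?_
      · fin_cases k <;> simp [typeLines]
      · rintro _ ⟨v, hv, rfl⟩
        refine hΦ.J_mem_coordSub c (fun k z hz => ?_) hv
        fin_cases k
        · trivial
        · trivial
        · have : z = 0 := (Submodule.mem_bot ℝ).1 hz
          simp [this]
    have hge : coordSub Φ c ![⊤, ⊤, ⊥] ≤
        coordSub Φ c typeLines ⊔ (coordSub Φ c radicalLines).map J := by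
      intro v hv
      have hcomp : ∀ i, ∃ r ∈ radicalLines (c i), ∃ w ∈ typeLines (c i),
          w + Complex.I * r = Φ v i := fun i => by
        have hvi := hv i
        rcases Fin.eq_zero_or_one_or_two (c i) with h | h | h <;> rw [h] at hvi ⊢
        · refine ⟨((Φ v i).im : ℂ), Complex.ofReal_im (Φ v i).im, ((Φ v i).re : ℂ),
            Complex.ofReal_im (Φ v i).re, ?_⟩
          rw [mul_comm]
          exact Complex.re_add_im _
        · exact ⟨0, zero_mem _, Φ v i, trivial, by simp⟩
        · exact ⟨0, zero_mem _, 0, zero_mem _, by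
            have : Φ v i = 0 := (Submodule.mem_bot ℝ).1 hvi
            simp [this]⟩
      choose r hr w hw hrw using hcomp
      refine Submodule.mem_sup.2 ⟨Φ.symm w, fun i => ?_, J (Φ.symm r), ⟨Φ.symm r, fun i => ?_, rfl⟩,
        Φ.injective (funext fun i => ?_)⟩
      · rw [Φ.apply_symm_apply]; exact hw i
      · rw [Φ.apply_symm_apply]; exact hr i
      · rw [map_add, Pi.add_apply, hΦ.map_J, Φ.apply_symm_apply, Φ.apply_symm_apply]
        exact hrw i
    intro v hv
    refine hge (hΦ.J_mem_coordSub c (fun k z hz => ?_) (hle hv))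
    fin_cases k
    · trivial
    · trivial
    · have : z = 0 := (Submodule.mem_bot ℝ).1 hz
      simp [this]

end IsUnitaryChart

/-- For `p = 0` the subspace equals its radical, and `W + J W` is `J`-stable. The base of the
bundles is thereby itself covered by the description of `Gr_J`. -/
lemma grassmannianOfType_subset_grassmannianJ [FiniteDimensional ℝ V]
    (hJ : ∀ v, J (J v) = -v) (n₀ m : ℕ) :
    grassmannianOfType ω n₀ 0 m ⊆ grassmannianJ ω J n₀ 0 m := by
  intro W hW
  refine ⟨hW, ?_⟩
  have h : symplecticRadical ω W = W :=
    Submodule.eq_of_le_of_finrank_eq inf_le_left (by rw [hW.2.1, hW.2.2]; ring)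
  rw [h]
  intro v hv
  obtain ⟨w, hw, _, ⟨r, hr, rfl⟩, rfl⟩ := Submodule.mem_sup.1 hv
  rw [map_add, hJ, add_comm]
  exact add_mem (Submodule.mem_sup_left (neg_mem hr))
    (Submodule.mem_sup_right ⟨w, hw, rfl⟩)

lemma grassmannianJ_zero_eq [FiniteDimensional ℝ V] (hJ : ∀ v, J (J v) = -v) (n₀ m : ℕ) :
    grassmannianJ ω J n₀ 0 m = grassmannianOfType ω n₀ 0 m :=
  Set.Subset.antisymm (fun _ h => h.1) (grassmannianOfType_subset_grassmannianJ hJ n₀ m)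

/-- A rotated coordinate vector is a combination of the columns of `u`, so the inclusion can be
checked on multiples of single columns. -/
lemma chartRot_smul_coordSub_le {u : unitaryGroup ι ℂ} {S : Fin 3 → Submodule ℝ ℂ}
    {W : Submodule ℝ V}
    (h : ∀ i, ∀ z ∈ S (c i), Φ.symm (z • fun j => u.1 j i) ∈ W) :
    chartRot Φ u • coordSub Φ c S ≤ W := by
  intro v hv
  obtain ⟨w, hw, rfl⟩ := (Submodule.mem_smul_pointwise_iff_exists _ _ _).1 hv
  have : chartRot Φ u • w = ∑ i, Φ.symm (Φ w i • fun j => u.1 j i) := by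
    apply Φ.injective
    change Φ (chartRot Φ u w) = _
    rw [chart_chartRot, map_sum]
    funext j
    simp [Matrix.mulVec, dotProduct, mul_comm]
  rw [this]
  exact sum_mem fun i _ => h i _ (hw i)

namespace IsUnitaryChart

variable (hΦ : IsUnitaryChart ω J Φ)
include hΦ

omit [DecidableEq ι] in
lemma symm_smul (z : ℂ) (x : ι → ℂ) :
    Φ.symm (z • x) = z.re • Φ.symm x + z.im • J (Φ.symm x) := by
  apply Φ.injective
  funext i
  simp only [map_add, map_smul, LinearEquiv.apply_symm_apply, Pi.add_apply, Pi.smul_apply, hΦ.map_J,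
    Complex.real_smul, smul_eq_mul]
  conv_lhs => rw [← Complex.re_add_im z]
  ring

omit [DecidableEq ι] in
/-- A `J`-stable real subspace, as a complex subspace in coordinates. -/
lemma exists_complexSubmodule (C : Submodule ℝ V) (hC : ∀ v ∈ C, J v ∈ C) :
    ∃ C' : Submodule ℂ (ι → ℂ), (∀ x, x ∈ C' ↔ Φ.symm x ∈ C) ∧ 2 * finrank ℂ C' = finrank ℝ C := by
  let C' : Submodule ℂ (ι → ℂ) :=
    { carrier := {x | Φ.symm x ∈ C}
      zero_mem' := by simp
      add_mem' := fun {x y} hx hy => by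
        change Φ.symm (x + y) ∈ C
        rw [map_add]
        exact add_mem hx hy
      smul_mem' := fun z x hx => by
        change Φ.symm (z • x) ∈ C
        rw [hΦ.symm_smul]
        exact add_mem (C.smul_mem _ hx) (C.smul_mem _ (hC _ hx)) }
  refine ⟨C', fun x => Iff.rfl, ?_⟩
  have h := Module.finrank_mul_finrank ℝ ℂ C'
  rw [Complex.finrank_real_complex] at h
  rw [h]
  let e : C' ≃ₗ[ℝ] C :=
    { toFun := fun x => ⟨Φ.symm x.1, x.2⟩
      map_add' := fun x y => by ext; simp
      map_smul' := fun r x => by ext; simp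
      invFun := fun v => ⟨Φ v.1, by
        change Φ.symm (Φ v.1) ∈ C
        simp⟩
      left_inv := fun x => by ext; simp
      right_inv := fun v => by ext; simp }
  exact e.finrank_eq

omit [DecidableEq ι] in
lemma dotProduct_eq (v w : V) : star (Φ v) ⬝ᵥ Φ w = ω v (J w) + ω v w * Complex.I := by
  rw [hΦ.apply_J, hΦ.form, ← Complex.re_sum, ← Complex.im_sum, Complex.re_add_im]
  rfl

/-- Every element of `Gr_J` is a unitary rotation of the model subspace. -/
theorem exists_eq_chartRot_smul [FiniteDimensional ℝ V] (hω : ω.IsAlt) (hn : ω.Nondegenerate)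
    (hJ : IsCompatibleComplexStructure ω J) {W : Submodule ℝ V}
    (hW : W ∈ grassmannianJ ω J (colorCard c 0) (colorCard c 1) (colorCard c 2)) :
    ∃ u : unitaryGroup ι ℂ, W = chartRot Φ u • coordSub Φ c typeLines := by
  obtain ⟨⟨hdim, h0, h1⟩, hinv⟩ := hW
  set R := symplecticRadical ω W with hR
  have hRW : ∀ y ∈ R, y ∈ W := fun y hy => hy.1
  have hRω : ∀ y ∈ R, ∀ w ∈ W, ω y w = 0 := fun y hy w hw => by
    have := LinearMap.BilinForm.mem_orthogonal_iff.1 hy.2 w hw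
    exact hω.isRefl _ _ this
  have hanti : ∀ x y, ω (J x) y = -ω x (J y) := fun x y => by
    have := hJ.symplectic (J x) y
    rw [hJ.sq, map_neg, LinearMap.neg_apply] at this
    exact this.symm
  -- This is the complement of the radical `R` in `W` that is orthogonal for the metric `ω · (J ·)`.
  let C : Submodule ℝ V := W ⊓ ω.orthogonal (R.map J)
  have hC : ∀ w ∈ C, ∀ y ∈ R, ω y (J w) = 0 := fun w hw y hy => by
    have := LinearMap.BilinForm.mem_orthogonal_iff.1 hw.2 (J y) ⟨y, hy, rfl⟩
    rw [hanti] at this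
    linarith
  have hCJ : ∀ w ∈ C, J w ∈ C := fun w hw => by
    have h := hinv w (Submodule.mem_sup_left hw.1)
    obtain ⟨w', hw', _, ⟨r, hr, rfl⟩, hsum⟩ := Submodule.mem_sup.1 h
    -- With `J w = w' + J r`, pairing with `r` kills `J w` (as `w` is in `C`) and `w'` (as `r` is in
    -- the radical), leaving `ω r (J r) = 0`.
    have hr0 : r = 0 := by
      by_contra hne
      have h1 := hC w hw r hr
      rw [← hsum, map_add, hRω r hr w' hw', zero_add] at h1
      exact (hJ.pos r hne).ne' h1
    refine ⟨?_, ?_⟩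
    · rw [← hsum, hr0, map_zero, add_zero]
      exact hw'
    · refine LinearMap.BilinForm.mem_orthogonal_iff.2 ?_
      rintro _ ⟨y, hy, rfl⟩
      rw [hJ.symplectic]
      exact hRω y hy w hw.1
  -- Passing to the orthogonal of `J R` costs at most `dim R = n₀` dimensions out of `n₀ + 2 p`.
  have hCdim : 2 * colorCard c 1 ≤ finrank ℝ C := by
    have e1 := Submodule.finrank_sup_add_finrank_inf_eq W (ω.orthogonal (R.map J))
    have e2 : finrank ℝ (ω.orthogonal (R.map J)) = finrank ℝ V - finrank ℝ (R.map J) :=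
      LinearMap.BilinForm.finrank_orthogonal hn _
    have e3 : finrank ℝ (R.map J) ≤ finrank ℝ R := Submodule.finrank_map_le J R
    have e4 := Submodule.finrank_le (W ⊔ ω.orthogonal (R.map J))
    change _ + finrank ℝ C = _ at e1
    omega
  obtain ⟨C', hC', hCrank⟩ := hΦ.exists_complexSubmodule C hCJ
  let R' : Submodule ℝ (ι → ℂ) := R.map (Φ : V →ₗ[ℝ] (ι → ℂ))
  have hR'dim : finrank ℝ R' = finrank ℝ R := LinearEquiv.finrank_map_eq Φ R
  obtain ⟨u, hu0, hu1⟩ := exists_unitary_adapted c R' C'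
    (by
      rintro _ ⟨x, hx, rfl⟩ _ ⟨y, hy, rfl⟩
      have := hΦ.dotProduct_eq x y
      rw [hRω x hx y (hRW y hy)] at this
      change (star (Φ x) ⬝ᵥ Φ y).im = 0
      simp [this])
    (by
      rintro _ ⟨x, hx, rfl⟩ y hy
      have hy' := (hC' y).1 hy
      have := hΦ.dotProduct_eq x (Φ.symm y)
      rw [hRω x hx _ hy'.1, hC _ hy' x hx, Φ.apply_symm_apply] at this
      change star (Φ x) ⬝ᵥ y = 0
      simp [this])
    (by rw [hR'dim, h0]) (by omega)
  refine ⟨u, (Submodule.eq_of_le_of_finrank_eq (chartRot_smul_coordSub_le c fun i z hz => ?_)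
    ?_).symm⟩
  · rcases Fin.eq_zero_or_one_or_two (c i) with h | h | h <;> rw [h] at hz
    · have hz' : z.im = 0 := hz
      obtain ⟨x, hx, hxe⟩ := hu0 i h
      rw [hΦ.symm_smul, hz', zero_smul, add_zero, ← hxe]
      change z.re • Φ.symm (Φ x) ∈ W
      rw [Φ.symm_apply_apply]
      exact W.smul_mem _ (hRW x hx)
    · exact ((hC' _).1 (C'.smul_mem z (hu1 i h))).1
    · have : z = 0 := (Submodule.mem_bot ℝ).1 hz
      simp [this]
  · rw [smul_coordSub, finrank_coordSub_typeLines, h1]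

end IsUnitaryChart

end RealSubspaces

end

/-! ### Complex Lagrangian subspaces in unitary coordinates -/

noncomputable section

open Matrix

section Lagrangian

variable {V : Type*} [AddCommGroup V] [Module ℝ V] {ω : LinearMap.BilinForm ℝ V} {J : V →ₗ[ℝ] V}
  {ι : Type*} [Fintype ι] {Φ : V ≃ₗ[ℝ] (ι → ℂ)} (c : ι → Fin 3)

/-- The six families describe, in order, the model of `F`, of `F₀`, of its intersections with the
`+i` and `-i` eigenspaces, and of the two members of its splitting class. -/
def lagLines : Fin 3 → Submodule ℂ (ℂ × ℂ) := ![diagLine, fstLine, sndLine]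
def kernelLines : Fin 3 → Submodule ℂ (ℂ × ℂ) := ![diagLine, ⊥, ⊥]
def plusLines : Fin 3 → Submodule ℂ (ℂ × ℂ) := ![⊥, fstLine, ⊥]
def minusLines : Fin 3 → Submodule ℂ (ℂ × ℂ) := ![⊥, ⊥, sndLine]
def nonnegLines : Fin 3 → Submodule ℂ (ℂ × ℂ) := ![diagLine, fstLine, ⊥]
def nonposLines : Fin 3 → Submodule ℂ (ℂ × ℂ) := ![diagLine, ⊥, sndLine]

lemma diagLine_inf_fstLine : diagLine ⊓ fstLine = ⊥ := by
  refine eq_bot_iff.2 fun z hz => ?_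
  have h1 := mem_diagLine.1 hz.1
  have h2 := mem_fstLine.1 hz.2
  exact Prod.ext (h1.trans h2) h2

lemma diagLine_inf_sndLine : diagLine ⊓ sndLine = ⊥ := by
  refine eq_bot_iff.2 fun z hz => ?_
  have h1 := mem_diagLine.1 hz.1
  have h2 := mem_sndLine.1 hz.2
  exact Prod.ext h2 (h1.symm.trans h2)

lemma fstLine_inf_sndLine : fstLine ⊓ sndLine = ⊥ := by
  refine eq_bot_iff.2 fun z hz => ?_
  have h1 := mem_fstLine.1 hz.1
  have h2 := mem_sndLine.1 hz.2
  exact Prod.ext h2 h1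

lemma lagLines_inf_fstLine : (lagLines ⊓ fun _ => fstLine) = plusLines := by
  funext k
  fin_cases k
  · exact diagLine_inf_fstLine
  · exact inf_idem fstLine
  · exact (inf_comm _ _).trans fstLine_inf_sndLine

lemma lagLines_inf_sndLine : (lagLines ⊓ fun _ => sndLine) = minusLines := by
  funext k
  fin_cases k
  · exact diagLine_inf_sndLine
  · exact fstLine_inf_sndLine
  · exact inf_idem sndLine

lemma kernelLines_sup_plusLines : kernelLines ⊔ plusLines = nonnegLines := by
  funext k
  fin_cases k
  · exact sup_bot_eq diagLine
  · exact bot_sup_eq fstLine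
  · exact sup_bot_eq _

lemma kernelLines_sup_minusLines : kernelLines ⊔ minusLines = nonposLines := by
  funext k
  fin_cases k
  · exact sup_bot_eq diagLine
  · exact sup_bot_eq _
  · exact bot_sup_eq sndLine

lemma nonnegLines_sup_minusLines : nonnegLines ⊔ minusLines = lagLines := by
  funext k
  fin_cases k
  · exact sup_bot_eq diagLine
  · exact sup_bot_eq fstLine
  · exact bot_sup_eq sndLine

lemma nonnegLines_sup_nonposLines : nonnegLines ⊔ nonposLines = lagLines := by
  funext k
  fin_cases k
  · exact sup_idem diagLine
  · exact sup_bot_eq fstLine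
  · exact bot_sup_eq sndLine

lemma finrank_coordSub_vec {L : ℂ ⊗[ℝ] V ≃ₗ[ℂ] (ι → ℂ × ℂ)} (A B C : Submodule ℂ (ℂ × ℂ)) :
    finrank ℂ (coordSub L c ![A, B, C]) = colorCard c 0 * finrank ℂ A +
      colorCard c 1 * finrank ℂ B + colorCard c 2 * finrank ℂ C :=
  finrank_coordSub L c _

lemma finrank_coordSub_lagLines {L : ℂ ⊗[ℝ] V ≃ₗ[ℂ] (ι → ℂ × ℂ)} :
    finrank ℂ (coordSub L c lagLines) = Fintype.card ι := by
  rw [lagLines, finrank_coordSub_vec, finrank_diagLine, finrank_fstLine, finrank_sndLine,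
    mul_one, mul_one, mul_one, colorCard_sum]

namespace IsUnitaryChart

variable (hΦ : IsUnitaryChart ω J Φ)
include hΦ

lemma eigenPlus_eq : eigenPlus J = coordSub (complexChart Φ) c fun _ => fstLine := by
  ext t
  rw [hΦ.mem_eigenPlus]
  exact forall_congr' fun i => mem_fstLine.symm

lemma eigenMinus_eq : eigenMinus J = coordSub (complexChart Φ) c fun _ => sndLine := by
  ext t
  rw [hΦ.mem_eigenMinus]
  exact forall_congr' fun i => mem_sndLine.symm

lemma baseChange_form_swap (s t : ℂ ⊗[ℝ] V) : LinearMap.BilinForm.baseChange ℂ ω s t =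
    -LinearMap.BilinForm.baseChange ℂ ω t s := by
  rw [hΦ.baseChange_form, hΦ.baseChange_form, ← Finset.sum_neg_distrib]
  exact Finset.sum_congr rfl fun i _ => by ring

lemma baseChange_form_conjC (s t : ℂ ⊗[ℝ] V) :
    LinearMap.BilinForm.baseChange ℂ ω (conjC s) (conjC t) =
      (starRingEnd ℂ) (LinearMap.BilinForm.baseChange ℂ ω s t) := by
  rw [hΦ.baseChange_form, hΦ.baseChange_form, map_sum]
  refine Finset.sum_congr rfl fun i _ => ?_
  rw [complexChart_conjC, complexChart_conjC]
  simp only [map_mul, map_sub, map_neg, map_div₀, Complex.conj_I, map_ofNat]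
  ring

lemma baseChange_form_nondegenerate : (LinearMap.BilinForm.baseChange ℂ ω).Nondegenerate := by
  classical
  have hl : (LinearMap.BilinForm.baseChange ℂ ω).SeparatingLeft := fun s hs => by
    refine (complexChart Φ).map_eq_zero_iff.1 (funext fun i => ?_)
    have h : ∀ z : ℂ × ℂ, (-Complex.I / 2) * ((complexChart Φ s i).2 * z.1 -
        (complexChart Φ s i).1 * z.2) = 0 := fun z => by
      have := hs ((complexChart Φ).symm (Pi.single i z))
      rw [hΦ.baseChange_form, Finset.sum_eq_single i] at this
      · simpa using this
      · intro j _ hj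
        simp [hj]
      · simp
    have h1 := h (1, 0)
    have h2 := h (0, 1)
    exact Prod.ext (by simpa using h2) (by simpa using h1)
  refine ⟨hl, fun t ht => hl t fun s => ?_⟩
  rw [hΦ.baseChange_form_swap, ht, neg_zero]

lemma kappa_self_re (t : ℂ ⊗[ℝ] V) : (kappa ω t t).re =
    ∑ i, (Complex.normSq (complexChart Φ t i).1 - Complex.normSq (complexChart Φ t i).2) / 2 := by
  rw [hΦ.kappa_eq, Complex.re_sum]
  refine Finset.sum_congr rfl fun i _ => ?_
  rw [Complex.mul_conj, Complex.mul_conj, ← Complex.ofReal_sub, ← Complex.ofReal_ofNat,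
    ← Complex.ofReal_div, Complex.ofReal_re]

lemma kappaPos_of_le_eigenPlus {P : Submodule ℂ (ℂ ⊗[ℝ] V)} (hP : P ≤ eigenPlus J) :
    KappaPos ω P := fun t ht ht0 => by
  have h2 := hΦ.mem_eigenPlus.1 (hP ht)
  rw [hΦ.kappa_self_re]
  simp only [h2, map_zero, sub_zero]
  obtain ⟨i, hi⟩ : ∃ i, (complexChart Φ t i).1 ≠ 0 := by
    by_contra! h
    exact ht0 ((complexChart Φ).map_eq_zero_iff.1 (funext fun i => Prod.ext (h i) (h2 i)))
  exact Finset.sum_pos' (fun j _ => div_nonneg (Complex.normSq_nonneg _) zero_le_two)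
    ⟨i, Finset.mem_univ i, div_pos (Complex.normSq_pos.2 hi) zero_lt_two⟩

lemma kappaNeg_of_le_eigenMinus {P : Submodule ℂ (ℂ ⊗[ℝ] V)} (hP : P ≤ eigenMinus J) :
    KappaNeg ω P := fun t ht ht0 => by
  have h2 := hΦ.mem_eigenMinus.1 (hP ht)
  rw [hΦ.kappa_self_re, ← neg_pos, ← Finset.sum_neg_distrib]
  simp only [h2, map_zero, zero_sub, neg_div, neg_neg]
  obtain ⟨i, hi⟩ : ∃ i, (complexChart Φ t i).2 ≠ 0 := by
    by_contra! h
    exact ht0 ((complexChart Φ).map_eq_zero_iff.1 (funext fun i => Prod.ext (h2 i) (h i)))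
  exact Finset.sum_pos' (fun j _ => div_nonneg (Complex.normSq_nonneg _) zero_le_two)
    ⟨i, Finset.mem_univ i, div_pos (Complex.normSq_pos.2 hi) zero_lt_two⟩

lemma baseChange_form_eq_zero_of_mem_lagLines {s t : ℂ ⊗[ℝ] V}
    (hs : s ∈ coordSub (complexChart Φ) c lagLines)
    (ht : t ∈ coordSub (complexChart Φ) c lagLines) :
    LinearMap.BilinForm.baseChange ℂ ω s t = 0 := by
  rw [hΦ.baseChange_form]
  refine Finset.sum_eq_zero fun i _ => ?_
  have h1 := hs i
  have h2 := ht i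
  rcases Fin.eq_zero_or_one_or_two (c i) with h | h | h <;> rw [h] at h1 h2
  · rw [mem_diagLine.1 h1, mem_diagLine.1 h2, sub_self, mul_zero]
  · rw [mem_fstLine.1 h1, mem_fstLine.1 h2]; simp
  · rw [mem_sndLine.1 h1, mem_sndLine.1 h2]; simp

/-- Testing against vectors supported in one coordinate reduces the kernel to one colour at a time:
the form vanishes on the diagonal and is definite on each axis. -/
lemma kappaKernel_coordSub :
    kappaKernel ω (coordSub (complexChart Φ) c lagLines) =
      coordSub (complexChart Φ) c kernelLines := by
  classical
  ext t
  constructor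
  · rintro ⟨ht, hk⟩ i
    have h1 := ht i
    have hz : ∀ z ∈ lagLines (c i), ((complexChart Φ t i).1 * (starRingEnd ℂ) z.1 -
        (complexChart Φ t i).2 * (starRingEnd ℂ) z.2) / 2 = 0 := fun z hz => by
      have := hk ((complexChart Φ).symm (Pi.single i z)) (fun j => by
        rw [LinearEquiv.apply_symm_apply]
        by_cases hij : j = i
        · subst hij; simpa using hz
        · simp [hij])
      rw [hΦ.kappa_eq, Finset.sum_eq_single i] at this
      · simpa using this
      · intro j _ hj
        simp [hj]
      · simp
    rcases Fin.eq_zero_or_one_or_two (c i) with h | h | h <;> rw [h] at h1 hz ⊢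
    · exact h1
    · have h2 := mem_fstLine.1 h1
      have h3 := hz (1, 0) (mem_fstLine.2 rfl)
      exact (Submodule.mem_bot ℂ).2 (Prod.ext (by simpa using h3) h2)
    · have h2 := mem_sndLine.1 h1
      have h3 := hz (0, 1) (mem_sndLine.2 rfl)
      exact (Submodule.mem_bot ℂ).2 (Prod.ext h2 (by simpa using h3))
  · intro ht
    have hle : kernelLines ≤ lagLines := by
      rw [← nonnegLines_sup_minusLines, ← kernelLines_sup_plusLines]
      exact le_sup_left.trans le_sup_left
    refine ⟨coordSub_mono _ c hle ht, fun w hw => ?_⟩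
    rw [hΦ.kappa_eq]
    refine Finset.sum_eq_zero fun i _ => ?_
    have h1 := ht i
    have h2 := hw i
    rcases Fin.eq_zero_or_one_or_two (c i) with h | h | h <;> rw [h] at h1 h2
    · rw [mem_diagLine.1 h1, mem_diagLine.1 h2, sub_self, zero_div]
    · have : complexChart Φ t i = 0 := (Submodule.mem_bot ℂ).1 h1
      simp [this]
    · have : complexChart Φ t i = 0 := (Submodule.mem_bot ℂ).1 h1
      simp [this]

lemma coordSub_inf_eigenPlus : coordSub (complexChart Φ) c lagLines ⊓ eigenPlus J =
    coordSub (complexChart Φ) c plusLines := by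
  rw [hΦ.eigenPlus_eq c, coordSub_inf, lagLines_inf_fstLine]

lemma coordSub_inf_eigenMinus : coordSub (complexChart Φ) c lagLines ⊓ eigenMinus J =
    coordSub (complexChart Φ) c minusLines := by
  rw [hΦ.eigenMinus_eq c, coordSub_inf, lagLines_inf_sndLine]

omit hΦ in
lemma finrank_le_of_inf_eq_bot [FiniteDimensional ℝ V] {F P Q : Submodule ℂ (ℂ ⊗[ℝ] V)}
    (hP : P ≤ F) (hQ : Q ≤ F) (h : P ⊓ Q = ⊥) : finrank ℂ P + finrank ℂ Q ≤ finrank ℂ F := by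
  rw [← Submodule.finrank_sup_add_finrank_inf_eq, h, finrank_bot, add_zero]
  exact Submodule.finrank_mono (sup_le hP hQ)

/-- The intersections with the eigenspaces attain the two inertia bounds. They are maximal because a
positive subspace meets the nonpositive part, of dimension `n₀ + q`, only in zero, and dually for
negative subspaces. -/
lemma coordSub_mem_lagrangianOfType : coordSub (complexChart Φ) c lagLines ∈
    lagrangianOfType ω (colorCard c 0) (colorCard c 1) (colorCard c 2) := by
  have : FiniteDimensional ℝ V := Module.Finite.equiv Φ.symm
  have hsum := colorCard_sum c
  have hF := finrank_coordSub_lagLines (L := complexChart Φ) c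
  refine ⟨⟨?_, fun s hs t ht => hΦ.baseChange_form_eq_zero_of_mem_lagLines c hs ht⟩, ?_, ⟨?_, ?_⟩,
    ⟨?_, ?_⟩⟩
  · rw [hF, IsUnitaryChart.finrank_eq Φ]
  · rw [hΦ.kappaKernel_coordSub, kernelLines, finrank_coordSub_vec, finrank_diagLine, finrank_bot]
    ring
  · refine ⟨_, inf_le_left, hΦ.kappaPos_of_le_eigenPlus inf_le_right, ?_⟩
    rw [hΦ.coordSub_inf_eigenPlus, plusLines, finrank_coordSub_vec, finrank_fstLine, finrank_bot]
    ring
  · rintro k ⟨P, hPF, hP, rfl⟩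
    have h := finrank_le_of_inf_eq_bot hPF
      (coordSub_mono (complexChart Φ) c (S := nonposLines) (S' := lagLines) (by
        rw [← nonnegLines_sup_nonposLines]; exact le_sup_right))
      (by
        refine eq_bot_iff.2 fun t ht => ?_
        by_contra hne
        have hpos := hP t ht.1 hne
        rw [hΦ.kappa_self_re] at hpos
        refine hpos.not_ge (Finset.sum_nonpos fun i _ => ?_)
        have h1 := ht.2 i
        rcases Fin.eq_zero_or_one_or_two (c i) with h | h | h <;> rw [h] at h1
        · rw [mem_diagLine.1 h1, sub_self, zero_div]
        · have : complexChart Φ t i = 0 := (Submodule.mem_bot ℂ).1 h1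
          simp [this]
        · rw [mem_sndLine.1 h1, map_zero, zero_sub]
          have := Complex.normSq_nonneg (complexChart Φ t i).2
          linarith)
    rw [hF, nonposLines, finrank_coordSub_vec, finrank_diagLine, finrank_bot, finrank_sndLine] at h
    omega
  · refine ⟨_, inf_le_left, hΦ.kappaNeg_of_le_eigenMinus inf_le_right, ?_⟩
    rw [hΦ.coordSub_inf_eigenMinus, minusLines, finrank_coordSub_vec, finrank_sndLine, finrank_bot]
    ring
  · rintro k ⟨P, hPF, hP, rfl⟩
    have h := finrank_le_of_inf_eq_bot hPF
      (coordSub_mono (complexChart Φ) c (S := nonnegLines) (S' := lagLines) (by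
        rw [← nonnegLines_sup_nonposLines]; exact le_sup_left))
      (by
        refine eq_bot_iff.2 fun t ht => ?_
        by_contra hne
        have hneg := hP t ht.1 hne
        rw [hΦ.kappa_self_re] at hneg
        refine hneg.not_ge (Finset.sum_nonneg fun i _ => ?_)
        have h1 := ht.2 i
        rcases Fin.eq_zero_or_one_or_two (c i) with h | h | h <;> rw [h] at h1
        · rw [mem_diagLine.1 h1, sub_self, zero_div]
        · rw [mem_fstLine.1 h1, map_zero, sub_zero]
          have := Complex.normSq_nonneg (complexChart Φ t i).1
          linarith
        · have : complexChart Φ t i = 0 := (Submodule.mem_bot ℂ).1 h1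
          simp [this])
    rw [hF, nonnegLines, finrank_coordSub_vec, finrank_diagLine, finrank_bot, finrank_fstLine] at h
    omega

lemma coordSub_mem_lagrangianJ : coordSub (complexChart Φ) c lagLines ∈
    lagrangianJ ω J (colorCard c 0) (colorCard c 1) (colorCard c 2) := by
  refine ⟨hΦ.coordSub_mem_lagrangianOfType c, ?_⟩
  rw [hΦ.coordSub_inf_eigenPlus, hΦ.coordSub_inf_eigenMinus, hΦ.kappaKernel_coordSub, coordSub_sup,
    coordSub_sup, kernelLines_sup_plusLines, nonnegLines_sup_minusLines, disjoint_iff, disjoint_iff,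
    coordSub_inf, coordSub_inf]
  refine ⟨coordSub_eq_bot _ c ?_, coordSub_eq_bot _ c ?_, rfl⟩
  · funext k
    fin_cases k
    · exact inf_bot_eq diagLine
    · exact bot_inf_eq fstLine
    · exact inf_idem _
  · funext k
    fin_cases k
    · exact inf_bot_eq diagLine
    · exact inf_bot_eq fstLine
    · exact bot_inf_eq sndLine

lemma reKernel_coordSub :
    reKernel ω (coordSub (complexChart Φ) c lagLines) = coordSub Φ c radicalLines := by
  rw [reKernel, hΦ.kappaKernel_coordSub]
  ext v
  constructor
  · rintro ⟨t, ht, rfl⟩ i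
    rw [chart_rePart]
    have h1 := ht i
    rcases Fin.eq_zero_or_one_or_two (c i) with h | h | h <;> rw [h] at h1 ⊢
    · rw [mem_diagLine.1 h1]
      change (_ : ℂ).im = 0
      rw [Complex.add_conj, ← Complex.ofReal_ofNat, ← Complex.ofReal_div, Complex.ofReal_im]
    · have : complexChart Φ t i = 0 := (Submodule.mem_bot ℂ).1 h1
      simp [this]
    · have : complexChart Φ t i = 0 := (Submodule.mem_bot ℂ).1 h1
      simp [this]
  · intro hv
    refine ⟨1 ⊗ₜ v, fun i => ?_, by simp [rePart]⟩
    rw [complexChart_tmul, one_mul, one_mul]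
    have h1 := hv i
    rcases Fin.eq_zero_or_one_or_two (c i) with h | h | h <;> rw [h] at h1 ⊢
    · exact mem_diagLine.2 (Complex.conj_eq_iff_im.2 h1).symm
    · have : Φ v i = 0 := (Submodule.mem_bot ℝ).1 h1
      rw [this, map_zero]
      exact zero_mem _
    · have : Φ v i = 0 := (Submodule.mem_bot ℝ).1 h1
      rw [this, map_zero]
      exact zero_mem _

lemma splittingClass_coordSub : splittingClass ω (coordSub (complexChart Φ) c lagLines)
    (coordSub (complexChart Φ) c lagLines ⊓ eigenPlus J)
    (coordSub (complexChart Φ) c lagLines ⊓ eigenMinus J) =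
    (coordSub (complexChart Φ) c nonnegLines, coordSub (complexChart Φ) c nonposLines) := by
  rw [splittingClass, hΦ.coordSub_inf_eigenPlus, hΦ.coordSub_inf_eigenMinus,
    hΦ.kappaKernel_coordSub, coordSub_sup, coordSub_sup, kernelLines_sup_plusLines,
    kernelLines_sup_minusLines]

/-- A Lagrangian equals its own orthogonal, by isotropy and dimension count, so it contains every
vector orthogonal to it. -/
lemma mem_of_baseChange_form_eq_zero {F : Submodule ℂ (ℂ ⊗[ℝ] V)}
    (hF : IsComplexLagrangian ω F) {t : ℂ ⊗[ℝ] V}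
    (ht : ∀ w ∈ F, LinearMap.BilinForm.baseChange ℂ ω w t = 0) : t ∈ F := by
  have : FiniteDimensional ℝ V := Module.Finite.equiv Φ.symm
  have hle : F ≤ (LinearMap.BilinForm.baseChange ℂ ω).orthogonal F := fun s hs =>
    LinearMap.BilinForm.mem_orthogonal_iff.2 fun w hw => hF.2 w hw s hs
  have heq := Submodule.eq_of_le_of_finrank_eq hle (by
    rw [LinearMap.BilinForm.finrank_orthogonal hΦ.baseChange_form_nondegenerate,
      Module.finrank_baseChange, ← hF.1]
    omega)
  rw [heq]
  exact LinearMap.BilinForm.mem_orthogonal_iff.2 ht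

/-- For `t` in the kernel, `ω^ℂ(t, w̄) = 0` on `F`; conjugating shows that `t̄` is orthogonal to
`F`, hence lies in it. Isotropy of `F`, conjugated, then gives `κ(t̄, w) = 0`. -/
lemma conjC_mem_kappaKernel {F : Submodule ℂ (ℂ ⊗[ℝ] V)}
    (hF : IsComplexLagrangian ω F) {t : ℂ ⊗[ℝ] V} (ht : t ∈ kappaKernel ω F) :
    conjC t ∈ kappaKernel ω F := by
  have hcc : ∀ s : ℂ ⊗[ℝ] V, conjC (conjC s) = s := fun s => by
    apply (complexChart Φ).injective
    funext i
    simp [complexChart_conjC]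
  refine ⟨hΦ.mem_of_baseChange_form_eq_zero hF fun w hw => ?_, fun w hw => ?_⟩
  · have h := ht.2 w hw
    rw [kappa, mul_eq_zero, or_iff_right (by simp)] at h
    rw [hΦ.baseChange_form_swap, ← hcc w, hΦ.baseChange_form_conjC, h, map_zero, neg_zero]
  · rw [kappa, hΦ.baseChange_form_conjC, hF.2 t ht.1 w hw, map_zero, mul_zero]

end IsUnitaryChart

/-- Definiteness is automatic on subspaces of the eigenspaces, so the direct sum condition defining
`Lag_J` is already a splitting. -/
lemma splitLagrangianJ_eq_image (hΦ : IsUnitaryChart ω J Φ) (n₀ p q : ℕ) :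
    splitLagrangianJ ω J n₀ p q =
      (fun F => splittingClass ω F (F ⊓ eigenPlus J) (F ⊓ eigenMinus J)) ''
        lagrangianJ ω J n₀ p q := by
  ext A
  constructor
  · rintro ⟨-, F, hF, hs, rfl⟩
    exact ⟨F, ⟨hF, hs.disjoint_pos, hs.disjoint_neg, hs.sup_eq⟩, rfl⟩
  · rintro ⟨F, ⟨hF, h1, h2, h3⟩, rfl⟩
    have hs : IsSplitting ω F (F ⊓ eigenPlus J) (F ⊓ eigenMinus J) :=
      ⟨h1, h2, h3, hΦ.kappaPos_of_le_eigenPlus inf_le_right,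
        hΦ.kappaNeg_of_le_eigenMinus inf_le_right⟩
    exact ⟨⟨F, hF, _, _, hs, rfl⟩, F, hF, hs, rfl⟩

variable [DecidableEq ι]

lemma chartRot_smul_complexCoordSub_le {u : unitaryGroup ι ℂ}
    {S : Fin 3 → Submodule ℂ (ℂ × ℂ)} {F : Submodule ℂ (ℂ ⊗[ℝ] V)}
    (h : ∀ i, ∀ z ∈ S (c i), (complexChart Φ).symm
      (fun j => (z.1 * u.1 j i, z.2 * (starRingEnd ℂ) (u.1 j i))) ∈ F) :
    chartRot Φ u • coordSub (complexChart Φ) c S ≤ F := by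
  intro t ht
  rw [smul_complexSubmodule_def] at ht
  obtain ⟨w, hw, rfl⟩ := ht
  have hrot : ∀ s : ℂ ⊗[ℝ] V, complexChart Φ ((chartRot Φ u : V →ₗ[ℝ] V).baseChange ℂ s) =
      ∑ i, fun j => ((complexChart Φ s i).1 * u.1 j i,
        (complexChart Φ s i).2 * (starRingEnd ℂ) (u.1 j i)) := fun s => by
    funext j
    rw [Finset.sum_apply]
    induction s with
    | zero => ext <;> simp
    | add s s' hs hs' =>
      rw [map_add, map_add, Pi.add_apply, hs, hs', ← Finset.sum_add_distrib]
      refine Finset.sum_congr rfl fun i _ => ?_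
      simp only [map_add, Pi.add_apply, Prod.fst_add, Prod.snd_add, add_mul]
      rfl
    | tmul z v =>
      rw [LinearMap.baseChange_tmul, complexChart_tmul]
      change (z * Φ (chartRot Φ u v) j, z * (starRingEnd ℂ) (Φ (chartRot Φ u v) j)) = _
      rw [chart_chartRot, Matrix.mulVec, dotProduct, map_sum, Finset.mul_sum, Finset.mul_sum,
        Prod.ext_iff, Prod.fst_sum, Prod.snd_sum]
      constructor
      · refine Finset.sum_congr rfl fun i _ => ?_
        rw [complexChart_tmul]
        ring
      · refine Finset.sum_congr rfl fun i _ => ?_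
        rw [complexChart_tmul, map_mul]
        ring
  rw [← (complexChart Φ).symm_apply_apply ((chartRot Φ u : V →ₗ[ℝ] V).baseChange ℂ w), hrot,
    map_sum]
  exact sum_mem fun i _ => h i _ (hw i)

/-- The real points of the kernel of `κ` on `F`. -/
def kernelRealPoints (ω : LinearMap.BilinForm ℝ V) (F : Submodule ℂ (ℂ ⊗[ℝ] V)) :
    Submodule ℝ V :=
  ((kappaKernel ω F).restrictScalars ℝ).comap (TensorProduct.mk ℝ ℂ V 1)

omit [DecidableEq ι] in
-- The kernel is stable under conjugation, so real and imaginary parts of its elements are again in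
-- it. Taking both parts embeds it in two copies of its real points; compare real dimensions.
lemma IsUnitaryChart.finrank_kappaKernel_le (hΦ : IsUnitaryChart ω J Φ)
    {F : Submodule ℂ (ℂ ⊗[ℝ] V)} (hL : IsComplexLagrangian ω F) :
    finrank ℂ (kappaKernel ω F) ≤ finrank ℝ (kernelRealPoints ω F) := by
  have : FiniteDimensional ℝ V := Module.Finite.equiv Φ.symm
  set F₀ := kappaKernel ω F with hF₀
  set R := kernelRealPoints ω F
  have hR : ∀ v, v ∈ R ↔ (1 : ℂ) ⊗ₜ[ℝ] v ∈ F₀ := fun v => Iff.rfl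
  have hre : ∀ t ∈ F₀, rePart t ∈ R := fun t ht => by
    have h1 : (1 : ℂ) ⊗ₜ[ℝ] rePart t = (1 / 2 : ℂ) • (t + conjC t) := by
      apply (complexChart Φ).injective
      funext i
      rw [complexChart_tmul, map_smul, map_add, Pi.smul_apply, Pi.add_apply, complexChart_conjC,
        chart_rePart]
      ext
      · simp only [Prod.smul_fst, Prod.fst_add, smul_eq_mul]
        ring
      · simp only [Prod.smul_snd, Prod.snd_add, smul_eq_mul, map_div₀, map_add, Complex.conj_conj,
          map_ofNat]
        ring
    rw [hR, h1]
    exact F₀.smul_mem _ (add_mem ht (hΦ.conjC_mem_kappaKernel hL ht))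
  let f : F₀ →ₗ[ℝ] R × R :=
    { toFun := fun t => (⟨rePart t.1, hre _ t.2⟩,
        ⟨rePart (-Complex.I • t.1), hre _ (F₀.smul_mem _ t.2)⟩)
      map_add' := fun s t => by ext <;> simp
      map_smul' := fun r t => by
        ext
        · simp
        · change rePart (-Complex.I • (r • t.1)) = r • rePart (-Complex.I • t.1)
          rw [smul_comm, map_smul] }
  have hf : Function.Injective f := (injective_iff_map_eq_zero f).2 fun t ht => by
    have h1 : rePart t.1 = 0 := congrArg (fun x => (x.1 : V)) ht
    have h2 : rePart (-Complex.I • t.1) = 0 := congrArg (fun x => (x.2 : V)) ht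
    refine Subtype.ext ((complexChart Φ).map_eq_zero_iff.1 (funext fun i => ?_))
    have e1 := chart_rePart Φ t.1 i
    have e2 := chart_rePart Φ (-Complex.I • t.1) i
    rw [h1] at e1
    rw [h2] at e2
    simp only [map_zero, Pi.zero_apply, map_smul, Pi.smul_apply, Prod.smul_fst, Prod.smul_snd,
      smul_eq_mul, map_mul, map_neg, Complex.conj_I, neg_neg] at e1 e2
    have e3 : (complexChart Φ t.1 i).1 = 0 := by
      linear_combination -e1 - Complex.I * e2 +
        ((complexChart Φ t.1 i).1 - (starRingEnd ℂ) (complexChart Φ t.1 i).2) / 2 * Complex.I_mul_I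
    have e4 : (starRingEnd ℂ) (complexChart Φ t.1 i).2 = 0 := by
      linear_combination -2 * e1 - e3
    exact Prod.ext e3 ((map_eq_zero _).1 e4)
  have h1 := LinearMap.finrank_le_finrank_of_injective hf
  rw [Module.finrank_prod] at h1
  have h2 := Module.finrank_mul_finrank ℝ ℂ F₀
  rw [Complex.finrank_real_complex] at h2
  omega

omit [DecidableEq ι] in
-- On the `+i` eigenspace the second coordinates vanish, so the intersection can be studied inside
-- `ℂ^ι` through its first coordinates.
lemma IsUnitaryChart.exists_submodule_inf_eigenPlus (hΦ : IsUnitaryChart ω J Φ)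
    (F : Submodule ℂ (ℂ ⊗[ℝ] V)) : ∃ C : Submodule ℂ (ι → ℂ),
      (∀ x, x ∈ C ↔ (complexChart Φ).symm (fun i => (x i, 0)) ∈ F) ∧
      finrank ℂ ↥(F ⊓ eigenPlus J) ≤ finrank ℂ C := by
  let pr : (ι → ℂ) →ₗ[ℂ] (ι → ℂ × ℂ) :=
    { toFun := fun x i => (x i, 0)
      map_add' := fun x y => by ext i <;> simp
      map_smul' := fun z x => by ext i <;> simp }
  let C : Submodule ℂ (ι → ℂ) := F.comap ((complexChart Φ).symm.toLinearMap ∘ₗ pr)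
  have hC : ∀ x, x ∈ C ↔ (complexChart Φ).symm (fun i => (x i, 0)) ∈ F := fun x => Iff.rfl
  refine ⟨C, hC, ?_⟩
  have hY : ∀ t : ↥(F ⊓ eigenPlus J),
      (fun i => ((complexChart Φ t.1 i).1, (0 : ℂ))) = complexChart Φ t.1 := fun t =>
    funext fun i => Prod.ext rfl (hΦ.mem_eigenPlus.1 t.2.2 i).symm
  let f : ↥(F ⊓ eigenPlus J) →ₗ[ℂ] C :=
    { toFun := fun t => ⟨fun i => (complexChart Φ t.1 i).1, by
        rw [hC, hY, LinearEquiv.symm_apply_apply]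
        exact t.2.1⟩
      map_add' := fun s t => by ext; simp
      map_smul' := fun r t => by ext; simp }
  refine LinearMap.finrank_le_finrank_of_injective (f := f)
    ((injective_iff_map_eq_zero f).2 fun t ht => ?_)
  refine Subtype.ext ((complexChart Φ).map_eq_zero_iff.1 ?_)
  have : (fun i => (complexChart Φ t.1 i).1) = 0 := congrArg Subtype.val ht
  rw [← hY]
  funext i
  exact Prod.ext (congrFun this i) rfl

/-- Isotropy of `F` says exactly that the real points of the kernel are isotropic in `ℂ^ι` and
hermitian orthogonal to the `+i` part, which is what `exists_unitary_adapted` requires. -/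
lemma IsUnitaryChart.exists_unitary_columns_mem (hΦ : IsUnitaryChart ω J Φ)
    {F : Submodule ℂ (ℂ ⊗[ℝ] V)} (hL : IsComplexLagrangian ω F)
    (h0 : colorCard c 0 ≤ finrank ℂ (kappaKernel ω F))
    (h1 : colorCard c 1 ≤ finrank ℂ ↥(F ⊓ eigenPlus J)) :
    ∃ u : unitaryGroup ι ℂ,
      (∀ i, c i = 0 → ∀ z ∈ diagLine, (complexChart Φ).symm
        (fun j => (z.1 * u.1 j i, z.2 * (starRingEnd ℂ) (u.1 j i))) ∈ kappaKernel ω F) ∧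
      ∀ i, c i = 1 → ∀ z ∈ fstLine, (complexChart Φ).symm
        (fun j => (z.1 * u.1 j i, z.2 * (starRingEnd ℂ) (u.1 j i))) ∈ F ⊓ eigenPlus J := by
  have hRdim := hΦ.finrank_kappaKernel_le hL
  obtain ⟨C, hC, hCdim⟩ := hΦ.exists_submodule_inf_eigenPlus F
  set F₀ := kappaKernel ω F with hF₀
  have hF₀F : F₀ ≤ F := fun t ht => ht.1
  set R := kernelRealPoints ω F
  have hRdim' : finrank ℝ (R.map (Φ : V →ₗ[ℝ] (ι → ℂ))) = finrank ℝ R :=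
    LinearEquiv.finrank_map_eq Φ R
  obtain ⟨u, hu0, hu1⟩ := exists_unitary_adapted c (R.map (Φ : V →ₗ[ℝ] (ι → ℂ))) C
    (by
      rintro _ ⟨x, hx, rfl⟩ _ ⟨y, hy, rfl⟩
      have h1 := hL.2 _ (hF₀F hx) _ (hF₀F hy)
      change LinearMap.BilinForm.baseChange ℂ ω (1 ⊗ₜ x) (1 ⊗ₜ y) = 0 at h1
      rw [LinearMap.BilinForm.baseChange_tmul] at h1
      have h2 := hΦ.dotProduct_eq x y
      change (star (Φ x) ⬝ᵥ Φ y).im = 0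
      rw [h2]
      simpa using h1)
    (by
      rintro _ ⟨x, hx, rfl⟩ y hy
      have h1 := hL.2 _ (hF₀F hx) _ ((hC y).1 hy)
      change LinearMap.BilinForm.baseChange ℂ ω (1 ⊗ₜ x) _ = 0 at h1
      rw [hΦ.baseChange_form, ← Finset.mul_sum, mul_eq_zero, or_iff_right (by simp)] at h1
      have h2 : ∑ i, (starRingEnd ℂ) (Φ x i) * y i = 0 := by simpa [complexChart_tmul] using h1
      exact h2)
    (by omega) (by omega)
  refine ⟨u, fun i hi z hz => ?_, fun i hi z hz => ?_⟩
  · obtain ⟨x, hx, hxe⟩ := hu0 i hi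
    have hxe' : ∀ j, Φ x j = u.1 j i := fun j => congrFun hxe j
    have : (complexChart Φ).symm (fun j => (z.1 * u.1 j i, z.2 * (starRingEnd ℂ) (u.1 j i))) =
        z.1 • (1 : ℂ) ⊗ₜ[ℝ] x := by
      rw [LinearEquiv.symm_apply_eq]
      funext j
      rw [map_smul, Pi.smul_apply, complexChart_tmul, hxe', ← mem_diagLine.1 hz]
      simp
    rw [this]
    exact F₀.smul_mem _ hx
  · have hz' := mem_fstLine.1 hz
    refine ⟨?_, hΦ.mem_eigenPlus.2 fun j => by simp [hz']⟩
    have h := (hC _).1 (C.smul_mem z.1 (hu1 i hi))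
    simpa [hz'] using h

/-- Every element of `Lag_J` is a unitary rotation of the model subspace. -/
theorem IsUnitaryChart.exists_eq_chartRot_smul_lagrangian (hΦ : IsUnitaryChart ω J Φ)
    {F : Submodule ℂ (ℂ ⊗[ℝ] V)}
    (hF : F ∈ lagrangianJ ω J (colorCard c 0) (colorCard c 1) (colorCard c 2)) :
    ∃ u : unitaryGroup ι ℂ, F = chartRot Φ u • coordSub (complexChart Φ) c lagLines := by
  have : FiniteDimensional ℝ V := Module.Finite.equiv Φ.symm
  obtain ⟨⟨hL, hk, hp, hq⟩, hd1, hd2, hsup⟩ := hF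
  set F₀ := kappaKernel ω F with hF₀
  have hF₀F : F₀ ≤ F := fun t ht => ht.1
  have hsum := colorCard_sum c
  have hdimF : finrank ℂ F = Fintype.card ι := by
    have := hL.1
    rw [IsUnitaryChart.finrank_eq Φ] at this
    omega
  have hplus : finrank ℂ ↥(F ⊓ eigenPlus J) ≤ colorCard c 1 :=
    hp.2 ⟨_, inf_le_left, hΦ.kappaPos_of_le_eigenPlus inf_le_right, rfl⟩
  have hminus : finrank ℂ ↥(F ⊓ eigenMinus J) ≤ colorCard c 2 :=
    hq.2 ⟨_, inf_le_left, hΦ.kappaNeg_of_le_eigenMinus inf_le_right, rfl⟩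
  -- The dimensions of the three summands add up to `n = n₀ + p + q`, and the definite ones are at
  -- most `p` and `q`; so both bounds are equalities.
  have hd1' := Submodule.finrank_sup_add_finrank_inf_eq F₀ (F ⊓ eigenPlus J)
  have hd2' := Submodule.finrank_sup_add_finrank_inf_eq (F₀ ⊔ F ⊓ eigenPlus J) (F ⊓ eigenMinus J)
  rw [hd1.eq_bot, finrank_bot, hk] at hd1'
  rw [hd2.eq_bot, finrank_bot, hsup, hdimF] at hd2'
  obtain ⟨u, hcol0, hcol1⟩ := hΦ.exists_unitary_columns_mem c hL hk.ge (by omega)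
  set k := chartRot Φ u with hkdef
  have hΦ' : IsUnitaryChart ω J (k.symm.trans Φ) := hΦ.symm_trans (chartRot_mem hΦ u)
  have hG : k • coordSub (complexChart Φ) c nonnegLines = F₀ ⊔ F ⊓ eigenPlus J := by
    refine Submodule.eq_of_le_of_finrank_eq (chartRot_smul_complexCoordSub_le c fun i z hz => ?_) ?_
    · rcases Fin.eq_zero_or_one_or_two (c i) with h | h | h <;> rw [h] at hz
      · exact Submodule.mem_sup_left (hcol0 i h z hz)
      · exact Submodule.mem_sup_right (hcol1 i h z hz)
      · have : z = 0 := (Submodule.mem_bot ℂ).1 hz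
        have h0 : (fun j => (z.1 * u.1 j i, z.2 * (starRingEnd ℂ) (u.1 j i))) = 0 := by
          funext j
          simp [this]
        rw [h0, map_zero]
        exact zero_mem _
    · rw [smul_coordSub_complexChart, nonnegLines, finrank_coordSub_vec, finrank_diagLine,
        finrank_fstLine, finrank_bot]
      omega
  refine ⟨u, (Submodule.eq_of_le_of_finrank_eq ?_ ?_).symm⟩
  · rw [← hkdef, smul_coordSub_complexChart, ← nonnegLines_sup_minusLines, ← coordSub_sup,
      ← smul_coordSub_complexChart, hG]
    refine sup_le (le_sup_left.trans_eq hsup) fun t ht => ?_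
    -- The colour `2` part is shown to lie in `F` by orthogonality: to the first two summands
    -- because all lie in the rotated model, which is isotropic, and to the third because the `-i`
    -- eigenspace is isotropic.
    refine hΦ.mem_of_baseChange_form_eq_zero hL fun w hw => ?_
    rw [← hsup] at hw
    obtain ⟨g, hg, f, hf, rfl⟩ := Submodule.mem_sup.1 hw
    rw [← hG, smul_coordSub_complexChart] at hg
    rw [map_add, LinearMap.add_apply, hΦ'.baseChange_form_eq_zero_of_mem_lagLines c
      (coordSub_mono _ c (le_sup_left.trans_eq nonnegLines_sup_minusLines) hg)
      (coordSub_mono _ c (le_sup_right.trans_eq nonnegLines_sup_minusLines) ht), zero_add,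
      hΦ'.baseChange_form]
    have h1 := hΦ'.mem_eigenMinus.1 hf.2
    rw [← hΦ'.coordSub_inf_eigenMinus] at ht
    have h2 := hΦ'.mem_eigenMinus.1 ht.2
    simp [h1, h2]
  · rw [smul_coordSub_complexChart, finrank_coordSub_lagLines, hdimF]

end Lagrangian

end

/-! ### Smooth orbit maps and smooth invariants of subspaces -/

noncomputable section

open Matrix

section OrbitMaps

variable {V : Type*} [AddCommGroup V] [Module ℝ V] 

lemma isPlot_linearEquiv_iff {n : ℕ} {p : Eucl n → V ≃ₗ[ℝ] V} : IsPlot p ↔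
    @IsPlot _ (DiffeologicalSpace.ofVectorSpace (V →ₗ[ℝ] V)) n
      fun t => (p t : V →ₗ[ℝ] V) :=
  Iff.rfl

variable [FiniteDimensional ℝ V]

lemma dSmooth_smul_submodule (W : Submodule ℝ V) : DSmooth fun k : V ≃ₗ[ℝ] V => k • W := by
  intro n p hp
  obtain ⟨ℓ, v, rfl⟩ := Frame.exists_span_eq W
  let q : Eucl n → Frame ℝ V ℓ := fun t => ⟨fun i => p t (v.1 i),
    v.2.map' (p t : V →ₗ[ℝ] V) (LinearEquiv.ker _)⟩
  have hq : IsPlot q := by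
    let L : (V →ₗ[ℝ] V) →ₗ[ℝ] (Fin ℓ → V) :=
      { toFun := fun f i => f (v.1 i)
        map_add' := fun f g => rfl
        map_smul' := fun r f => rfl }
    exact isPlot_ofVectorSpace_comp (isPlot_linearEquiv_iff.1 hp) L
  have h : (fun k : V ≃ₗ[ℝ] V => k • v.span) ∘ p = fun t => (q t).span := by
    funext t
    change (Submodule.span ℝ (Set.range v.1)).map (p t : V →ₗ[ℝ] V) = Submodule.span ℝ _
    rw [Submodule.map_span, ← Set.range_comp]
    rfl
  rw [h]
  exact isPlot_frame_span hq

lemma dSmooth_smul_complexSubmodule (F : Submodule ℂ (ℂ ⊗[ℝ] V)) :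
    DSmooth fun k : V ≃ₗ[ℝ] V => k • F := by
  intro n p hp
  obtain ⟨ℓ, v, rfl⟩ := Frame.exists_span_eq F
  have hinj : ∀ k : V ≃ₗ[ℝ] V, LinearMap.ker ((k : V →ₗ[ℝ] V).baseChange ℂ) = ⊥ := fun k =>
    LinearEquiv.ker (LinearEquiv.baseChange ℝ ℂ V V k)
  let q : Eucl n → Frame ℂ (ℂ ⊗[ℝ] V) ℓ := fun t =>
    ⟨fun i => (p t : V →ₗ[ℝ] V).baseChange ℂ (v.1 i), v.2.map' _ (hinj _)⟩
  have hq : IsPlot q := by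
    let L : (V →ₗ[ℝ] V) →ₗ[ℝ] (Fin ℓ → ℂ ⊗[ℝ] V) :=
      { toFun := fun f i => f.baseChange ℂ (v.1 i)
        map_add' := fun f g => by
          funext i
          rw [LinearMap.baseChange_add]
          rfl
        map_smul' := fun r f => by
          funext i
          rw [LinearMap.baseChange_smul]
          rfl }
    exact isPlot_ofVectorSpace_comp (isPlot_linearEquiv_iff.1 hp) L
  have h : (fun k : V ≃ₗ[ℝ] V => k • v.span) ∘ p = fun t => (q t).span := by
    funext t
    change (Submodule.span ℂ (Set.range v.1)).map ((p t : V →ₗ[ℝ] V).baseChange ℂ) =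
      Submodule.span ℂ _
    rw [Submodule.map_span, ← Set.range_comp]
    rfl
  rw [h]
  exact isPlot_frame_span hq

omit [FiniteDimensional ℝ V] in
-- A left inverse of the real frame map, complexified, reads off each coefficient.
lemma LinearIndependent.one_tmul {ℓ : ℕ} {v : Fin ℓ → V} (hv : LinearIndependent ℝ v) :
    LinearIndependent ℂ fun i => (1 : ℂ) ⊗ₜ[ℝ] v i := by
  obtain ⟨g, hg⟩ := LinearMap.exists_leftInverse_of_injective (Fintype.linearCombination ℝ v)
    (LinearMap.ker_eq_bot.2 (linearIndependent_iff_injective_fintypeLinearCombination.1 hv))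
  have hgv : ∀ i, g (v i) = Pi.single i 1 := fun i => by
    have := LinearMap.congr_fun hg (Pi.single i 1)
    rwa [LinearMap.comp_apply, Fintype.linearCombination_apply_single, one_smul] at this
  refine Fintype.linearIndependent_iff.2 fun z hz j => ?_
  let φ : ℂ ⊗[ℝ] V →ₗ[ℂ] ℂ := LinearMap.liftBaseChange ℂ
    ((Algebra.linearMap ℝ ℂ) ∘ₗ (LinearMap.proj j) ∘ₗ g)
  have h := congrArg φ hz
  rw [map_sum, map_zero, Finset.sum_eq_single j] at h
  · simpa [φ, hgv] using h
  · intro i _ hij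
    simp [φ, hgv, hij.symm]
  · simp

open OpenPartialHomeomorph (univBall) in
/-- Complexification of subspaces is smooth. -/
lemma dSmooth_baseChange : DSmooth fun W : Submodule ℝ V => W.baseChange ℂ := by
  intro n p hp
  refine isPlot_of_local fun t => ?_
  obtain ⟨r, hr, ℓ, q, hq, hpq⟩ := exists_frame_of_isPlot hp t
  refine ⟨r, hr, ?_⟩
  let q' : Eucl n → Frame ℂ (ℂ ⊗[ℝ] V) ℓ := fun s =>
    ⟨fun i => (1 : ℂ) ⊗ₜ[ℝ] (q s).1 i, (q s).2.one_tmul⟩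
  have hq' : IsPlot q' := by
    let L : (Fin ℓ → V) →ₗ[ℝ] (Fin ℓ → ℂ ⊗[ℝ] V) := (TensorProduct.mk ℝ ℂ V 1).compLeft (Fin ℓ)
    exact isPlot_ofVectorSpace_comp hq L
  have h : (fun s => (p (univBall t r s)).baseChange ℂ) = fun s => (q' s).span := by
    funext s
    rw [hpq, Frame.span, Submodule.baseChange_span, ← Set.range_comp]
    rfl
  change IsPlot fun s => (p (univBall t r s)).baseChange ℂ
  rw [h]
  exact isPlot_frame_span hq'

end OrbitMaps

/-! ### Orthogonal projections onto rotated models -/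

section Charts

variable {V : Type*} [AddCommGroup V] [Module ℝ V] {ι : Type*} [Fintype ι]

lemma complexChart_eq_mulVec {Φ₁ Φ₂ : V ≃ₗ[ℝ] (ι → ℂ)} {M : Matrix ι ι ℂ}
    (h : ∀ v, Φ₁ v = M *ᵥ Φ₂ v) (t : ℂ ⊗[ℝ] V) (i : ι) : complexChart Φ₁ t i =
      (∑ j, M i j * (complexChart Φ₂ t j).1, ∑ j, (starRingEnd ℂ) (M i j) * (complexChart Φ₂ t j).2) := by
  induction t with
  | zero => ext <;> simp
  | add s t hs ht =>
    rw [map_add, Pi.add_apply, hs, ht, Prod.mk_add_mk, ← Finset.sum_add_distrib,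
      ← Finset.sum_add_distrib]
    simp only [map_add, Pi.add_apply, Prod.fst_add, Prod.snd_add, mul_add]
  | tmul z v =>
    rw [complexChart_tmul, h, Matrix.mulVec, dotProduct, map_sum, Finset.mul_sum, Finset.mul_sum]
    refine Prod.ext (Finset.sum_congr rfl fun j _ => ?_) (Finset.sum_congr rfl fun j _ => ?_)
    · rw [complexChart_tmul]
      ring
    · rw [complexChart_tmul, map_mul]
      ring

omit [Fintype ι] in
lemma eq_one_tmul_add_I_tmul (t : ℂ ⊗[ℝ] V) :
    t = (1 : ℂ) ⊗ₜ[ℝ] rePart t + Complex.I ⊗ₜ[ℝ] rePart (-Complex.I • t) := by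
  induction t with
  | zero => simp
  | add s t hs ht =>
    rw [smul_add, map_add, map_add, TensorProduct.tmul_add, TensorProduct.tmul_add,
      add_add_add_comm, ← hs, ← ht]
  | tmul z v =>
    have h : ∀ w : ℂ, rePart (w ⊗ₜ[ℝ] v) = w.re • v := fun w => by simp [rePart]
    rw [TensorProduct.smul_tmul', h, h, ← TensorProduct.smul_tmul, ← TensorProduct.smul_tmul,
      ← TensorProduct.add_tmul]
    congr 1
    apply Complex.ext <;> simp

/-- The second condition says that real parts stay in the real subspace; applied to `t` and `-i t`,
it writes `t` as a combination of two real vectors of the subspace. -/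
lemma baseChange_coordSub (Φ : V ≃ₗ[ℝ] (ι → ℂ)) (c : ι → Fin 3) {S : Fin 3 → Submodule ℝ ℂ}
    {S' : Fin 3 → Submodule ℂ (ℂ × ℂ)} (h1 : ∀ k, ∀ z ∈ S k, (z, (starRingEnd ℂ) z) ∈ S' k)
    (h2 : ∀ k, ∀ z ∈ S' k, (z.1 + (starRingEnd ℂ) z.2) / 2 ∈ S k) :
    (coordSub Φ c S).baseChange ℂ = coordSub (complexChart Φ) c S' := by
  refine le_antisymm ?_ fun t ht => ?_
  · rw [Submodule.baseChange_eq_span, Submodule.span_le]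
    rintro _ ⟨v, hv, rfl⟩ i
    change complexChart Φ (1 ⊗ₜ v) i ∈ _
    rw [complexChart_tmul, one_mul, one_mul]
    exact h1 _ _ (hv i)
  · have hre : ∀ s ∈ coordSub (complexChart Φ) c S', rePart s ∈ coordSub Φ c S := fun s hs i => by
      rw [chart_rePart]
      exact h2 _ _ (hs i)
    rw [eq_one_tmul_add_I_tmul t]
    exact add_mem (Submodule.tmul_mem_baseChange_of_mem _ (hre t ht))
      (Submodule.tmul_mem_baseChange_of_mem _ (hre _ (Submodule.smul_mem _ _ ht)))

variable [DecidableEq ι] {Φ : V ≃ₗ[ℝ] (ι → ℂ)} {c : ι → Fin 3}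

/-- A block matrix mixes only coordinates of one colour, with real coefficients for colour `0`. This
gives one inclusion, and dimensions give equality; away from colour `0` the lines must be complex.
-/
lemma chartRot_smul_coordSub_of_isBlock [FiniteDimensional ℝ V] {h : unitaryGroup ι ℂ}
    (hh : BlockModel.IsBlock c h.1) {S : Fin 3 → Submodule ℝ ℂ}
    (hS : ∀ k ≠ 0, ∀ z, ∀ s ∈ S k, s * z ∈ S k) :
    chartRot Φ h • coordSub Φ c S = coordSub Φ c S := by
  refine Submodule.eq_of_le_of_finrank_eq (chartRot_smul_coordSub_le c fun i z hz j => ?_) ?_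
  · rw [Φ.apply_symm_apply, Pi.smul_apply, smul_eq_mul]
    by_cases hij : c j = c i
    · rw [hij]
      by_cases h0 : c i = 0
      · have hreal : h.1 j i = ((h.1 j i).re : ℂ) :=
          Complex.ext rfl (hh.2 j i (hij.trans h0) h0)
        rw [hreal, mul_comm, ← Complex.real_smul]
        exact (S (c i)).smul_mem _ hz
      · exact hS _ h0 _ _ hz
    · rw [hh.1 j i hij, mul_zero]
      exact zero_mem _
  · rw [smul_coordSub, finrank_coordSub, finrank_coordSub]

lemma chartRot_smul_complexCoordSub_of_isBlock [FiniteDimensional ℝ V] {h : unitaryGroup ι ℂ}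
    (hh : BlockModel.IsBlock c h.1) {S : Fin 3 → Submodule ℂ (ℂ × ℂ)}
    (hS : ∀ k ≠ 0, ∀ z, ∀ s ∈ S k, (s.1 * z, s.2 * (starRingEnd ℂ) z) ∈ S k) :
    chartRot Φ h • coordSub (complexChart Φ) c S = coordSub (complexChart Φ) c S := by
  refine Submodule.eq_of_le_of_finrank_eq
    (chartRot_smul_complexCoordSub_le c fun i z hz j => ?_) ?_
  · rw [LinearEquiv.apply_symm_apply]
    by_cases hij : c j = c i
    · rw [hij]
      by_cases h0 : c i = 0
      · have hreal : (starRingEnd ℂ) (h.1 j i) = h.1 j i :=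
          Complex.conj_eq_iff_im.2 (hh.2 j i (hij.trans h0) h0)
        rw [hreal, mul_comm, mul_comm z.2]
        exact (S (c i)).smul_mem (h.1 j i) hz
      · exact hS _ h0 _ _ hz
    · rw [hh.1 j i hij, map_zero, mul_zero, mul_zero]
      exact zero_mem _
  · rw [smul_coordSub_complexChart, finrank_coordSub, finrank_coordSub]

variable (Φ) in
/-- The complexified chart, with values in a hermitian space. -/
def hermitianChart : ℂ ⊗[ℝ] V ≃ₗ[ℂ] EuclideanSpace ℂ (ι ⊕ ι) where
  toFun t := WithLp.toLp 2 (Sum.elim (fun i => (complexChart Φ t i).1)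
    fun i => (complexChart Φ t i).2)
  map_add' s t := by ext i; rcases i with i | i <;> simp
  map_smul' z t := by ext i; rcases i with i | i <;> simp
  invFun w := (complexChart Φ).symm fun i => (w (Sum.inl i), w (Sum.inr i))
  left_inv t := by simp
  right_inv w := by ext i; rcases i with i | i <;> simp

omit [DecidableEq ι] in
lemma hermitianChart_inl (t : ℂ ⊗[ℝ] V) (i : ι) :
    hermitianChart Φ t (Sum.inl i) = (complexChart Φ t i).1 := rfl

omit [DecidableEq ι] in
lemma hermitianChart_inr (t : ℂ ⊗[ℝ] V) (i : ι) :
    hermitianChart Φ t (Sum.inr i) = (complexChart Φ t i).2 := rfl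

lemma chart_eq_mulVec_chartRot (u : unitaryGroup ι ℂ) (v : V) :
    Φ v = u.1 *ᵥ ((chartRot Φ u).symm.trans Φ) v := by
  rw [LinearEquiv.trans_apply, chart_chartRot_symm, Matrix.mulVec_mulVec,
    BlockModel.mul_conjTranspose_self, Matrix.one_mulVec]

omit [DecidableEq ι] in
lemma inner_hermitianChart (s t : ℂ ⊗[ℝ] V) :
    (inner ℂ (hermitianChart Φ s) (hermitianChart Φ t) : ℂ) =
      ∑ i, ((starRingEnd ℂ) (complexChart Φ s i).1 * (complexChart Φ t i).1 +
        (starRingEnd ℂ) (complexChart Φ s i).2 * (complexChart Φ t i).2) := by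
  rw [PiLp.inner_apply, Fintype.sum_sum_type, ← Finset.sum_add_distrib]
  refine Finset.sum_congr rfl fun i _ => ?_
  rw [hermitianChart_inl, hermitianChart_inl, hermitianChart_inr, hermitianChart_inr]
  simp [mul_comm]

/-- The first coordinates change by `u` and the second by its conjugate, both unitary, so the
hermitian product may be computed in the rotated chart. -/
lemma inner_hermitianChart_chartRot (u : unitaryGroup ι ℂ) (s t : ℂ ⊗[ℝ] V) :
    (inner ℂ (hermitianChart Φ s) (hermitianChart Φ t) : ℂ) =
      inner ℂ (hermitianChart ((chartRot Φ u).symm.trans Φ) s)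
        (hermitianChart ((chartRot Φ u).symm.trans Φ) t) := by
  rw [inner_hermitianChart, inner_hermitianChart, Finset.sum_add_distrib, Finset.sum_add_distrib]
  have h := fun t i => complexChart_eq_mulVec (chart_eq_mulVec_chartRot (Φ := Φ) u) t i
  congr 1
  · have h1 := sum_conj_mulVec u
      (fun i => (complexChart ((chartRot Φ u).symm.trans Φ) s i).1)
      (fun i => (complexChart ((chartRot Φ u).symm.trans Φ) t i).1)
    rw [← h1]
    refine Finset.sum_congr rfl fun i _ => ?_
    rw [h, h]
    rfl
  · have h1 := congrArg (starRingEnd ℂ) (sum_conj_mulVec u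
      (fun i => (starRingEnd ℂ) (complexChart ((chartRot Φ u).symm.trans Φ) s i).2)
      (fun i => (starRingEnd ℂ) (complexChart ((chartRot Φ u).symm.trans Φ) t i).2))
    simp only [map_sum, map_mul, Complex.conj_conj] at h1
    rw [← h1]
    refine Finset.sum_congr rfl fun i _ => ?_
    rw [h, h]
    simp only [Matrix.mulVec, dotProduct, map_sum, map_mul, Complex.conj_conj]

/-- Families of subspaces of `ℂ × ℂ` whose orthogonal projections have prescribed first rows. -/
def HasModelProjections (S : Fin 3 → Submodule ℂ (ℂ × ℂ)) : Prop :=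
  ∃ π : Fin 3 → ℂ × ℂ → ℂ × ℂ, (∀ k z, π k z ∈ S k) ∧
    (∀ k z, ∀ s ∈ S k, (starRingEnd ℂ) s.1 * (z - π k z).1 +
      (starRingEnd ℂ) s.2 * (z - π k z).2 = 0) ∧
    (∀ z, (π 0 z).1 = 2⁻¹ * (z.1 + z.2)) ∧ (∀ z, (π 1 z).1 = z.1) ∧ ∀ z, (π 2 z).1 = 0

/-- The first rows of the matrix of the orthogonal projection onto a subspace. -/
def projBlocks (Φ : V ≃ₗ[ℝ] (ι → ℂ)) (F : Submodule ℂ (ℂ ⊗[ℝ] V)) :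
    Matrix ι ι ℂ × Matrix ι ι ℂ :=
  (fun i j => (F.map (hermitianChart Φ : ℂ ⊗[ℝ] V →ₗ[ℂ] EuclideanSpace ℂ (ι ⊕ ι))).starProjection
      (EuclideanSpace.single (Sum.inl j) 1) (Sum.inl i),
    fun i j => (F.map (hermitianChart Φ : ℂ ⊗[ℝ] V →ₗ[ℂ] EuclideanSpace ℂ (ι ⊕ ι))).starProjection
      (EuclideanSpace.single (Sum.inr j) 1) (Sum.inl i))

/-- A smooth function of subspaces that inverts the orbit maps. -/
def modelInvariant (Φ : V ≃ₗ[ℝ] (ι → ℂ)) (F : Submodule ℂ (ℂ ⊗[ℝ] V)) :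
    Matrix ι ι ℂ × Matrix ι ι ℂ :=
  ((2 : ℝ) • (projBlocks Φ F).2,
    (projBlocks Φ F).1 - (2 : ℝ) • ((projBlocks Φ F).2 * (projBlocks Φ F).2ᴴ))

/-- In the rotated chart the product is a sum over coordinates, so projecting each coordinate
separately gives the orthogonal projection. -/
lemma starProjection_coordSub {S : Fin 3 → Submodule ℂ (ℂ × ℂ)} {π : Fin 3 → ℂ × ℂ → ℂ × ℂ}
    (h1 : ∀ k z, π k z ∈ S k)
    (h2 : ∀ k z, ∀ s ∈ S k, (starRingEnd ℂ) s.1 * (z - π k z).1 +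
      (starRingEnd ℂ) s.2 * (z - π k z).2 = 0) (u : unitaryGroup ι ℂ) (t : ℂ ⊗[ℝ] V) :
    ((chartRot Φ u • coordSub (complexChart Φ) c S).map
      (hermitianChart Φ : ℂ ⊗[ℝ] V →ₗ[ℂ] _)).starProjection (hermitianChart Φ t) =
    hermitianChart Φ ((complexChart ((chartRot Φ u).symm.trans Φ)).symm
      fun i => π (c i) (complexChart ((chartRot Φ u).symm.trans Φ) t i)) := by
  rw [smul_coordSub_complexChart]
  refine Submodule.eq_starProjection_of_mem_orthogonal ?_ ?_
  · refine ⟨_, fun i => ?_, rfl⟩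
    rw [LinearEquiv.apply_symm_apply]
    exact h1 _ _
  · rw [Submodule.mem_orthogonal]
    rintro _ ⟨s, hs, rfl⟩
    rw [← map_sub]
    change (inner ℂ (hermitianChart Φ s) _ : ℂ) = 0
    rw [inner_hermitianChart_chartRot u, inner_hermitianChart]
    refine Finset.sum_eq_zero fun i _ => ?_
    rw [map_sub, Pi.sub_apply, LinearEquiv.apply_symm_apply]
    exact h2 _ _ _ (hs i)

/-- Pass to the rotated chart, project each coordinate, and return. Only the first component is
needed: it is the mean of the two coordinates for colour `0`, the first for colour `1`, and zero for
colour `2`. The transpose arises because second coordinates change by the conjugate of `u`. -/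
lemma projBlocks_coordSub {S : Fin 3 → Submodule ℂ (ℂ × ℂ)} (hS : HasModelProjections S)
    (u : unitaryGroup ι ℂ) :
    projBlocks Φ (chartRot Φ u • coordSub (complexChart Φ) c S) =
      ((2⁻¹ : ℝ) • (u.1 * BlockModel.diagProj c 0 * u.1ᴴ) + u.1 * BlockModel.diagProj c 1 * u.1ᴴ,
        (2⁻¹ : ℝ) • (u.1 * BlockModel.diagProj c 0 * u.1ᵀ)) := by
  obtain ⟨π, h1, h2, p0, p1, p2⟩ := hS
  have hsym : ∀ v, ((chartRot Φ u).symm.trans Φ) v = u.1ᴴ *ᵥ Φ v := chart_chartRot_symm Φ u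
  have hB := fun t i => complexChart_eq_mulVec hsym t i
  have hA := fun t i => complexChart_eq_mulVec (chart_eq_mulVec_chartRot (Φ := Φ) u) t i
  have hp : ∀ k z, (π k z).1 = (if k = 0 then 2⁻¹ * (z.1 + z.2) else 0) + if k = 1 then z.1 else 0 :=
    fun k z => by
      rcases Fin.eq_zero_or_one_or_two k with rfl | rfl | rfl
      · simp [p0]
      · simp [p1]
      · simp [p2]
  have key : ∀ w i, ((chartRot Φ u • coordSub (complexChart Φ) c S).map (hermitianChart Φ :
      ℂ ⊗[ℝ] V →ₗ[ℂ] EuclideanSpace ℂ (ι ⊕ ι))).starProjection w (Sum.inl i) =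
      ∑ k, u.1 i k * ((if c k = 0 then 2⁻¹ * (∑ j, (starRingEnd ℂ) (u.1 j k) * w (Sum.inl j) +
        ∑ j, u.1 j k * w (Sum.inr j)) else 0) +
        if c k = 1 then ∑ j, (starRingEnd ℂ) (u.1 j k) * w (Sum.inl j) else 0) := fun w i => by
    obtain ⟨t, rfl⟩ := (hermitianChart Φ).surjective w
    rw [starProjection_coordSub h1 h2, hermitianChart_inl, hA]
    refine Finset.sum_congr rfl fun k _ => ?_
    rw [LinearEquiv.apply_symm_apply, hp, hB]
    simp only [hermitianChart_inl, hermitianChart_inr, Matrix.conjTranspose_apply, RCLike.star_def,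
      Complex.conj_conj]
  refine Prod.ext (Matrix.ext fun i j => ?_) (Matrix.ext fun i j => ?_)
  · rw [projBlocks]
    dsimp only
    rw [key, Matrix.add_apply, Matrix.smul_apply, Matrix.mul_apply, Matrix.mul_apply,
      Finset.smul_sum, ← Finset.sum_add_distrib]
    refine Finset.sum_congr rfl fun k _ => ?_
    rw [BlockModel.mul_diagProj_apply, BlockModel.mul_diagProj_apply, Complex.real_smul]
    have e1 : ∑ j', (starRingEnd ℂ) (u.1 j' k) *
        (EuclideanSpace.single (Sum.inl j : ι ⊕ ι) (1 : ℂ)) (Sum.inl j') =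
        (starRingEnd ℂ) (u.1 j k) := by
      rw [Finset.sum_eq_single j]
      · simp
      · intro b _ hb
        simp [hb]
      · simp
    have e2 : ∑ j', u.1 j' k *
        (EuclideanSpace.single (Sum.inl j : ι ⊕ ι) (1 : ℂ)) (Sum.inr j') = 0 :=
      Finset.sum_eq_zero fun b _ => by simp
    rw [e1, e2, Matrix.conjTranspose_apply, RCLike.star_def]
    split_ifs <;> push_cast <;> ring
  · rw [projBlocks]
    dsimp only
    rw [key, Matrix.smul_apply, Matrix.mul_apply, Finset.smul_sum]
    refine Finset.sum_congr rfl fun k _ => ?_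
    rw [BlockModel.mul_diagProj_apply, Complex.real_smul]
    have e1 : ∑ j', u.1 j' k *
        (EuclideanSpace.single (Sum.inr j : ι ⊕ ι) (1 : ℂ)) (Sum.inr j') = u.1 j k := by
      rw [Finset.sum_eq_single j]
      · simp
      · intro b _ hb
        simp [hb]
      · simp
    have e2 : ∑ j', (starRingEnd ℂ) (u.1 j' k) *
        (EuclideanSpace.single (Sum.inr j : ι ⊕ ι) (1 : ℂ)) (Sum.inl j') = 0 :=
      Finset.sum_eq_zero fun b _ => by simp
    rw [e1, e2, Matrix.transpose_apply]
    split_ifs <;> push_cast <;> ring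

/-- With `Q = ½ u D₀ uᵀ` the second block, `2 Q Q* = ½ u D₀ u*` is exactly the unwanted term of the
first block, since `uᵀ` is unitary and `D₀` is idempotent. -/
lemma modelInvariant_coordSub {S : Fin 3 → Submodule ℂ (ℂ × ℂ)} (hS : HasModelProjections S)
    (u : unitaryGroup ι ℂ) :
    modelInvariant Φ (chartRot Φ u • coordSub (complexChart Φ) c S) =
      BlockModel.act u.1 (BlockModel.basePair c) := by
  rw [modelInvariant, projBlocks_coordSub hS, BlockModel.act, BlockModel.basePair]
  have h : u.1 * BlockModel.diagProj c 0 * u.1ᵀ * (u.1 * BlockModel.diagProj c 0 * u.1ᵀ)ᴴ =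
      u.1 * BlockModel.diagProj c 0 * u.1ᴴ := by
    rw [conjTranspose_mul, conjTranspose_mul, BlockModel.diagProj_conjTranspose]
    calc _ = u.1 * BlockModel.diagProj c 0 * (u.1ᵀ * u.1ᵀᴴ) * BlockModel.diagProj c 0 * u.1ᴴ := by
          simp only [Matrix.mul_assoc]
      _ = _ := by
          have : u.1ᵀ * u.1ᵀᴴ = 1 := BlockModel.transpose_mul_conj u
          rw [this, Matrix.mul_one, Matrix.mul_assoc u.1, BlockModel.diagProj_mul_self]
  refine Prod.ext ?_ ?_
  · dsimp only
    rw [smul_smul]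
    norm_num
  · dsimp only
    rw [conjTranspose_smul, smul_mul_smul_comm, h, smul_smul]
    norm_num

end Charts

section Smooth

open scoped ContDiff

variable {V : Type*} [AddCommGroup V] [Module ℝ V] {ι : Type*} [Fintype ι] [DecidableEq ι]
  [FiniteDimensional ℝ V]

attribute [local instance] Matrix.linftyOpNormedRing Matrix.linftyOpNormedAlgebra

theorem dSmooth_modelInvariant (Φ : V ≃ₗ[ℝ] (ι → ℂ)) : DSmooth (modelInvariant Φ) := by
  intro n p hp
  have hproj := fun w => contDiff_starProjection_map (hermitianChart Φ) hp w
  have hev : ∀ i : ι ⊕ ι, ContDiff ℝ ∞ fun w : EuclideanSpace ℂ (ι ⊕ ι) => w i := fun i =>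
    BlockModel.contDiff_of_isLinearMap ⟨fun _ _ => rfl, fun _ _ => rfl⟩
  have h1 : ContDiff ℝ ∞ fun t => (projBlocks Φ (p t)).1 :=
    BlockModel.contDiff_matrix fun i j => (hev _).comp (hproj _)
  have h2 : ContDiff ℝ ∞ fun t => (projBlocks Φ (p t)).2 :=
    BlockModel.contDiff_matrix fun i j => (hev _).comp (hproj _)
  have h3 : ContDiff ℝ ∞ fun t => ((projBlocks Φ (p t)).2)ᴴ :=
    BlockModel.contDiff_conjTranspose.comp h2
  exact isPlot_prod_iff.2 ⟨isPlot_iff_contDiff.2 (h2.const_smul _),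
    isPlot_iff_contDiff.2 (h1.sub ((h2.mul h3).const_smul _))⟩

end Smooth

end

/-! ### The orbits of `K` -/

noncomputable section

open Matrix BlockModel

section Orbit

variable {V : Type*} [AddCommGroup V] [Module ℝ V]
  {ω : LinearMap.BilinForm ℝ V} {J : V →ₗ[ℝ] V} {ι : Type*} [Fintype ι] [DecidableEq ι]
  {Φ : V ≃ₗ[ℝ] (ι → ℂ)} {c : ι → Fin 3}
  {X : Type*} [DiffeologicalSpace X] [MulAction (V ≃ₗ[ℝ] V) X] {x : X} {M : Set X}

/-- An orbit with a smooth invariant separating its points is diffeomorphic to the model. -/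
theorem exists_diffeomorphism_modelSet (hsm : DSmooth fun k : V ≃ₗ[ℝ] V => k • x)
    (hblock : ∀ h : unitaryGroup ι ℂ, IsBlock c h.1 → chartRot Φ h • x = x)
    {ρ : X → Matrix ι ι ℂ × Matrix ι ι ℂ} (hρ : DSmooth ρ)
    (hρx : ∀ u : unitaryGroup ι ℂ, ρ (chartRot Φ u • x) = act u.1 (basePair c))
    (hM : ∀ y, y ∈ M ↔ ∃ u : unitaryGroup ι ℂ, y = chartRot Φ u • x) :
    ∃ Ξ : modelSet c ≃ M, IsDiffeomorphism Ξ ∧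
      ∀ u, (Ξ (orbitMap c u) : X) = chartRot Φ u • x := by
  -- An arbitrary set-theoretic section suffices: two choices differ by a block matrix, which fixes
  -- `x`. Smoothness comes later from local lifts.
  choose s hs using orbitMap_surjective c
  let f : modelSet c → M := fun y => ⟨chartRot Φ (s y) • x, (hM _).2 ⟨_, rfl⟩⟩
  have hf : ∀ u, (f (orbitMap c u) : X) = chartRot Φ u • x := fun u => by
    have h1 : act (s (orbitMap c u)).1 (basePair c) = act u.1 (basePair c) :=
      congrArg Subtype.val (hs (orbitMap c u))
    have h2 := hblock _ ((act_eq_act_iff c _ _).1 h1)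
    change chartRot Φ (s (orbitMap c u)) • x = _
    conv_lhs => rw [← h2]
    rw [← mul_smul, ← map_mul, mul_inv_cancel_left]
  have hρf : ∀ y, ρ (f y) = y := fun y => by
    obtain ⟨u, rfl⟩ := orbitMap_surjective c y
    rw [hf, hρx]
    rfl
  have hρM : ∀ m : M, ρ m ∈ modelSet c := fun m => by
    obtain ⟨u, hu⟩ := (hM m).1 m.2
    rw [hu, hρx]
    exact ⟨u, rfl⟩
  have hfs : ∀ m : M, ∃ u, f (orbitMap c u) = m := fun m => by
    obtain ⟨u, hu⟩ := (hM m).1 m.2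
    exact ⟨u, Subtype.ext ((hf u).trans hu.symm)⟩
  let Ξ : modelSet c ≃ M :=
    { toFun := f
      invFun := fun m => ⟨ρ m, hρM m⟩
      left_inv := fun y => Subtype.ext (hρf y)
      right_inv := fun m => by
        obtain ⟨u, rfl⟩ := hfs m
        congr 1
        exact Subtype.ext (hρf _) }
  refine ⟨Ξ, ⟨(locallyLifts_orbitMap c).dSmooth ?_, ?_⟩, hf⟩
  · have h1 : DSmooth fun u : unitaryGroup ι ℂ => chartRot Φ u • x :=
      hsm.comp dSmooth_chartRot
    refine dSmooth_subtype_iff.2 ?_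
    convert h1 using 1
    exact funext hf
  · exact dSmooth_subtype_iff.2 (hρ.comp dSmooth_subtype_val)

omit [DiffeologicalSpace X] in
lemma orbit_eq_of_chart (hΦ : IsUnitaryChart ω J Φ)
    (hM : ∀ y, y ∈ M ↔ ∃ u : unitaryGroup ι ℂ, y = chartRot Φ u • x) {y : X} (hy : y ∈ M) :
    MulAction.orbit (commutingSymplecticGroup ω J) y = M := by
  obtain ⟨u₀, rfl⟩ := (hM y).1 hy
  ext z
  rw [hM, MulAction.mem_orbit_iff]
  constructor
  · rintro ⟨⟨k, hk⟩, rfl⟩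
    obtain ⟨u, rfl⟩ := exists_chartRot_eq hΦ hk
    refine ⟨u * u₀, ?_⟩
    rw [map_mul, mul_smul]
    rfl
  · rintro ⟨u, rfl⟩
    refine ⟨⟨chartRot Φ (u * u₀⁻¹), chartRot_mem hΦ _⟩, ?_⟩
    change chartRot Φ (u * u₀⁻¹) • chartRot Φ u₀ • x = _
    rw [← mul_smul, ← map_mul, inv_mul_cancel_right]

/-- Plots of `M` pass to the model, lift locally to `U(n)`, and return to `K`. The lift is corrected
by `u₀⁻¹` on the right because the base point is `y`, the rotation of `x` by `u₀`. -/
theorem orbitMapIsDiffeomorphism_of_chart (hΦ : IsUnitaryChart ω J Φ)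
    (hsm : ∀ y : X, DSmooth fun k : V ≃ₗ[ℝ] V => k • y)
    {Ξ : modelSet c ≃ M} (hΞ : IsDiffeomorphism Ξ)
    (hΞx : ∀ u, (Ξ (orbitMap c u) : X) = chartRot Φ u • x)
    (hM : ∀ y, y ∈ M ↔ ∃ u : unitaryGroup ι ℂ, y = chartRot Φ u • x) {y : X} (hy : y ∈ M) :
    OrbitMapIsDiffeomorphism (commutingSymplecticGroup ω J) M y := by
  have horb := orbit_eq_of_chart hΦ hM hy
  obtain ⟨u₀, rfl⟩ := (hM y).1 hy
  let f : commutingSymplecticGroup ω J → M := fun k =>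
    ⟨k • (chartRot Φ u₀ • x), horb ▸ MulAction.mem_orbit _ k⟩
  have hf : DSmooth f := dSmooth_subtype_iff.2
    ((hsm (chartRot Φ u₀ • x)).comp dSmooth_subtype_val)
  have hfs : Function.Surjective f := fun m => by
    have hm : (m : X) ∈ MulAction.orbit (commutingSymplecticGroup ω J) (chartRot Φ u₀ • x) := by
      rw [horb]
      exact m.2
    obtain ⟨k, hk⟩ := hm
    exact ⟨k, Subtype.ext hk⟩
  have hl : LocallyLifts f := fun n p hp t => by
    obtain ⟨r, hr, q, hq, hpq⟩ := locallyLifts_orbitMap c n _ (hΞ.2 n p hp) t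
    refine ⟨r, hr, fun s => ⟨chartRot Φ (q s * u₀⁻¹), chartRot_mem hΦ _⟩, ?_, fun s => ?_⟩
    · have h1 : IsPlot fun s => q s * u₀⁻¹ :=
        isPlot_ofVectorSpace_comp (p := fun s => (q s).1) hq
          (LinearMap.mulRight ℝ (u₀⁻¹ : unitaryGroup ι ℂ).1)
      exact isPlot_subtype_iff.2 (dSmooth_chartRot _ _ h1)
    · have h1 := hpq s
      apply Subtype.ext
      change _ = chartRot Φ (q s * u₀⁻¹) • chartRot Φ u₀ • x
      rw [← mul_smul, ← map_mul, inv_mul_cancel_right, ← hΞx, ← h1]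
      exact congrArg Subtype.val (Ξ.apply_symm_apply _).symm
  obtain ⟨Ψ, hΨ, h⟩ := exists_diffeomorphism_quotient
    (MulAction.stabilizer (commutingSymplecticGroup ω J) (chartRot Φ u₀ • x)) hf hl hfs
    fun k k' => by
      rw [MulAction.mem_stabilizer_iff, mul_smul, inv_smul_eq_iff, Subtype.ext_iff, eq_comm]
  exact ⟨Ψ, hΨ, fun k => congrArg Subtype.val (h k)⟩

/-- On the rotated base points `φ` acts as forgetting the second matrix does on the model; both
identifications then carry the model bundle over. -/
theorem exists_isSmoothFiberBundle_restrict {F : Type*} [DiffeologicalSpace F]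
    (hF : IsSmoothFiberBundle F (modelMap c)) {B : Set (Submodule ℝ V)} {W : Submodule ℝ V}
    {Ξ : modelSet c ≃ M} (hΞ : IsDiffeomorphism Ξ)
    (hΞx : ∀ u, (Ξ (orbitMap c u) : X) = chartRot Φ u • x)
    {Ξ' : modelSet (mergeColor c) ≃ B} (hΞ' : IsDiffeomorphism Ξ')
    (hΞx' : ∀ u, (Ξ' (orbitMap (mergeColor c) u) : Submodule ℝ V) = chartRot Φ u • W)
    {φ : X → Submodule ℝ V} (hφ : ∀ u : unitaryGroup ι ℂ,
      φ (chartRot Φ u • x) = chartRot Φ u • W) :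
    ∃ h : Set.MapsTo φ M B, IsSmoothFiberBundle F h.restrict := by
  have key : ∀ m : M, φ m = Ξ' (modelMap c (Ξ.symm m)) := fun m => by
    obtain ⟨u, hu⟩ := orbitMap_surjective c (Ξ.symm m)
    have hm : m = Ξ (orbitMap c u) := by rw [hu, Ξ.apply_symm_apply]
    rw [← hu, modelMap_orbitMap, hΞx', hm, hΞx, hφ]
  have h : Set.MapsTo φ M B := fun m hm => by
    rw [key ⟨m, hm⟩]
    exact (Ξ' _).2
  refine ⟨h, hF.of_diffeomorphisms Ξ.symm hΞ.symm Ξ'.symm hΞ'.symm fun m => ?_⟩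
  rw [Equiv.symm_apply_eq]
  exact Subtype.ext (key m)

end Orbit

/-! ### The three spaces as unitary orbits -/

section Models

variable {V : Type*} [AddCommGroup V] [Module ℝ V]
  {ω : LinearMap.BilinForm ℝ V} {J : V →ₗ[ℝ] V} {ι : Type*} [Fintype ι] [DecidableEq ι]
  {Φ : V ≃ₗ[ℝ] (ι → ℂ)} (c : ι → Fin 3)

/-- One statement covers the three models: complexified real subspaces (`A = ⊤`, `B = ⊥`),
Lagrangians (`A` and `B` the axes), and first members of splitting classes (`A` the first axis, `B =
⊥`). Their projections agree in the first component, so a single invariant inverts all three orbit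
maps. -/
lemma hasModelProjections {A B : Submodule ℂ (ℂ × ℂ)} (hA : A = fstLine ∨ A = ⊤)
    (hB : B = ⊥ ∨ B = sndLine) : HasModelProjections ![diagLine, A, B] := by
  obtain ⟨α, hα1, hα2, hα3⟩ : ∃ α : ℂ × ℂ → ℂ × ℂ, (∀ z, α z ∈ A) ∧
      (∀ z, ∀ s ∈ A, (starRingEnd ℂ) s.1 * (z - α z).1 + (starRingEnd ℂ) s.2 * (z - α z).2 = 0) ∧
      ∀ z, (α z).1 = z.1 := by
    rcases hA with rfl | rfl
    · exact ⟨fun z => (z.1, 0), fun z => mem_fstLine.2 rfl,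
        fun z s hs => by simp [mem_fstLine.1 hs], fun z => rfl⟩
    · exact ⟨id, fun z => trivial, fun z s hs => by simp, fun z => rfl⟩
  obtain ⟨β, hβ1, hβ2, hβ3⟩ : ∃ β : ℂ × ℂ → ℂ × ℂ, (∀ z, β z ∈ B) ∧
      (∀ z, ∀ s ∈ B, (starRingEnd ℂ) s.1 * (z - β z).1 + (starRingEnd ℂ) s.2 * (z - β z).2 = 0) ∧
      ∀ z, (β z).1 = 0 := by
    rcases hB with rfl | rfl
    · exact ⟨fun _ => 0, fun z => zero_mem _,
        fun z s hs => by simp [(Submodule.mem_bot ℂ).1 hs], fun z => rfl⟩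
    · exact ⟨fun z => (0, z.2), fun z => mem_sndLine.2 rfl,
        fun z s hs => by simp [mem_sndLine.1 hs], fun z => rfl⟩
  refine ⟨![fun z => (2⁻¹ * (z.1 + z.2), 2⁻¹ * (z.1 + z.2)), α, β], fun k z => ?_,
    fun k z s hs => ?_, fun z => rfl, hα3, hβ3⟩
  · rcases Fin.eq_zero_or_one_or_two k with rfl | rfl | rfl
    · exact mem_diagLine.2 rfl
    · exact hα1 z
    · exact hβ1 z
  · rcases Fin.eq_zero_or_one_or_two k with rfl | rfl | rfl
    · have h := mem_diagLine.1 hs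
      change (starRingEnd ℂ) s.1 * (z.1 - 2⁻¹ * (z.1 + z.2)) +
        (starRingEnd ℂ) s.2 * (z.2 - 2⁻¹ * (z.1 + z.2)) = 0
      rw [h]
      ring
    · exact hα2 z s hs
    · exact hβ2 z s hs

omit [DecidableEq ι] in
lemma baseChange_coordSub_typeLines (Φ : V ≃ₗ[ℝ] (ι → ℂ)) :
    (coordSub Φ c typeLines).baseChange ℂ =
      coordSub (complexChart Φ) c ![diagLine, ⊤, ⊥] := by
  refine baseChange_coordSub Φ c (fun k z hz => ?_) fun k z hz => ?_
  · rcases Fin.eq_zero_or_one_or_two k with rfl | rfl | rfl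
    · exact mem_diagLine.2 (Complex.conj_eq_iff_im.2 hz).symm
    · trivial
    · have : z = 0 := (Submodule.mem_bot ℝ).1 hz
      subst this
      rw [map_zero]
      exact zero_mem _
  · rcases Fin.eq_zero_or_one_or_two k with rfl | rfl | rfl
    · rw [mem_diagLine.1 hz, Complex.add_conj, ← Complex.ofReal_ofNat, ← Complex.ofReal_div]
      exact Complex.ofReal_im (2 * z.2.re / 2)
    · trivial
    · have : z = 0 := (Submodule.mem_bot ℂ).1 hz
      subst this
      simp

lemma smul_mem_lines {S : Fin 3 → Submodule ℂ (ℂ × ℂ)} (h1 : S 1 = fstLine)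
    (h2 : S 2 = ⊥ ∨ S 2 = sndLine) :
    ∀ k ≠ 0, ∀ z, ∀ s ∈ S k, (s.1 * z, s.2 * (starRingEnd ℂ) z) ∈ S k := by
  intro k hk z s hs
  rcases Fin.eq_zero_or_one_or_two k with rfl | rfl | rfl
  · exact absurd rfl hk
  · rw [h1] at hs ⊢
    exact mem_fstLine.2 (by simp [mem_fstLine.1 hs])
  · rcases h2 with h2 | h2 <;> rw [h2] at hs ⊢
    · rw [(Submodule.mem_bot ℂ).1 hs]
      simp
    · exact mem_sndLine.2 (by simp [mem_sndLine.1 hs])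

variable (hΦ : IsUnitaryChart ω J Φ)
include hΦ

lemma mem_grassmannianJ_iff [FiniteDimensional ℝ V] (hω : ω.IsAlt) (hn : ω.Nondegenerate)
    (hJ : IsCompatibleComplexStructure ω J) (W : Submodule ℝ V) :
    W ∈ grassmannianJ ω J (colorCard c 0) (colorCard c 1) (colorCard c 2) ↔
      ∃ u : unitaryGroup ι ℂ, W = chartRot Φ u • coordSub Φ c typeLines := by
  refine ⟨hΦ.exists_eq_chartRot_smul c hω hn hJ, ?_⟩
  rintro ⟨u, rfl⟩
  rw [smul_coordSub]
  exact (hΦ.symm_trans (chartRot_mem hΦ u)).coordSub_mem_grassmannianJ c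

lemma mem_lagrangianJ_iff (F : Submodule ℂ (ℂ ⊗[ℝ] V)) :
    F ∈ lagrangianJ ω J (colorCard c 0) (colorCard c 1) (colorCard c 2) ↔
      ∃ u : unitaryGroup ι ℂ, F = chartRot Φ u • coordSub (complexChart Φ) c lagLines := by
  refine ⟨hΦ.exists_eq_chartRot_smul_lagrangian c, ?_⟩
  rintro ⟨u, rfl⟩
  rw [smul_coordSub_complexChart]
  exact (hΦ.symm_trans (chartRot_mem hΦ u)).coordSub_mem_lagrangianJ c

/-- The model class of splittings. -/
def splitModel (Φ : V ≃ₗ[ℝ] (ι → ℂ)) (c : ι → Fin 3) :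
    Submodule ℂ (ℂ ⊗[ℝ] V) × Submodule ℂ (ℂ ⊗[ℝ] V) :=
  (coordSub (complexChart Φ) c nonnegLines, coordSub (complexChart Φ) c nonposLines)

omit [DecidableEq ι] hΦ in
lemma smul_splitModel (k : V ≃ₗ[ℝ] V) :
    k • splitModel Φ c = splitModel (k.symm.trans Φ) c :=
  Prod.ext (smul_coordSub_complexChart k c _) (smul_coordSub_complexChart k c _)

lemma mem_splitLagrangianJ_iff
    (A : Submodule ℂ (ℂ ⊗[ℝ] V) × Submodule ℂ (ℂ ⊗[ℝ] V)) :
    A ∈ splitLagrangianJ ω J (colorCard c 0) (colorCard c 1) (colorCard c 2) ↔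
      ∃ u : unitaryGroup ι ℂ, A = chartRot Φ u • splitModel Φ c := by
  rw [splitLagrangianJ_eq_image hΦ]
  have h : ∀ u : unitaryGroup ι ℂ, splittingClass ω
      (chartRot Φ u • coordSub (complexChart Φ) c lagLines)
      (chartRot Φ u • coordSub (complexChart Φ) c lagLines ⊓ eigenPlus J)
      (chartRot Φ u • coordSub (complexChart Φ) c lagLines ⊓ eigenMinus J) =
      chartRot Φ u • splitModel Φ c := fun u => by
    rw [smul_splitModel, smul_coordSub_complexChart,
      (hΦ.symm_trans (chartRot_mem hΦ u)).splittingClass_coordSub]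
    rfl
  constructor
  · rintro ⟨F, hF, rfl⟩
    obtain ⟨u, rfl⟩ := (mem_lagrangianJ_iff c hΦ F).1 hF
    exact ⟨u, h u⟩
  · rintro ⟨u, rfl⟩
    exact ⟨_, (mem_lagrangianJ_iff c hΦ _).2 ⟨u, rfl⟩, h u⟩

theorem exists_diffeomorphism_grassmannianJ [FiniteDimensional ℝ V] (hω : ω.IsAlt) (hn : ω.Nondegenerate)
    (hJ : IsCompatibleComplexStructure ω J) :
    ∃ Ξ : modelSet c ≃ grassmannianJ ω J (colorCard c 0) (colorCard c 1) (colorCard c 2),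
      IsDiffeomorphism Ξ ∧ ∀ u, (Ξ (orbitMap c u) : Submodule ℝ V) =
        chartRot Φ u • coordSub Φ c typeLines := by
  refine exists_diffeomorphism_modelSet (dSmooth_smul_submodule _)
    (fun h hh => chartRot_smul_coordSub_of_isBlock hh fun k hk z s hs => ?_)
    ((dSmooth_modelInvariant Φ).comp dSmooth_baseChange) (fun u => ?_)
    (mem_grassmannianJ_iff c hΦ hω hn hJ)
  · rcases Fin.eq_zero_or_one_or_two k with rfl | rfl | rfl
    · exact absurd rfl hk
    · trivial
    · have : s = 0 := (Submodule.mem_bot ℝ).1 hs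
      rw [this, zero_mul]
      exact zero_mem _
  · rw [Function.comp_apply, smul_coordSub, baseChange_coordSub_typeLines,
      ← smul_coordSub_complexChart]
    exact modelInvariant_coordSub (hasModelProjections (.inr rfl) (.inl rfl)) u

theorem exists_diffeomorphism_lagrangianJ [FiniteDimensional ℝ V] :
    ∃ Ξ : modelSet c ≃ lagrangianJ ω J (colorCard c 0) (colorCard c 1) (colorCard c 2),
      IsDiffeomorphism Ξ ∧ ∀ u, (Ξ (orbitMap c u) : Submodule ℂ (ℂ ⊗[ℝ] V)) =
        chartRot Φ u • coordSub (complexChart Φ) c lagLines :=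
  exists_diffeomorphism_modelSet (dSmooth_smul_complexSubmodule _)
    (fun _ hh => chartRot_smul_complexCoordSub_of_isBlock hh (smul_mem_lines rfl (.inr rfl)))
    (dSmooth_modelInvariant Φ)
    (modelInvariant_coordSub (hasModelProjections (.inl rfl) (.inr rfl)))
    (mem_lagrangianJ_iff c hΦ)

omit hΦ in
lemma dSmooth_smul_pair [FiniteDimensional ℝ V] (A : Submodule ℂ (ℂ ⊗[ℝ] V) × Submodule ℂ (ℂ ⊗[ℝ] V)) :
    DSmooth fun k : V ≃ₗ[ℝ] V => k • A :=
  (dSmooth_smul_complexSubmodule A.1).prodMk (dSmooth_smul_complexSubmodule A.2)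

theorem exists_diffeomorphism_splitLagrangianJ [FiniteDimensional ℝ V] :
    ∃ Ξ : modelSet c ≃ splitLagrangianJ ω J (colorCard c 0) (colorCard c 1) (colorCard c 2),
      IsDiffeomorphism Ξ ∧ ∀ u,
        (Ξ (orbitMap c u) : Submodule ℂ (ℂ ⊗[ℝ] V) × Submodule ℂ (ℂ ⊗[ℝ] V)) =
          chartRot Φ u • splitModel Φ c :=
  exists_diffeomorphism_modelSet (dSmooth_smul_pair _)
    (fun _ hh => Prod.ext
      (chartRot_smul_complexCoordSub_of_isBlock hh (smul_mem_lines rfl (.inl rfl)))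
      (chartRot_smul_complexCoordSub_of_isBlock hh fun k hk z s hs => by
        rcases Fin.eq_zero_or_one_or_two k with rfl | rfl | rfl
        · exact absurd rfl hk
        · rw [(Submodule.mem_bot ℂ).1 hs, Prod.fst_zero, Prod.snd_zero, zero_mul, zero_mul]
          exact zero_mem _
        · exact mem_sndLine.2 (by simp [mem_sndLine.1 hs])))
    -- The first member `F₀ ⊕ F₊` alone already determines both matrices.
    ((dSmooth_modelInvariant Φ).comp dSmooth_fst)
    (modelInvariant_coordSub (hasModelProjections (.inl rfl) (.inl rfl)))
    (mem_splitLagrangianJ_iff c hΦ)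

omit [Fintype ι] [DecidableEq ι] hΦ in
-- The radical of the model is the model for the merged colouring, so the reduction maps are matched
-- with `modelMap`.
lemma coordSub_mergeColor (Φ : V ≃ₗ[ℝ] (ι → ℂ)) :
    coordSub Φ (mergeColor c) typeLines = coordSub Φ c radicalLines := by
  ext v
  refine forall_congr' fun i => ?_
  rcases Fin.eq_zero_or_one_or_two (c i) with h | h | h <;> rw [mergeColor, h] <;> rfl

lemma symplecticRadical_chartRot_smul (u : unitaryGroup ι ℂ) :
    symplecticRadical ω (chartRot Φ u • coordSub Φ c typeLines) =
      chartRot Φ u • coordSub Φ (mergeColor c) typeLines := by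
  rw [smul_coordSub, smul_coordSub,
    (hΦ.symm_trans (chartRot_mem hΦ u)).symplecticRadical_coordSub, coordSub_mergeColor]

lemma reKernel_chartRot_smul (u : unitaryGroup ι ℂ) :
    reKernel ω (chartRot Φ u • coordSub (complexChart Φ) c lagLines) =
      chartRot Φ u • coordSub Φ (mergeColor c) typeLines := by
  rw [smul_coordSub_complexChart, smul_coordSub,
    (hΦ.symm_trans (chartRot_mem hΦ u)).reKernel_coordSub, coordSub_mergeColor]

lemma alphaMap_chartRot_smul (u : unitaryGroup ι ℂ) :
    alphaMap ω (chartRot Φ u • splitModel Φ c) =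
      chartRot Φ u • coordSub Φ (mergeColor c) typeLines := by
  rw [← reKernel_chartRot_smul c hΦ u, smul_splitModel, smul_coordSub_complexChart, alphaMap,
    forgetSplitting, splitModel, coordSub_sup, nonnegLines_sup_nonposLines]

end Models

lemma colorCard_eq_sum {ι : Type*} [Fintype ι] (c : ι → Fin 3) (k : Fin 3) :
    colorCard c k = ∑ i, if c i = k then 1 else 0 :=
  Finset.card_filter _ _

lemma colorCard_blockColor (n₀ p q : ℕ) : colorCard (blockColor n₀ p q) 0 = n₀ ∧
    colorCard (blockColor n₀ p q) 1 = p ∧ colorCard (blockColor n₀ p q) 2 = q := by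
  simp only [colorCard_eq_sum, Fintype.sum_sum_type, blockColor, Sum.elim_inl, Sum.elim_inr]
  simp

lemma colorCard_mergeColor_blockColor (n₀ p q : ℕ) :
    colorCard (mergeColor (blockColor n₀ p q)) 0 = n₀ ∧
    colorCard (mergeColor (blockColor n₀ p q)) 1 = 0 ∧
    colorCard (mergeColor (blockColor n₀ p q)) 2 = p + q := by
  simp only [colorCard_eq_sum, Fintype.sum_sum_type, mergeColor, blockColor, Sum.elim_inl,
    Sum.elim_inr]
  simp

end

open BlockModel in
theorem mainTheorem3 {V : Type*} [AddCommGroup V] [Module ℝ V] [FiniteDimensional ℝ V]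
    (ω : LinearMap.BilinForm ℝ V) (hω_alt : ω.IsAlt) (hω_nondeg : ω.Nondegenerate)
    (J : V →ₗ[ℝ] V) (hJ : IsCompatibleComplexStructure ω J)
    (n₀ p q : ℕ) (hn : Module.finrank ℝ V = 2 * (n₀ + p + q)) :
    -- `K` acts transitively on the three spaces
    ((∀ W ∈ grassmannianJ ω J n₀ p q,
        MulAction.orbit (commutingSymplecticGroup ω J) W = grassmannianJ ω J n₀ p q) ∧
      (∀ F ∈ lagrangianJ ω J n₀ p q,
        MulAction.orbit (commutingSymplecticGroup ω J) F = lagrangianJ ω J n₀ p q) ∧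
      (∀ A ∈ splitLagrangianJ ω J n₀ p q,
        MulAction.orbit (commutingSymplecticGroup ω J) A = splitLagrangianJ ω J n₀ p q)) ∧
    -- the three spaces are smooth manifolds
    ((∃ d, IsSmoothManifold d (grassmannianJ ω J n₀ p q)) ∧
      (∃ d, IsSmoothManifold d (lagrangianJ ω J n₀ p q)) ∧
      (∃ d, IsSmoothManifold d (splitLagrangianJ ω J n₀ p q))) ∧
    -- for every choice of base point, the orbit map is a diffeomorphism from `K / K ∩ Sp_x(V)`
    ((∀ W ∈ grassmannianJ ω J n₀ p q,
        OrbitMapIsDiffeomorphism (commutingSymplecticGroup ω J) (grassmannianJ ω J n₀ p q) W) ∧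
      (∀ F ∈ lagrangianJ ω J n₀ p q,
        OrbitMapIsDiffeomorphism (commutingSymplecticGroup ω J) (lagrangianJ ω J n₀ p q) F) ∧
      (∀ A ∈ splitLagrangianJ ω J n₀ p q,
        OrbitMapIsDiffeomorphism (commutingSymplecticGroup ω J)
          (splitLagrangianJ ω J n₀ p q) A)) ∧
    -- the three spaces are diffeomorphic to `U(n) / (O(n₀) × U(p) × U(q))`
    (Diffeomorphic (grassmannianJ ω J n₀ p q)
        (Matrix.unitaryGroup (Fin n₀ ⊕ Fin p ⊕ Fin q) ℂ ⧸ blockSubgroup n₀ p q) ∧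
      Diffeomorphic (lagrangianJ ω J n₀ p q)
        (Matrix.unitaryGroup (Fin n₀ ⊕ Fin p ⊕ Fin q) ℂ ⧸ blockSubgroup n₀ p q) ∧
      Diffeomorphic (splitLagrangianJ ω J n₀ p q)
        (Matrix.unitaryGroup (Fin n₀ ⊕ Fin p ⊕ Fin q) ℂ ⧸ blockSubgroup n₀ p q)) ∧
    -- the restricted reduction maps are fiber bundles over the isotropic Grassmannian, with fiber
    -- the Grassmannian of complex `p`-planes in `ℂ^(n - n₀)`
    ((∃ h : Set.MapsTo (symplecticRadical ω) (grassmannianJ ω J n₀ p q)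
          (grassmannianOfType ω n₀ 0 (p + q)),
        IsSmoothFiberBundle (ComplexGrassmannian p (p + q)) h.restrict) ∧
      (∃ h : Set.MapsTo (reKernel ω) (lagrangianJ ω J n₀ p q)
          (grassmannianOfType ω n₀ 0 (p + q)),
        IsSmoothFiberBundle (ComplexGrassmannian p (p + q)) h.restrict) ∧
      (∃ h : Set.MapsTo (alphaMap ω) (splitLagrangianJ ω J n₀ p q)
          (grassmannianOfType ω n₀ 0 (p + q)),
        IsSmoothFiberBundle (ComplexGrassmannian p (p + q)) h.restrict)) := by
  have hcard : Module.finrank ℝ V = 2 * Fintype.card (Fin n₀ ⊕ Fin p ⊕ Fin q) := by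
    rw [hn]
    simp [add_assoc]
  obtain ⟨Φ, hΦ⟩ := exists_isUnitaryChart (ι := Fin n₀ ⊕ Fin p ⊕ Fin q) hω_alt hJ hcard
  obtain ⟨c0, c1, c2⟩ := colorCard_blockColor n₀ p q
  obtain ⟨m0, m1, m2⟩ := colorCard_mergeColor_blockColor n₀ p q
  have hM₁ := mem_grassmannianJ_iff (blockColor n₀ p q) hΦ hω_alt hω_nondeg hJ
  have hM₂ := mem_lagrangianJ_iff (blockColor n₀ p q) hΦ
  have hM₃ := mem_splitLagrangianJ_iff (blockColor n₀ p q) hΦ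
  have h₁ := exists_diffeomorphism_grassmannianJ (blockColor n₀ p q) hΦ hω_alt hω_nondeg hJ
  have h₂ := exists_diffeomorphism_lagrangianJ (blockColor n₀ p q) hΦ
  have h₃ := exists_diffeomorphism_splitLagrangianJ (blockColor n₀ p q) hΦ
  -- The base is described by the same theorem with the merged colouring, of type `(n₀, 0, p + q)`,
  -- for which `Gr_J` is the whole isotropic Grassmannian.
  have h := exists_diffeomorphism_grassmannianJ (mergeColor (blockColor n₀ p q)) hΦ hω_alt
    hω_nondeg hJ
  rw [m0, m1, m2, grassmannianJ_zero_eq hJ.sq] at h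
  rw [c0, c1, c2] at hM₁ hM₂ hM₃ h₁ h₂ h₃
  obtain ⟨Ξ₁, hΞ₁, hx₁⟩ := h₁
  obtain ⟨Ξ₂, hΞ₂, hx₂⟩ := h₂
  obtain ⟨Ξ₃, hΞ₃, hx₃⟩ := h₃
  obtain ⟨Ξ, hΞ, hx⟩ := h
  obtain ⟨d, hd⟩ := exists_isSmoothManifold_modelSet (blockColor n₀ p q)
  obtain ⟨Υ, hΥ⟩ := diffeomorphic_modelSet_quotient (n₀ := n₀) (p := p) (q := q)
  have hF := isSmoothFiberBundle_modelMap_blockColor (n₀ := n₀) (p := p) (q := q)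
  exact ⟨⟨fun _ => orbit_eq_of_chart hΦ hM₁, fun _ => orbit_eq_of_chart hΦ hM₂,
      fun _ => orbit_eq_of_chart hΦ hM₃⟩,
    ⟨⟨d, hd.of_diffeomorphic ⟨Ξ₁, hΞ₁⟩⟩, ⟨d, hd.of_diffeomorphic ⟨Ξ₂, hΞ₂⟩⟩,
      ⟨d, hd.of_diffeomorphic ⟨Ξ₃, hΞ₃⟩⟩⟩,
    ⟨fun _ => orbitMapIsDiffeomorphism_of_chart hΦ dSmooth_smul_submodule hΞ₁ hx₁ hM₁,
      fun _ => orbitMapIsDiffeomorphism_of_chart hΦ dSmooth_smul_complexSubmodule hΞ₂ hx₂ hM₂,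
      fun _ => orbitMapIsDiffeomorphism_of_chart hΦ dSmooth_smul_pair hΞ₃ hx₃ hM₃⟩,
    ⟨⟨_, hΞ₁.symm.trans hΥ⟩, ⟨_, hΞ₂.symm.trans hΥ⟩, ⟨_, hΞ₃.symm.trans hΥ⟩⟩,
    exists_isSmoothFiberBundle_restrict hF hΞ₁ hx₁ hΞ hx
      (symplecticRadical_chartRot_smul (blockColor n₀ p q) hΦ),
    exists_isSmoothFiberBundle_restrict hF hΞ₂ hx₂ hΞ hx
      (reKernel_chartRot_smul (blockColor n₀ p q) hΦ),
    exists_isSmoothFiberBundle_restrict hF hΞ₃ hx₃ hΞ hx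
      (alphaMap_chartRot_smul (blockColor n₀ p q) hΦ)⟩
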